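/- \textbf{Setting.} Let $n\ge 1$ and let $M$ be a connected (Hausdorff, second countable) $C^\infty$-manifold of dimension $n+1$ without boundary. Let $L:TM\to\mathbb R$ be a Lorentz--Finsler structure: $L$ is $C^\infty$ on $TM\setminus\{0\}$, $L(cv)=c^2L(v)$ for $c>0$, and $g_{\alpha\beta}(v)=\frac{\partial^2L}{\partial v^\alpha\partial v^\beta}(v)$ is non-degenerate of signature $(-,+,\dots,+)$ for all $v\ne0$; it defines the Lorentzian metric $g_v$ on $T_xM$. Let $(M,L)$ be time oriented by a smooth vector field $X$ with $L(X)<0$. Let $\Omega_x$ be the set of future-directed timelike vectors ($L(v)<0$ and $v$ in the connected component of $X(x)$ in $\overline{\{L<0\}\cap T_xM}\setminus\{0\}$), $\overline\Omega=\bigcup_x\overline{\Omega}_x$, and $F(v)=\sqrt{-2L(v)}$. Let $\psi:\overline\Omega\setminus\{0\}\to\mathbb R$ be $C^\infty$ and positively $0$-homogeneous. With $\widetilde\Gamma^\alpha_{\beta\gamma}=\frac12 g^{\alpha\delta}\big(\frac{\partial g_{\delta\gamma}}{\partial x^\beta}+\frac{\partial g_{\beta\delta}}{\partial x^\gamma}-\frac{\partial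 g_{\beta\gamma}}{\partial x^\delta}\big)$ (repeated indices are summed), put $G^\alpha(v)=\frac12\widetilde\Gamma^\alpha_{\beta\gamma}(v)v^\beta v^\gamma$, $N^\alpha_\beta=\partial G^\alpha/\partial v^\beta$, $$\Gamma^\alpha_{\beta\gamma}=\widetilde\Gamma^\alpha_{\beta\gamma}-\tfrac12 g^{\alpha\delta}\Big(\tfrac{\partial g_{\delta\gamma}}{\partial v^\mu}N^\mu_\beta+\tfrac{\partial g_{\beta\delta}}{\partial v^\mu}N^\mu_\gamma-\tfrac{\partial g_{\beta\gamma}}{\partial v^\mu}N^\mu_\delta\Big),$$ $$R^\alpha_\beta(v)=2\tfrac{\partial G^\alpha}{\partial x^\beta}-\Big(\tfrac{\partial N^\alpha_\beta}{\partial x^\gamma}v^\gamma-2\tfrac{\partial N^\alpha_\beta}{\partial v^\gamma}G^\gamma\Big)-N^\alpha_\gamma N^\gamma_\beta .$$ Let $R_v$ be the endomorphism of $T_xM$ with matrix $(R^\alpha_\beta(v))$ and $\mathrm{Ric}(v)=\operatorname{trace}R_v$. A geodesic is a smooth future-directed causal curve with $\ddot\eta^\alpha+2G^\alpha(\dot\eta)=0$;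 write $\psi_\eta(t)=\psi(\dot\eta(t))$. For $v\in\overline\Omega\setminus\{0\}$ let $\gamma$ be the geodesic defined near $0$ with $\dot\gamma(0)=v$; then $$\mathrm{Ric}_N(v)=\mathrm{Ric}(v)+\psi_\gamma''(0)-\frac{\psi_\gamma'(0)^2}{N-n}\quad(N\in\mathbb R\setminus\{n\}),\qquad \mathrm{Ric}_\infty(v)=\mathrm{Ric}(v)+\psi_\gamma''(0).$$ \textbf{Tensor fields along a geodesic.} Let $\eta$ be a future-directed timelike geodesic of unit speed, $F(\dot\eta)\equiv1$, on an interval $I$, and let $N_\eta(t)\subset T_{\eta(t)}M$ be the $n$-dimensional $g_{\dot\eta}$-orthogonal complement of $\dot\eta(t)$. A prime denotes the covariant derivative along $\eta$, $(Y')^\alpha=\dot Y^\alpha+\Gamma^\alpha_{\beta\gamma}(\dot\eta)\dot\eta^\beta Y^\gamma$ for vector fields and $E'(P)=E(P)'-E(P')$ for endomorphism fields. (If $I$ is not open, curves and tensor fields on $I$ are understood to be given, with the stated properties except nonsingularity, on an open interval containing $I$.) A Lagrange tensor field along $\eta$ is a smooth field $\mathsf J(t)$ of endomorphisms of $N_\eta(t)$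 with $\mathsf J''+R_{\dot\eta}\mathsf J=0$, $\ker\mathsf J\cap\ker\mathsf J'=\{0\}$ and $(\mathsf J')^{\mathsf T}\mathsf J-\mathsf J^{\mathsf T}\mathsf J'=0$, where $\mathsf T$ is the transpose with respect to $g_{\dot\eta}$. For $\epsilon\in\mathbb R$ let $\tau_\epsilon$ be an $\epsilon$-proper time, i.e. a primitive $\tau_\epsilon=\int e^{\frac{2(\epsilon-1)}n\psi_\eta(t)}\,dt$, and let $*$ denote the (covariant) derivative in $\tau_\epsilon$; thus $f^*=d(f\circ\tau_\epsilon^{-1})/d\tau_\epsilon$ for functions and $\eta^*=d(\eta\circ\tau_\epsilon^{-1})/d\tau_\epsilon$. Put $\mathsf J_\psi=e^{-\psi_\eta/n}\mathsf J$ and, where $\mathsf J$ is invertible, $\mathsf B_\epsilon=\mathsf J_\psi^*\mathsf J_\psi^{-1}$, $\theta_\epsilon=\operatorname{trace}\mathsf B_\epsilon$ and $\sigma_\epsilon=\mathsf B_\epsilon-\frac{\theta_\epsilon}n I_n$, where $I_n$ is the identity of $N_\eta$. \textbf{Theorem} (Timelike weighted Raychaudhuri equation). Let $\mathsf J$ be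 a Lagrange tensor field, nonsingular on $I$, along a future-directed timelike geodesic $\eta:I\to M$ of unit speed, and let $\epsilon\in\mathbb R$. Then $\theta_\epsilon$ is differentiable in $\tau_\epsilon$ and, on $I$, $$\theta_\epsilon^*+\frac{2\epsilon}n\psi_\eta^*\theta_\epsilon+\frac{\theta_\epsilon^2}n+\operatorname{trace}(\sigma_\epsilon^2)+\mathrm{Ric}_0(\eta^*)=0;$$ for every $N\in\mathbb R\setminus\{0,n\}$, $$\theta_\epsilon^*+\Big(1-\epsilon^2\frac{N-n}N\Big)\frac{\theta_\epsilon^2}n+\frac{N(N-n)}n\Big(\frac{\epsilon\theta_\epsilon}N+\frac{\psi_\eta^*}{N-n}\Big)^2+\operatorname{trace}(\sigma_\epsilon^2)+\mathrm{Ric}_N(\eta^*)=0;$$ and, for $N=+\infty$, $$\theta_\epsilon^*+(1-\epsilon^2)\frac{\theta_\epsilon^2}n+\frac1n(\epsilon\theta_\epsilon+\psi_\eta^*)^2+\operatorname{trace}(\sigma_\epsilon^2)+\mathrm{Ric}_\infty(\eta^*)=0 .$$ -/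

import Mathlib

open Set Filter Topology
open scoped Manifold ContDiff

/-- The model space `ℝ^{n+1}`, with coordinates indexed by `0, …, n`. -/
abbrev Model (n : ℕ) : Type := EuclideanSpace ℝ (Fin (n + 1))

noncomputable section

namespace LorentzFinsler

/-! ### The fundamental tensor, Lorentz--Finsler structures, Finsler spacetimes -/

section Structure

variable {n : ℕ} {M : Type*} [TopologicalSpace M] [ChartedSpace (Model n) M]

/-- The fundamental tensor `g_v` at `p = (x, v)`: the second derivative at `v` of the restriction of
`L` to the vector space `T_x M`; in fibrewise linear coordinates it is the matrix
`∂²L / ∂v^α ∂v^β (v)`. -/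
def fundTensor (L : TangentBundle (𝓡 (n + 1)) M → ℝ) (p : TangentBundle (𝓡 (n + 1)) M) :
    Model n →L[ℝ] Model n →L[ℝ] ℝ :=
  fderiv ℝ (fderiv ℝ (fun u : Model n => L ⟨p.1, u⟩)) p.2

/-- A bilinear form on `ℝ^{n+1}` is non-degenerate of signature `(-,+,…,+)`:
it has a pseudo-orthonormal basis. -/
def IsLorentzian (b : Model n →L[ℝ] Model n →L[ℝ] ℝ) : Prop :=
  ∃ e : Module.Basis (Fin (n + 1)) ℝ (Model n), ∀ i j,
    b (e i) (e j) = if i = j then (if i = 0 then -1 else 1) else 0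

end Structure

variable {n : ℕ} {M : Type*} [TopologicalSpace M] [ChartedSpace (Model n) M]
  [IsManifold (𝓡 (n + 1)) ∞ M]

/-- `L : TM → ℝ` is a Lorentz--Finsler structure on `M`. -/
structure IsLorentzFinsler (L : TangentBundle (𝓡 (n + 1)) M → ℝ) : Prop where
  smooth : ContMDiffOn (𝓡 (n + 1)).tangent 𝓘(ℝ, ℝ) ∞ L {p | p.2 ≠ 0}
  homogeneous : ∀ (x : M) (v : TangentSpace (𝓡 (n + 1)) x) (c : ℝ), 0 < c →
    L ⟨x, c • v⟩ = c ^ 2 * L ⟨x, v⟩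
  lorentzian : ∀ p : TangentBundle (𝓡 (n + 1)) M, p.2 ≠ 0 → IsLorentzian (fundTensor L p)

variable (n M) in
/-- A Finsler spacetime: a Lorentz--Finsler manifold `(M, L)` of dimension `n + 1`, time oriented by
a smooth timelike vector field `X`. -/
structure FinslerSpacetime where
  L : TangentBundle (𝓡 (n + 1)) M → ℝ
  isLorentzFinsler : IsLorentzFinsler L
  X : (x : M) → TangentSpace (𝓡 (n + 1)) x
  smooth_X : ContMDiff (𝓡 (n + 1)) (𝓡 (n + 1)).tangent ∞
    (fun x => (⟨x, X x⟩ : TangentBundle (𝓡 (n + 1)) M))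
  timelike_X : ∀ x, L ⟨x, X x⟩ < 0

/-- The set `Ω` of future-directed timelike vectors: timelike vectors in the connected component of
`X(x)` in `closure Ω'_x \ {0}`, where `Ω'_x` is the set of all timelike vectors at `x`. -/
def FinslerSpacetime.futureTimelike (S : FinslerSpacetime n M) :
    Set (TangentBundle (𝓡 (n + 1)) M) :=
  {p | S.L p < 0 ∧ p.2 ∈ connectedComponentIn
    (closure {w : TangentSpace (𝓡 (n + 1)) p.1 | S.L ⟨p.1, w⟩ < 0} \ {0}) (S.X p.1)}

/-- The set `closure Ω \ {0}` (closure in each fibre) of future-directed causal vectors. -/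
def FinslerSpacetime.futureCausal (S : FinslerSpacetime n M) :
    Set (TangentBundle (𝓡 (n + 1)) M) :=
  {p | p.2 ≠ 0 ∧ p.2 ∈ closure {w : TangentSpace (𝓡 (n + 1)) p.1 |
    (⟨p.1, w⟩ : TangentBundle (𝓡 (n + 1)) M) ∈ S.futureTimelike}}

/-- `F(v) = √(-2 L(v))`. -/
def FinslerSpacetime.F (S : FinslerSpacetime n M) (p : TangentBundle (𝓡 (n + 1)) M) : ℝ :=
  Real.sqrt (-2 * S.L p)

/-- A weight function: a smooth positively `0`-homogeneous function on the set of future-directed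
causal vectors (its values elsewhere are irrelevant). -/
structure FinslerSpacetime.IsWeight (S : FinslerSpacetime n M)
    (ψ : TangentBundle (𝓡 (n + 1)) M → ℝ) : Prop where
  smooth : ContMDiffOn (𝓡 (n + 1)).tangent 𝓘(ℝ, ℝ) ∞ ψ S.futureCausal
  homogeneous : ∀ (x : M) (v : TangentSpace (𝓡 (n + 1)) x) (c : ℝ), 0 < c →
    (⟨x, v⟩ : TangentBundle (𝓡 (n + 1)) M) ∈ S.futureCausal → ψ ⟨x, c • v⟩ = ψ ⟨x, v⟩

/-! ### Local formulas

All of the following functions are expressed in the fibrewise linear coordinates `(x^α, v^β)` of `TM`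
induced by the chart of `M` around `x₀`; they are functions of `q = (x, v) ∈ ℝ^{n+1} × ℝ^{n+1}` and
are only used for `v ≠ 0`. -/

/-- `∂f/∂x^α`. -/
def dx (α : Fin (n + 1)) (f : Model n × Model n → ℝ) (q : Model n × Model n) : ℝ :=
  fderiv ℝ f q (EuclideanSpace.single α 1, 0)

/-- `∂f/∂v^α`. -/
def dv (α : Fin (n + 1)) (f : Model n × Model n → ℝ) (q : Model n × Model n) : ℝ :=
  fderiv ℝ f q (0, EuclideanSpace.single α 1)

/-- `L` in local coordinates. -/
def coordL (L : TangentBundle (𝓡 (n + 1)) M → ℝ) (x₀ : M) (q : Model n × Model n) : ℝ :=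
  L ((chartAt (ModelProd (Model n) (Model n)) (⟨x₀, 0⟩ : TangentBundle (𝓡 (n + 1)) M)).symm q)

/-- The matrix `g_{αβ}`. -/
def coordG (L : TangentBundle (𝓡 (n + 1)) M → ℝ) (x₀ : M) (α β : Fin (n + 1))
    (q : Model n × Model n) : ℝ :=
  dv α (dv β (coordL L x₀)) q

/-- The inverse matrix `g^{αβ}`. -/
def coordGInv (L : TangentBundle (𝓡 (n + 1)) M → ℝ) (x₀ : M) (α β : Fin (n + 1))
    (q : Model n × Model n) : ℝ :=
  (Matrix.of fun i j => coordG L x₀ i j q)⁻¹ α β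

/-- The formal Christoffel symbols
`½ g^{αδ} (∂g_{δγ}/∂x^β + ∂g_{βδ}/∂x^γ - ∂g_{βγ}/∂x^δ)`. -/
def formalChristoffel (L : TangentBundle (𝓡 (n + 1)) M → ℝ) (x₀ : M) (α β γ : Fin (n + 1))
    (q : Model n × Model n) : ℝ :=
  1 / 2 * ∑ δ, coordGInv L x₀ α δ q *
    (dx β (coordG L x₀ δ γ) q + dx γ (coordG L x₀ β δ) q - dx δ (coordG L x₀ β γ) q)

/-- The coefficients `G^α` of the geodesic spray. -/
def spray (L : TangentBundle (𝓡 (n + 1)) M → ℝ) (x₀ : M) (α : Fin (n + 1))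
    (q : Model n × Model n) : ℝ :=
  1 / 2 * ∑ β, ∑ γ, formalChristoffel L x₀ α β γ q * q.2 β * q.2 γ

/-- The nonlinear connection `N^α_β = ∂G^α/∂v^β`. -/
def nonlinConn (L : TangentBundle (𝓡 (n + 1)) M → ℝ) (x₀ : M) (α β : Fin (n + 1))
    (q : Model n × Model n) : ℝ :=
  dv β (spray L x₀ α) q

/-- The coefficients `Γ^α_{βγ}` of the Chern connection. -/
def chernChristoffel (L : TangentBundle (𝓡 (n + 1)) M → ℝ) (x₀ : M) (α β γ : Fin (n + 1))
    (q : Model n × Model n) : ℝ :=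
  formalChristoffel L x₀ α β γ q - 1 / 2 * ∑ δ, ∑ μ, coordGInv L x₀ α δ q *
    (dv μ (coordG L x₀ δ γ) q * nonlinConn L x₀ μ β q
      + dv μ (coordG L x₀ β δ) q * nonlinConn L x₀ μ γ q
      - dv μ (coordG L x₀ β γ) q * nonlinConn L x₀ μ δ q)

/-- The components `R^α_β` of the curvature endomorphism. -/
def coordR (L : TangentBundle (𝓡 (n + 1)) M → ℝ) (x₀ : M) (α β : Fin (n + 1))
    (q : Model n × Model n) : ℝ :=
  2 * dx β (spray L x₀ α) q
    - ∑ γ, (dx γ (nonlinConn L x₀ α β) q * q.2 γ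
        - 2 * dv γ (nonlinConn L x₀ α β) q * spray L x₀ γ q)
    - ∑ γ, nonlinConn L x₀ α γ q * nonlinConn L x₀ γ β q

/-- The curvature endomorphism `R_v` of `T_x M` for `p = (x, v)`, computed in the chart around `x`,
by which Mathlib identifies `T_x M` with `ℝ^{n+1}`. -/
def curvature (L : TangentBundle (𝓡 (n + 1)) M → ℝ) (p : TangentBundle (𝓡 (n + 1)) M) :
    Model n →L[ℝ] Model n :=
  Matrix.toEuclideanCLM (𝕜 := ℝ) (Matrix.of fun α β => coordR L p.1 α β
    (chartAt (ModelProd (Model n) (Model n)) (⟨p.1, 0⟩ : TangentBundle (𝓡 (n + 1)) M) p))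

/-- The trace of an endomorphism of `ℝ^{n+1}`. -/
def tr (A : Model n →L[ℝ] Model n) : ℝ := LinearMap.trace ℝ (Model n) A.toLinearMap

/-- The Ricci curvature `Ric(v) = trace R_v`. -/
def ricci (L : TangentBundle (𝓡 (n + 1)) M → ℝ) (p : TangentBundle (𝓡 (n + 1)) M) : ℝ :=
  tr (curvature L p)

/-! ### Curves, geodesics, weighted Ricci curvature -/

/-- The velocity `ċ(t) ∈ T_{c(t)} M` of a curve, as a point of `TM`. -/
def velocity (c : ℝ → M) (t : ℝ) : TangentBundle (𝓡 (n + 1)) M :=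
  ⟨c t, mfderiv 𝓘(ℝ, ℝ) (𝓡 (n + 1)) c t (1 : ℝ)⟩

/-- The curve in the chart around `x₀`. -/
def coordCurve (x₀ : M) (c : ℝ → M) (t : ℝ) : Model n := chartAt (Model n) x₀ (c t)

/-- The curve and its velocity in the chart around `x₀`. -/
def coordVelocity (x₀ : M) (c : ℝ → M) (t : ℝ) : Model n × Model n :=
  (coordCurve x₀ c t, deriv (coordCurve x₀ c) t)

/-- `γ` is a (future-directed causal, smooth) geodesic on the open set `V ⊆ ℝ`: in local
coordinates, `γ̈^α + 2 G^α(γ̇) = 0`. -/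
structure FinslerSpacetime.IsGeodesicOn (S : FinslerSpacetime n M) (γ : ℝ → M) (V : Set ℝ) :
    Prop where
  smooth : ContMDiffOn 𝓘(ℝ, ℝ) (𝓡 (n + 1)) ∞ γ V
  causal : ∀ t ∈ V, velocity γ t ∈ S.futureCausal
  equation : ∀ x₀ : M, ∀ t ∈ V, γ t ∈ (chartAt (Model n) x₀).source → ∀ α,
    deriv (deriv (coordCurve x₀ γ)) t α + 2 * spray S.L x₀ α (coordVelocity x₀ γ t) = 0

/-- The function `ψ_γ(t) = ψ(γ̇(t))`. -/
def psiAlong (ψ : TangentBundle (𝓡 (n + 1)) M → ℝ) (γ : ℝ → M) (t : ℝ) : ℝ := ψ (velocity γ t)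

open Classical in
/-- The function `ψ_γ` near `0`, where `γ` is the geodesic, defined around `0`, with `γ̇(0) = p`
(the germ of `γ` at `0` is unique). -/
def FinslerSpacetime.psiGeodesic (S : FinslerSpacetime n M)
    (ψ : TangentBundle (𝓡 (n + 1)) M → ℝ) (p : TangentBundle (𝓡 (n + 1)) M) : ℝ → ℝ :=
  if h : ∃ γ : ℝ → M, ∃ δ > 0, S.IsGeodesicOn γ (Ioo (-δ) δ) ∧ velocity γ 0 = p
  then psiAlong ψ h.choose else 0

/-- The weighted Ricci curvature `Ric_N`, for real `N ≠ n`. -/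
def FinslerSpacetime.ricciN (S : FinslerSpacetime n M) (ψ : TangentBundle (𝓡 (n + 1)) M → ℝ)
    (N : ℝ) (p : TangentBundle (𝓡 (n + 1)) M) : ℝ :=
  ricci S.L p + deriv (deriv (S.psiGeodesic ψ p)) 0 - deriv (S.psiGeodesic ψ p) 0 ^ 2 / (N - n)

/-- The weighted Ricci curvature `Ric_∞`. -/
def FinslerSpacetime.ricciInfty (S : FinslerSpacetime n M)
    (ψ : TangentBundle (𝓡 (n + 1)) M → ℝ) (p : TangentBundle (𝓡 (n + 1)) M) : ℝ :=
  ricci S.L p + deriv (deriv (S.psiGeodesic ψ p)) 0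

/-! ### Endomorphism fields along a curve and their covariant derivatives -/

/-- The components, in the chart around `x₀`, of a field `A` of endomorphisms of the tangent spaces
along the curve `c`. -/
def coordEnd (x₀ : M) (c : ℝ → M)
    (A : (t : ℝ) → TangentSpace (𝓡 (n + 1)) (c t) →L[ℝ] TangentSpace (𝓡 (n + 1)) (c t))
    (t : ℝ) : Model n →L[ℝ] Model n :=
  ContinuousLinearMap.inCoordinates (Model n) (TangentSpace (𝓡 (n + 1)) : M → Type)
    (Model n) (TangentSpace (𝓡 (n + 1)) : M → Type) x₀ (c t) x₀ (c t) (A t)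

/-- The connection matrix `(∑_β Γ^α_{βγ}(ċ) ċ^β)_{αγ}` along the curve `c`, so that
`D^ċ_ċ Y = Ẏ + connMatrix Y` in the chart around `x₀` for vector fields `Y` along `c`. -/
def connMatrix (L : TangentBundle (𝓡 (n + 1)) M → ℝ) (x₀ : M) (c : ℝ → M) (t : ℝ) :
    Model n →L[ℝ] Model n :=
  Matrix.toEuclideanCLM (𝕜 := ℝ) (Matrix.of fun α γ => ∑ β,
    chernChristoffel L x₀ α β γ (coordVelocity x₀ c t) * (coordVelocity x₀ c t).2 β)

/-- The covariant derivative `D^ċ_ċ` of a field of endomorphisms along `c` in the chart around `x₀`,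
by the rule `A'(P) = (A(P))' - A(P')` for vector fields `P` along `c`. -/
def coordCovDeriv (L : TangentBundle (𝓡 (n + 1)) M → ℝ) (x₀ : M) (c : ℝ → M)
    (A : ℝ → Model n →L[ℝ] Model n) (t : ℝ) : Model n →L[ℝ] Model n :=
  deriv A t + (connMatrix L x₀ c t).comp (A t) - (A t).comp (connMatrix L x₀ c t)

/-- The `k`-th covariant derivative along `c` of a field `A` of endomorphisms of the tangent spaces
along `c`; its value at `t`, an endomorphism of `T_{c(t)} M`, is computed in the chart around
`c(t)`. -/
def covDeriv (L : TangentBundle (𝓡 (n + 1)) M → ℝ) (c : ℝ → M) (k : ℕ)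
    (A : (t : ℝ) → TangentSpace (𝓡 (n + 1)) (c t) →L[ℝ] TangentSpace (𝓡 (n + 1)) (c t))
    (t : ℝ) : Model n →L[ℝ] Model n :=
  (coordCovDeriv L (c t) c)^[k] (coordEnd (c t) c A) t

/-- The subspace of `T_x M` that is `g_v`-orthogonal to `v`, for `p = (x, v)`; for `v = η̇(t)` this
is `N_η(t)`. -/
def normalSpace (L : TangentBundle (𝓡 (n + 1)) M → ℝ) (p : TangentBundle (𝓡 (n + 1)) M) :
    Set (Model n) :=
  {w | fundTensor L p p.2 w = 0}

/-- The `g_v`-orthogonal projection of `T_x M` to `normalSpace L p`, for timelike `p = (x, v)`: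
`w ↦ w - (g_v(v,w)/g_v(v,v)) v`.

Endomorphisms of `N_η(t)` are always extended by `0` on `ℝ η̇(t)` to endomorphisms of `T_{η(t)} M`;
this changes neither products nor traces. The identity of `N_η(t)` becomes this projection. -/
def normalProj (L : TangentBundle (𝓡 (n + 1)) M → ℝ) (p : TangentBundle (𝓡 (n + 1)) M) :
    Model n →L[ℝ] Model n :=
  ContinuousLinearMap.id ℝ (Model n)
    - ContinuousLinearMap.smulRight (M₂ := Model n)
        ((fundTensor L p p.2 p.2)⁻¹ • fundTensor L p p.2) p.2

/-- The inverse, on the normal space, of an endomorphism `A` of the normal space: with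
`Q = id - normalProj` the projection to `ℝ v`, it is `(A + Q)⁻¹ - Q`. -/
def normalInv (L : TangentBundle (𝓡 (n + 1)) M → ℝ) (p : TangentBundle (𝓡 (n + 1)) M)
    (A : Model n →L[ℝ] Model n) : Model n →L[ℝ] Model n :=
  Ring.inverse (A + (ContinuousLinearMap.id ℝ (Model n) - normalProj L p))
    - (ContinuousLinearMap.id ℝ (Model n) - normalProj L p)

/-- `J` is a Jacobi tensor field along the geodesic `η`, defined on the open interval `U`: a smooth
field of endomorphisms of `N_η` (extended by `0` on `ℝ η̇`) with `J'' + R J = 0` and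
`ker J ∩ ker J' = {0}`. -/
structure FinslerSpacetime.IsJacobiTensorField (S : FinslerSpacetime n M) (η : ℝ → M) (U : Set ℝ)
    (J : (t : ℝ) → TangentSpace (𝓡 (n + 1)) (η t) →L[ℝ] TangentSpace (𝓡 (n + 1)) (η t)) :
    Prop where
  smooth : ∀ t ∈ U, ContDiffAt ℝ ∞ (coordEnd (η t) η J) t
  map_velocity : ∀ t ∈ U, J t (velocity (n := n) η t).2 = 0
  map_normal : ∀ t ∈ U, ∀ w ∈ normalSpace S.L (velocity η t),
    J t w ∈ normalSpace S.L (velocity η t)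
  equation : ∀ t ∈ U, ∀ w ∈ normalSpace S.L (velocity η t),
    covDeriv S.L η 2 J t w + curvature S.L (velocity η t) (J t w) = 0
  ker_inter_ker : ∀ t ∈ U, ∀ w ∈ normalSpace S.L (velocity η t),
    J t w = 0 → covDeriv S.L η 1 J t w = 0 → w = 0

/-- A Lagrange tensor field: a Jacobi tensor field with `(J')ᵀ J - Jᵀ J' = 0`, the transpose being
taken with respect to `g_η̇`. -/
structure FinslerSpacetime.IsLagrangeTensorField (S : FinslerSpacetime n M) (η : ℝ → M)
    (U : Set ℝ)
    (J : (t : ℝ) → TangentSpace (𝓡 (n + 1)) (η t) →L[ℝ] TangentSpace (𝓡 (n + 1)) (η t)) :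
    Prop extends S.IsJacobiTensorField η U J where
  symmetric : ∀ t ∈ U, ∀ w₁ ∈ normalSpace S.L (velocity η t),
    ∀ w₂ ∈ normalSpace S.L (velocity η t),
      fundTensor S.L (velocity η t) (covDeriv S.L η 1 J t w₁) (J t w₂)
        - fundTensor S.L (velocity η t) (J t w₁) (covDeriv S.L η 1 J t w₂) = 0

/-! ### The `ε`-proper time, expansion and shear -/

/-- `τ` is an `ε`-proper time along `η`, on the open interval `U`:
a primitive of `exp(2(ε-1)ψ_η/n)`. -/
def IsEpsProperTime (ψ : TangentBundle (𝓡 (n + 1)) M → ℝ) (η : ℝ → M) (U : Set ℝ) (ε : ℝ)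
    (τ : ℝ → ℝ) : Prop :=
  ∀ t ∈ U, HasDerivAt τ (Real.exp (2 * (ε - 1) / n * psiAlong ψ η t)) t

/-- The inverse `τ⁻¹ : τ(U) → U` of a parameter `τ` on `U`. -/
def invParam (U : Set ℝ) (τ : ℝ → ℝ) : ℝ → ℝ := Function.invFunOn τ U

/-- The derivative `f^* = df/dτ` of a function `f` on `U`. -/
def starDeriv (U : Set ℝ) (τ : ℝ → ℝ) (f : ℝ → ℝ) (t : ℝ) : ℝ := deriv (f ∘ invParam U τ) (τ t)

/-- The derivative `η^* = d(η ∘ τ⁻¹)/dτ`, a tangent vector at `η(t)`. -/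
def velocityStar (U : Set ℝ) (τ : ℝ → ℝ) (η : ℝ → M) (t : ℝ) : TangentBundle (𝓡 (n + 1)) M :=
  velocity (fun s => η (invParam U τ s)) (τ t)

/-- The covariant derivative `A^*` in `τ` of a field `A` of endomorphisms along `η`: the covariant
derivative along the curve `η ∘ τ⁻¹`. -/
def covDerivStar (L : TangentBundle (𝓡 (n + 1)) M → ℝ) (U : Set ℝ) (τ : ℝ → ℝ) (η : ℝ → M)
    (A : (t : ℝ) → TangentSpace (𝓡 (n + 1)) (η t) →L[ℝ] TangentSpace (𝓡 (n + 1)) (η t))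
    (t : ℝ) : Model n →L[ℝ] Model n :=
  covDeriv L (fun s => η (invParam U τ s)) 1 (fun s => A (invParam U τ s)) (τ t)

/-- The weighted Jacobi endomorphism `J_ψ = exp(-ψ_η/n) J`. -/
def weightedJ (ψ : TangentBundle (𝓡 (n + 1)) M → ℝ) (η : ℝ → M)
    (J : (t : ℝ) → TangentSpace (𝓡 (n + 1)) (η t) →L[ℝ] TangentSpace (𝓡 (n + 1)) (η t))
    (t : ℝ) : TangentSpace (𝓡 (n + 1)) (η t) →L[ℝ] TangentSpace (𝓡 (n + 1)) (η t) :=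
  Real.exp (-psiAlong ψ η t / n) • J t

variable (L : TangentBundle (𝓡 (n + 1)) M → ℝ) (ψ : TangentBundle (𝓡 (n + 1)) M → ℝ)
  (U : Set ℝ) (τ : ℝ → ℝ) (η : ℝ → M)
  (J : (t : ℝ) → TangentSpace (𝓡 (n + 1)) (η t) →L[ℝ] TangentSpace (𝓡 (n + 1)) (η t))

/-- `B_ε = J_ψ^* J_ψ⁻¹`, where `*` is the derivative in the `ε`-proper time `τ`. -/
def Beps (t : ℝ) : Model n →L[ℝ] Model n :=
  (covDerivStar L U τ η (weightedJ ψ η J) t).comp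
    (normalInv L (velocity η t) (weightedJ ψ η J t))

/-- The `ε`-expansion `θ_ε = trace B_ε`. -/
def thetaEps (t : ℝ) : ℝ := tr (Beps L ψ U τ η J t)

/-- The `ε`-shear tensor `σ_ε = B_ε - (θ_ε/n) I_n`. -/
def sigmaEps (t : ℝ) : Model n →L[ℝ] Model n :=
  Beps L ψ U τ η J t - (thetaEps L ψ U τ η J t / n) • normalProj L (velocity η t)

end LorentzFinsler

end

open LorentzFinsler

/-!
The proof is the classical derivation of the Raychaudhuri equation from the Riccati equation, followed
by a change of weight and of parameter.

*Riccati equation.* All fields of endomorphisms of the normal spaces are extended by `0` to the line of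
the velocity. Along a unit speed geodesic the velocity is parallel for the Chern connection, and so is
the covector `∂L/∂v = g_v(v, ·)` (`eulerLagrange`, `hasDerivAt_coordForm`); hence the projection `Q` to
the line of the velocity is parallel (`hasDerivAt_lineProj`), and `J + Q` is an invertible field whose
inverse restricts to `J⁻¹`. Differentiating `trace (J' J⁻¹)` gives
`trace (J'' J⁻¹) - trace ((J' J⁻¹)²)` (`hasDerivAt_tr_deriv_mul_inverse`), and `J'' = -R J` together with
`R_v v = 0` (`sum_coordR`) turns the first term into `-Ric` (`hasDerivAt_expansion`). Only the trace is
needed, so covariant derivatives may be replaced by derivatives in a fixed chart: the difference is a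
commutator with `J`, whose product with `J⁻¹` has trace zero (`expansion_eq`).

*Weight and parameter.* With `f = dt/dτ_ε = exp(-2(ε-1)ψ_η/n)` one has
`B_ε = f (J' J⁻¹ - (ψ_η'/n) I_n)`, because the Chern connection is `0`-homogeneous (`Beps_eq`). This gives
`θ_ε`, the derivative of `θ_ε` and the trace of `σ_ε²` in terms of the unweighted quantities
(`thetaEps_eq`, `hasDerivAt_thetaEps`, `tr_sigmaEps`).

*Weighted Ricci curvature.* `Ric_N(η^*)` involves the geodesic with initial velocity `f η̇(t)`. By local
uniqueness of geodesics (`IsGeodesicOn.eventuallyEq`) it is `s ↦ η (t + f s)`, so that the derivatives of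
the weight along it are `f ψ_η'` and `f² ψ_η''` (`deriv_psiGeodesic`), while `Ric` is `2`-homogeneous
(`ricci_smul`). The three equations are then algebraic identities.

All homogeneity properties in local coordinates come from Euler's identity and the calculus of smooth
functions on `ℝ^{n+1} × (ℝ^{n+1} ∖ {0})` that are homogeneous in the second variable (`IsSmoothHom`).
-/

namespace LorentzFinsler

/-! ### Traces of endomorphisms and the trace of the Riccati equation -/

variable {n : ℕ}

/-- The trace as a continuous linear functional on the algebra of endomorphisms. -/
noncomputable def trCLM (n : ℕ) : (Model n →L[ℝ] Model n) →L[ℝ] ℝ :=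
  LinearMap.toContinuousLinearMap
    ({ toFun := tr
       map_add' := fun A B => by simp [tr]
       map_smul' := fun c A => by simp [tr] } : (Model n →L[ℝ] Model n) →ₗ[ℝ] ℝ)

theorem tr_add (A B : Model n →L[ℝ] Model n) : tr (A + B) = tr A + tr B :=
  (trCLM n).map_add A B

theorem tr_sub (A B : Model n →L[ℝ] Model n) : tr (A - B) = tr A - tr B :=
  (trCLM n).map_sub A B

theorem tr_neg (A : Model n →L[ℝ] Model n) : tr (-A) = -tr A :=
  (trCLM n).map_neg A

theorem tr_smul (c : ℝ) (A : Model n →L[ℝ] Model n) : tr (c • A) = c * tr A :=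
  (trCLM n).map_smul c A

theorem tr_mul_comm (A B : Model n →L[ℝ] Model n) : tr (A * B) = tr (B * A) :=
  LinearMap.trace_mul_comm ℝ A.toLinearMap B.toLinearMap

theorem tr_one : tr (1 : Model n →L[ℝ] Model n) = n + 1 := by
  have := LinearMap.trace_one ℝ (Model n)
  rw [finrank_euclideanSpace_fin] at this
  exact_mod_cast this

theorem tr_smulRight (φ : Model n →L[ℝ] ℝ) (v : Model n) : tr (φ.smulRight v) = φ v := by
  exact LinearMap.trace_smulRight (R := ℝ) φ.toLinearMap v

theorem _root_.HasDerivAt.tr {A : ℝ → Model n →L[ℝ] Model n} {A' : Model n →L[ℝ] Model n} {t : ℝ}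
    (h : HasDerivAt A A' t) : HasDerivAt (fun s => tr (A s)) (tr A') t :=
  (trCLM n).hasFDerivAt.comp_hasDerivAt t h

theorem contDiffAt_deriv {F : Type*} [NormedAddCommGroup F] [NormedSpace ℝ F] {f : ℝ → F} {t : ℝ}
    {m k : WithTop ℕ∞} (hf : ContDiffAt ℝ k f t) (hmk : m + 1 ≤ k) :
    ContDiffAt ℝ m (deriv f) t :=
  (hf.fderiv_right hmk).clm_apply contDiffAt_const

section Ring

variable {R : Type*} [Ring R]

/-- If `Q` is an idempotent annihilating `A` from both sides and `A + Q` is invertible with inverse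
`Y`, then `Y - Q` inverts `A` on the complement of `Q`. -/
theorem mul_inverse_sub_of_orthogonal {A Q Y : R} (hAQ : A * Q = 0) (hQA : Q * A = 0)
    (hQQ : Q * Q = Q) (hY : (A + Q) * Y = 1) (hY' : Y * (A + Q) = 1) :
    A * (Y - Q) = 1 - Q ∧ (Y - Q) * A = 1 - Q ∧ Q * (Y - Q) = 0 ∧ (Y - Q) * Q = 0 := by
  have h1 : Q * Y = Q := by
    have : Q * ((A + Q) * Y) = Q * Y := by rw [← mul_assoc, mul_add, hQA, hQQ, zero_add]
    rw [← this, hY, mul_one]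
  have h2 : Y * Q = Q := by
    have : (Y * (A + Q)) * Q = Y * Q := by rw [mul_assoc, add_mul, hAQ, hQQ, zero_add]
    rw [← this, hY', one_mul]
  refine ⟨?_, ?_, ?_, ?_⟩
  · rw [mul_sub, hAQ, sub_zero, eq_sub_iff_add_eq, ← hY, add_mul, h1]
  · rw [sub_mul, hQA, sub_zero, eq_sub_iff_add_eq, ← hY', mul_add, h2]
  · rw [mul_sub, h1, hQQ, sub_self]
  · rw [sub_mul, h2, hQQ, sub_self]

theorem ringInverse_eq {X Y : R} (h : X * Y = 1) (h' : Y * X = 1) :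
    Ring.inverse X = Y := by
  have := Ring.inverse_unit (⟨X, Y, h, h'⟩ : Rˣ)
  exact this

/-- Product rule for `T A S` with `S = T⁻¹` (here `dA`, `dT`, `dS` are the derivatives), conjugated
back: the derivative of `A` changes by a commutator with `S dT`. -/
theorem conj_deriv_identity {T S A K dT dS dA : R} (h : S * T = 1) (h' : dS * T = -(S * dT)) :
    S * (((dT * A + T * dA) * S + T * A * dS) * (T * K))
      = dA * K + (S * dT * A - A * (S * dT)) * K := by
  calc _ = S * dT * A * (S * T) * K + S * T * dA * (S * T) * K + S * T * A * (dS * T) * K := by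
        noncomm_ring
    _ = _ := by rw [h, h']; noncomm_ring

/-- If `a q = 0` and `q` is parallel, then `(D a) q = 0`. Here `a₁` stands for `D a = a' + [Γ, a]`, so
that `a' = a₁ - Γ a + a Γ`, and `q' = q Γ - Γ q`; the second hypothesis is `(a q)' = 0`. -/
theorem covDeriv_mul_eq_zero {a₁ a q Γ : R} (h : a * q = 0)
    (h' : (a₁ - Γ * a + a * Γ) * q + a * (q * Γ - Γ * q) = 0) : a₁ * q = 0 := by
  calc a₁ * q = (a₁ - Γ * a + a * Γ) * q + a * (q * Γ - Γ * q) + Γ * (a * q) - (a * q) * Γ := by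
        noncomm_ring
    _ = 0 := by rw [h, h']; noncomm_ring

/-- The derivative of `(D a) (Y - q)` for a parallel `q`, where `Y = (a + q)⁻¹`. Here `a₁` stands for
`D a`, `a₂` for the derivative of `D a`, and the derivatives of `a` and `q` are expressed through
`a₁` and `Γ` as in `covDeriv_mul_eq_zero`. -/
theorem deriv_mul_inverse_identity {a₂ a₁ a q Γ Y : R} (hY : (a + q) * Y = 1)
    (hY' : Y * (a + q) = 1) (h : a₁ * q = 0) :
    a₂ * (Y - q) + a₁ * (-(Y * (a₁ - Γ * a + a * Γ + (q * Γ - Γ * q)) * Y) - (q * Γ - Γ * q))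
      = a₂ * (Y - q) + a₁ * (Y - q) * Γ - a₁ * Γ * (Y - q)
        - a₁ * (Y - q) * (a₁ * (Y - q)) := by
  have h1 : Y * (a₁ - Γ * a + a * Γ + (q * Γ - Γ * q)) * Y = Y * a₁ * Y - Y * Γ + Γ * Y := by
    calc _ = Y * a₁ * Y - Y * Γ * ((a + q) * Y) + (Y * (a + q)) * Γ * Y := by noncomm_ring
      _ = _ := by rw [hY, hY']; noncomm_ring
  have h2 : a₁ * (Y - q) = a₁ * Y := by rw [mul_sub, h, sub_zero]
  rw [h1]
  calc _ = a₂ * (Y - q) + a₁ * (Y - q) * Γ - a₁ * Γ * (Y - q) - a₁ * Y * (a₁ * Y) := by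
        noncomm_ring
    _ = _ := by rw [h2]

end Ring

/-- The trace of the logarithmic derivative is unchanged by a connection term, because a field
commutes with its inverse. -/
theorem tr_commutator_mul {A K C : Model n →L[ℝ] Model n} (h : A * K = K * A) :
    tr ((C * A - A * C) * K) = 0 := by
  rw [sub_mul, tr_sub, mul_assoc, mul_assoc, tr_mul_comm A, mul_assoc, ← h, sub_self]

/-- The trace of the logarithmic derivative does not depend on the moving frame. -/
theorem tr_deriv_conj {A T T' : ℝ → Model n →L[ℝ] Model n} {K : Model n →L[ℝ] Model n} {s : ℝ}
    (hA : DifferentiableAt ℝ A s) (hT : DifferentiableAt ℝ T s) (hT' : DifferentiableAt ℝ T' s)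
    (hTT' : ∀ᶠ r in 𝓝 s, T' r * T r = 1) (hAK : A s * K = K * A s) :
    tr (deriv (fun r => T r * A r * T' r) s * (T s * K * T' s)) = tr (deriv A s * K) := by
  have h1 : T' s * T s = 1 := hTT'.self_of_nhds
  have hd : HasDerivAt (fun r => T' r * T r) 0 s :=
    (hasDerivAt_const s (1 : Model n →L[ℝ] Model n)).congr_of_eventuallyEq hTT'
  have h2 : deriv T' s * T s + T' s * deriv T s = 0 :=
    (hT'.hasDerivAt.mul hT.hasDerivAt).unique hd
  have h0 : HasDerivAt (fun r => T r * A r * T' r)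
      ((deriv T s * A s + T s * deriv A s) * T' s + T s * A s * deriv T' s) s :=
    (hT.hasDerivAt.mul hA.hasDerivAt).mul hT'.hasDerivAt
  rw [h0.deriv]
  have h3 : deriv T' s * T s = -(T' s * deriv T s) := eq_neg_of_add_eq_zero_left h2
  calc tr (((deriv T s * A s + T s * deriv A s) * T' s + T s * A s * deriv T' s)
          * (T s * K * T' s))
      = tr (T' s * (((deriv T s * A s + T s * deriv A s) * T' s + T s * A s * deriv T' s)
          * (T s * K))) := by
        rw [tr_mul_comm (T' s)]; simp only [mul_assoc]
    _ = tr (deriv A s * K + (T' s * deriv T s * A s - A s * (T' s * deriv T s)) * K) := by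
        rw [conj_deriv_identity h1 h3]
    _ = tr (deriv A s * K) := by rw [tr_add, tr_commutator_mul hAK, add_zero]

/-- The trace of the Riccati equation: if `Q` is a parallel idempotent annihilating `A` from both
sides, `K` is the inverse of `A` on the complement of `Q`, and `D = ∂ + [Γ, ·]`, then
`(tr (∂A · K))' = tr (D²A · K) - tr ((DA · K)²)`. -/
theorem hasDerivAt_tr_deriv_mul_inverse {A Q Γ : ℝ → Model n →L[ℝ] Model n} {t : ℝ}
    (hA : ContDiffAt ℝ 2 A t) (hQ : DifferentiableAt ℝ Q t) (hΓ : DifferentiableAt ℝ Γ t)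
    (hAQ : ∀ᶠ s in 𝓝 t, A s * Q s = 0) (hQA : ∀ᶠ s in 𝓝 t, Q s * A s = 0)
    (hQQ : ∀ᶠ s in 𝓝 t, Q s * Q s = Q s) (hu : IsUnit (A t + Q t))
    (hDQ : deriv Q t + Γ t * Q t - Q t * Γ t = 0)
    {D : (ℝ → Model n →L[ℝ] Model n) → ℝ → Model n →L[ℝ] Model n}
    (hD : ∀ X s, D X s = deriv X s + Γ s * X s - X s * Γ s)
    {K : ℝ → Model n →L[ℝ] Model n} (hK : ∀ s, K s = Ring.inverse (A s + Q s) - Q s) :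
    HasDerivAt (fun s => tr (deriv A s * K s))
      (tr (D (D A) t * K t) - tr (D A t * K t * (D A t * K t))) t := by
  have hA1 : DifferentiableAt ℝ A t := hA.differentiableAt (by norm_num)
  have hA2 : DifferentiableAt ℝ (deriv A) t :=
    (contDiffAt_deriv (m := 1) hA (by norm_num)).differentiableAt (by norm_num)
  have hunit : ∀ᶠ s in 𝓝 t, IsUnit (A s + Q s) :=
    (hA1.add hQ).continuousAt.eventually (Units.isOpen.mem_nhds hu)
  -- The commutator part of `D A` does not contribute to the trace against `K`.
  have hev : (fun s => tr (deriv A s * K s)) =ᶠ[𝓝 t] fun s => tr (D A s * K s) := by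
    filter_upwards [hAQ, hQA, hQQ, hunit] with s h1 h2 h3 ⟨x, hx⟩
    have hY : (A s + Q s) * Ring.inverse (A s + Q s) = 1 := Ring.mul_inverse_cancel _ ⟨x, hx⟩
    have hY' : Ring.inverse (A s + Q s) * (A s + Q s) = 1 := Ring.inverse_mul_cancel _ ⟨x, hx⟩
    obtain ⟨h4, h5, -, -⟩ := mul_inverse_sub_of_orthogonal h1 h2 h3 hY hY'
    rw [hD, hK, add_sub_assoc, add_mul, tr_add, tr_commutator_mul (h4.trans h5.symm), add_zero]
  refine HasDerivAt.congr_of_eventuallyEq ?_ hev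
  obtain ⟨x, hx⟩ := hu
  have hDA : HasDerivAt (D A) (deriv (D A) t) t := by
    have : D A = fun s => deriv A s + Γ s * A s - A s * Γ s := funext fun s => hD A s
    rw [this]
    exact ((hA2.add (hΓ.mul hA1)).sub (hA1.mul hΓ)).hasDerivAt
  have hKd : HasDerivAt K
      (-(Ring.inverse (A t + Q t) * (deriv A t + deriv Q t) * Ring.inverse (A t + Q t))
        - deriv Q t) t := by
    have h1 : HasDerivAt (fun s => A s + Q s) (deriv A t + deriv Q t) t :=
      hA1.hasDerivAt.add hQ.hasDerivAt
    have h2 := hasFDerivAt_ringInverse (𝕜 := ℝ) x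
    rw [hx] at h2
    have h3 := (h2.comp_hasDerivAt t h1).sub hQ.hasDerivAt
    have h4 : K = fun s => (Ring.inverse ∘ fun s => A s + Q s) s - Q s := funext hK
    rw [h4, ← hx, Ring.inverse_unit]
    exact h3
  have hmain : HasDerivAt (fun s => tr (D A s * K s)) _ t := (hDA.mul hKd).tr
  refine hmain.congr_deriv ?_
  have hY : (A t + Q t) * Ring.inverse (A t + Q t) = 1 := Ring.mul_inverse_cancel _ ⟨x, hx⟩
  have hY' : Ring.inverse (A t + Q t) * (A t + Q t) = 1 := Ring.inverse_mul_cancel _ ⟨x, hx⟩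
  have e1 := hAQ.self_of_nhds
  have e3 : deriv A t * Q t + A t * deriv Q t = 0 :=
    ((hA1.hasDerivAt.mul hQ.hasDerivAt).unique
      ((hasDerivAt_const t (0 : Model n →L[ℝ] Model n)).congr_of_eventuallyEq hAQ))
  have hQ' : deriv Q t = Q t * Γ t - Γ t * Q t := by rw [← sub_eq_zero, ← hDQ]; abel
  have hA' : deriv A t = D A t - Γ t * A t + A t * Γ t := by rw [hD]; abel
  rw [hQ', hA'] at e3
  rw [hD (D A) t, hQ', hA', hK, deriv_mul_inverse_identity hY hY' (covDeriv_mul_eq_zero e1 e3)]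
  have h5 := tr_mul_comm (D A t * (Ring.inverse (A t + Q t) - Q t)) (Γ t)
  simp only [sub_mul (_ + _), add_mul, tr_sub, tr_add, mul_assoc] at h5 ⊢
  linarith

end LorentzFinsler

namespace LorentzFinsler

/-! ### Smooth functions homogeneous in the fibre variable -/

variable {n : ℕ}

/-- An open set of `ℝ^{n+1} × ℝ^{n+1}` that is a cone in the second variable. -/
structure IsConic (W : Set (Model n × Model n)) : Prop where
  isOpen : IsOpen W
  smul_mem : ∀ q ∈ W, ∀ c : ℝ, 0 < c → (q.1, c • q.2) ∈ W

/-- A smooth function on `W` that is positively `k`-homogeneous in the second variable. -/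
structure IsSmoothHom (W : Set (Model n × Model n)) (k : ℤ) (f : Model n × Model n → ℝ) :
    Prop where
  smooth : ContDiffOn ℝ ∞ f W
  hom : ∀ q ∈ W, ∀ c : ℝ, 0 < c → f (q.1, c • q.2) = c ^ k * f q

variable {W : Set (Model n × Model n)} {k l : ℤ} {f g : Model n × Model n → ℝ}
  {q : Model n × Model n}

theorem IsSmoothHom.contDiffAt (hf : IsSmoothHom W k f) (hW : IsConic W) (hq : q ∈ W) :
    ContDiffAt ℝ ∞ f q :=
  hf.smooth.contDiffAt (hW.isOpen.mem_nhds hq)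

theorem IsSmoothHom.differentiableAt (hf : IsSmoothHom W k f) (hW : IsConic W) (hq : q ∈ W) :
    DifferentiableAt ℝ f q :=
  (hf.contDiffAt hW hq).differentiableAt (by simp)

theorem IsSmoothHom.add (hf : IsSmoothHom W k f) (hg : IsSmoothHom W k g) :
    IsSmoothHom W k (fun q => f q + g q) where
  smooth := hf.smooth.add hg.smooth
  hom q hq c hc := by rw [hf.hom q hq c hc, hg.hom q hq c hc]; ring

theorem IsSmoothHom.sub (hf : IsSmoothHom W k f) (hg : IsSmoothHom W k g) :
    IsSmoothHom W k (fun q => f q - g q) where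
  smooth := hf.smooth.sub hg.smooth
  hom q hq c hc := by rw [hf.hom q hq c hc, hg.hom q hq c hc]; ring

theorem IsSmoothHom.mul (hf : IsSmoothHom W k f) (hg : IsSmoothHom W l g) :
    IsSmoothHom W (k + l) (fun q => f q * g q) where
  smooth := hf.smooth.mul hg.smooth
  hom q hq c hc := by rw [hf.hom q hq c hc, hg.hom q hq c hc, zpow_add₀ hc.ne']; ring

theorem IsSmoothHom.const_mul (hf : IsSmoothHom W k f) (a : ℝ) :
    IsSmoothHom W k (fun q => a * f q) where
  smooth := contDiffOn_const.mul hf.smooth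
  hom q hq c hc := by rw [hf.hom q hq c hc]; ring

theorem IsSmoothHom.sum {ι : Type*} (s : Finset ι) {f : ι → Model n × Model n → ℝ}
    (hf : ∀ i ∈ s, IsSmoothHom W k (f i)) : IsSmoothHom W k (fun q => ∑ i ∈ s, f i q) where
  smooth := ContDiffOn.sum fun i hi => (hf i hi).smooth
  hom q hq c hc := by
    rw [Finset.mul_sum]
    exact Finset.sum_congr rfl fun i hi => (hf i hi).hom q hq c hc

theorem IsSmoothHom.prod {ι : Type*} (s : Finset ι) {f : ι → Model n × Model n → ℝ}
    (hf : ∀ i ∈ s, IsSmoothHom W 0 (f i)) : IsSmoothHom W 0 (fun q => ∏ i ∈ s, f i q) where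
  smooth := contDiffOn_prod fun i hi => (hf i hi).smooth
  hom q hq c hc := by
    rw [zpow_zero, one_mul]
    refine Finset.prod_congr rfl fun i hi => ?_
    simpa using (hf i hi).hom q hq c hc

theorem IsSmoothHom.const (a : ℝ) : IsSmoothHom W 0 (fun _ => a) where
  smooth := contDiffOn_const
  hom q hq c hc := by simp

theorem IsSmoothHom.inv (hf : IsSmoothHom W 0 f) (h0 : ∀ q ∈ W, f q ≠ 0) :
    IsSmoothHom W 0 (fun q => (f q)⁻¹) where
  smooth := hf.smooth.inv h0
  hom q hq c hc := by rw [hf.hom q hq c hc]; simp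

theorem isSmoothHom_snd (α : Fin (n + 1)) : IsSmoothHom W 1 (fun q => q.2 α) where
  smooth := ((EuclideanSpace.proj (𝕜 := ℝ) α).contDiff.comp contDiff_snd).contDiffOn
  hom q hq c hc := by simp

theorem hasFDerivAt_scale (c : ℝ) (q : Model n × Model n) :
    HasFDerivAt (fun q : Model n × Model n => (q.1, c • q.2))
      ((ContinuousLinearMap.fst ℝ (Model n) (Model n)).prod
        (c • ContinuousLinearMap.snd ℝ (Model n) (Model n))) q :=
  ((ContinuousLinearMap.fst ℝ (Model n) (Model n)).prod
    (c • ContinuousLinearMap.snd ℝ (Model n) (Model n))).hasFDerivAt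

theorem IsSmoothHom.fderiv_scale (hf : IsSmoothHom W k f) (hW : IsConic W) (hq : q ∈ W) {c : ℝ}
    (hc : 0 < c) (u v : Model n) :
    fderiv ℝ f (q.1, c • q.2) (u, c • v) = c ^ k * fderiv ℝ f q (u, v) := by
  have h1 := ((hf.differentiableAt hW (hW.smul_mem q hq c hc)).hasFDerivAt.comp q
    (hasFDerivAt_scale c q))
  have h2 : HasFDerivAt (fun q => c ^ k * f q) (c ^ k • fderiv ℝ f q) q :=
    (hf.differentiableAt hW hq).hasFDerivAt.const_mul _
  have h3 : (f ∘ fun q : Model n × Model n => (q.1, c • q.2)) =ᶠ[𝓝 q] fun q => c ^ k * f q := by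
    filter_upwards [hW.isOpen.mem_nhds hq] with p hp using hf.hom p hp c hc
  have h4 := DFunLike.congr_fun ((h2.congr_of_eventuallyEq h3).unique h1) (u, v)
  simpa using h4.symm

theorem IsSmoothHom.contDiffOn_fderiv_apply (hf : IsSmoothHom W k f) (hW : IsConic W)
    (w : Model n × Model n) : ContDiffOn ℝ ∞ (fun q => fderiv ℝ f q w) W :=
  (hf.smooth.fderiv_of_isOpen hW.isOpen (m := ∞) (by simp)).clm_apply contDiffOn_const

theorem IsSmoothHom.dx (hf : IsSmoothHom W k f) (hW : IsConic W) (α : Fin (n + 1)) :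
    IsSmoothHom W k (dx α f) where
  smooth := hf.contDiffOn_fderiv_apply hW _
  hom q hq c hc := by
    have := hf.fderiv_scale hW hq hc (EuclideanSpace.single α 1) 0
    rwa [smul_zero] at this

theorem IsSmoothHom.dv (hf : IsSmoothHom W k f) (hW : IsConic W) (α : Fin (n + 1)) :
    IsSmoothHom W (k - 1) (dv α f) where
  smooth := hf.contDiffOn_fderiv_apply hW _
  hom q hq c hc := by
    have := hf.fderiv_scale hW hq hc 0 (EuclideanSpace.single α 1)
    have h2 : ((0 : Model n), c • (EuclideanSpace.single α 1 : Model n))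
        = c • ((0 : Model n), (EuclideanSpace.single α 1 : Model n)) := by simp
    rw [h2, map_smul, smul_eq_mul] at this
    rw [zpow_sub_one₀ hc.ne']
    unfold LorentzFinsler.dv
    field_simp
    linarith

/-- A differential in terms of the coordinate derivatives. -/
theorem fderiv_eq_sum (f : Model n × Model n → ℝ) (q : Model n × Model n) (a b : Model n) :
    fderiv ℝ f q (a, b) = ∑ α, a α * dx α f q + ∑ α, b α * dv α f q := by
  have h : (a, b) = ∑ α, a α • ((EuclideanSpace.single α (1 : ℝ) : Model n), (0 : Model n))
      + ∑ α, b α • ((0 : Model n), (EuclideanSpace.single α (1 : ℝ) : Model n)) := by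
    ext i
    · simp [Prod.fst_sum, Pi.single_apply]
    · simp [Prod.snd_sum, Pi.single_apply]
  rw [h, map_add, map_sum, map_sum]
  simp only [map_smul, smul_eq_mul, dx, dv]

/-- Euler's identity for homogeneous functions. -/
theorem IsSmoothHom.euler (hf : IsSmoothHom W k f) (hW : IsConic W) (hq : q ∈ W) :
    ∑ α, q.2 α * LorentzFinsler.dv α f q = k * f q := by
  have h1 : HasDerivAt (fun c : ℝ => (q.1, c • q.2)) ((0 : Model n), q.2) 1 := by
    have := (hasDerivAt_const (1 : ℝ) q.1).prodMk ((hasDerivAt_id (1 : ℝ)).smul_const q.2)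
    simpa using this
  have hq1 : (q.1, (1 : ℝ) • q.2) = q := by simp
  have h2 : HasDerivAt (fun c : ℝ => f (q.1, c • q.2)) (fderiv ℝ f q (0, q.2)) 1 := by
    have := (hf.differentiableAt hW hq).hasFDerivAt
    rw [← hq1] at this
    have := this.comp_hasDerivAt (1 : ℝ) h1
    rwa [hq1] at this
  have h3 : HasDerivAt (fun c : ℝ => c ^ k * f q) (k * f q) 1 := by
    simpa using (hasDerivAt_zpow k (1 : ℝ) (by simp)).mul_const (f q)
  have h4 : (fun c : ℝ => f (q.1, c • q.2)) =ᶠ[𝓝 1] fun c => c ^ k * f q := by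
    filter_upwards [lt_mem_nhds one_pos] with c hc using hf.hom q hq c hc
  have h5 := (h3.congr_of_eventuallyEq h4).unique h2
  rw [fderiv_eq_sum] at h5
  simpa using h5.symm

theorem IsSmoothHom.fderiv_comm (hf : IsSmoothHom W k f) (hW : IsConic W) (hq : q ∈ W)
    (u w : Model n × Model n) :
    fderiv ℝ (fun p => fderiv ℝ f p u) q w = fderiv ℝ (fun p => fderiv ℝ f p w) q u := by
  have h := hf.contDiffAt hW hq
  have h1 : DifferentiableAt ℝ (fderiv ℝ f) q :=
    (h.fderiv_right (m := 1) (by norm_cast)).differentiableAt (by simp)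
  have h2 : ∀ u, fderiv ℝ (fun p => fderiv ℝ f p u) q = (fderiv ℝ (fderiv ℝ f) q).flip u := by
    intro u
    rw [fderiv_clm_apply h1 (by fun_prop)]
    ext <;> simp [fderiv_fun_const]
  rw [h2, h2]
  exact (h.isSymmSndFDerivAt (by simp; norm_cast)) w u

theorem IsSmoothHom.dv_dv_comm (hf : IsSmoothHom W k f) (hW : IsConic W) (hq : q ∈ W)
    (α β : Fin (n + 1)) : LorentzFinsler.dv α (LorentzFinsler.dv β f) q
      = LorentzFinsler.dv β (LorentzFinsler.dv α f) q :=
  hf.fderiv_comm hW hq _ _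

theorem IsSmoothHom.dx_dv_comm (hf : IsSmoothHom W k f) (hW : IsConic W) (hq : q ∈ W)
    (α β : Fin (n + 1)) : LorentzFinsler.dx α (LorentzFinsler.dv β f) q
      = LorentzFinsler.dv β (LorentzFinsler.dx α f) q :=
  hf.fderiv_comm hW hq _ _

theorem IsConic.dx_congr (hW : IsConic W) (hq : q ∈ W) (h : ∀ p ∈ W, f p = g p)
    (α : Fin (n + 1)) : dx α f q = dx α g q := by
  unfold dx
  rw [Filter.EventuallyEq.fderiv_eq (f := g)]
  filter_upwards [hW.isOpen.mem_nhds hq] with p hp using h p hp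

theorem IsConic.dv_congr (hW : IsConic W) (hq : q ∈ W) (h : ∀ p ∈ W, f p = g p)
    (α : Fin (n + 1)) : dv α f q = dv α g q := by
  unfold dv
  rw [Filter.EventuallyEq.fderiv_eq (f := g)]
  filter_upwards [hW.isOpen.mem_nhds hq] with p hp using h p hp

theorem IsSmoothHom.det {A : Fin (n + 1) → Fin (n + 1) → Model n × Model n → ℝ}
    (hA : ∀ i j, IsSmoothHom W 0 (A i j)) :
    IsSmoothHom W 0 (fun q => (Matrix.of fun i j => A i j q).det) := by
  simp only [Matrix.det_apply', Matrix.of_apply]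
  exact IsSmoothHom.sum _ fun σ _ => (IsSmoothHom.prod _ fun i _ => hA _ _).const_mul _

/-- The entries of the inverse of a matrix of smooth `0`-homogeneous functions. -/
theorem IsSmoothHom.matrix_inv {A : Fin (n + 1) → Fin (n + 1) → Model n × Model n → ℝ}
    (hA : ∀ i j, IsSmoothHom W 0 (A i j))
    (hdet : ∀ q ∈ W, (Matrix.of fun i j => A i j q).det ≠ 0) (i j : Fin (n + 1)) :
    IsSmoothHom W 0 (fun q => (Matrix.of fun i j => A i j q)⁻¹ i j) := by
  simp only [Matrix.inv_def, Ring.inverse_eq_inv', Matrix.smul_apply, smul_eq_mul,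
    Matrix.adjugate_apply]
  have h : IsSmoothHom W 0 (fun q =>
      (Matrix.of fun a b => (if a = j then (Pi.single i 1 : Fin (n + 1) → ℝ) b else A a b q)).det) :=
    IsSmoothHom.det (A := fun a b q => if a = j then (Pi.single i 1 : Fin (n + 1) → ℝ) b
      else A a b q) fun a b => by
        by_cases hab : a = j
        · simpa only [hab, if_true] using IsSmoothHom.const _
        · simpa only [hab, if_false] using hA a b
  have h2 := (IsSmoothHom.inv (IsSmoothHom.det hA) hdet).mul h
  rw [add_zero] at h2
  -- The adjugate is given by determinants with a row replaced by a unit vector.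
  convert h2 using 4 with q
  ext a b
  by_cases hab : a = j
  · subst hab; simp
  · simp [hab]

end LorentzFinsler

namespace LorentzFinsler

/-! ### The spray, the Chern connection and the curvature in coordinates -/

variable {n : ℕ} {M : Type*} [TopologicalSpace M] [ChartedSpace (Model n) M]
  [IsManifold (𝓡 (n + 1)) ∞ M]

theorem IsSmoothHom.of_eq {W : Set (Model n × Model n)} {k l : ℤ} {f : Model n × Model n → ℝ}
    (hf : IsSmoothHom W k f) (h : k = l) : IsSmoothHom W l f := h ▸ hf

/-- On the conic open set `W`, the function `L` is smooth, positively `2`-homogeneous and has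
non-degenerate fundamental tensor in the chart around `x₀`. -/
structure IsCoordNondegenerate (L : TangentBundle (𝓡 (n + 1)) M → ℝ) (x₀ : M)
    (W : Set (Model n × Model n)) : Prop where
  conic : IsConic W
  isSmoothHom : IsSmoothHom W 2 (coordL L x₀)
  det_ne_zero : ∀ q ∈ W, (Matrix.of fun i j => coordG L x₀ i j q).det ≠ 0

section Contractions

variable {ι : Type*} [Fintype ι]

theorem sum_sum_eq_of_forall_eq {F G H K : ι → ι → ℝ} (h : ∀ i j, F i j = G i j + H i j - K i j) :
    ∑ i, ∑ j, F i j = ∑ i, ∑ j, G i j + ∑ i, ∑ j, H i j - ∑ i, ∑ j, K i j := by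
  simp only [h, Finset.sum_sub_distrib, Finset.sum_add_distrib]

theorem sum_sum_sub (F G : ι → ι → ℝ) :
    ∑ i, ∑ j, (F i j - G i j) = ∑ i, ∑ j, F i j - ∑ i, ∑ j, G i j := by
  simp only [Finset.sum_sub_distrib]

theorem sum_sum_contract (a v : ι → ℝ) (T : ι → ι → ι → ℝ) :
    ∑ β, ∑ γ, (1 / 2 * ∑ δ, a δ * T δ β γ) * v β * v γ
      = 1 / 2 * ∑ δ, a δ * ∑ β, ∑ γ, T δ β γ * v β * v γ := by
  simp only [Finset.mul_sum, Finset.sum_mul]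
  rw [Finset.sum_comm_cycle]
  refine Finset.sum_congr rfl fun δ _ => ?_
  refine Finset.sum_congr rfl fun β _ => ?_
  exact Finset.sum_congr rfl fun γ _ => by ring

/-- The terms `H^μ_{ij}` stand for the Cartan tensor, which vanishes on `v`; hence so does its
contribution to the Chern connection when the last two slots are filled with `v`. -/
theorem cartan_contract_upper {H : ι → ι → ι → ℝ} (N : ι → ι → ℝ)
    {v : ι → ℝ} (h : ∀ μ i, ∑ j, H μ i j * v j = 0) (hs : ∀ μ i j, H μ i j = H μ j i) (δ : ι) :
    ∑ β, ∑ γ, (∑ μ, (H μ δ γ * N μ β + H μ β δ * N μ γ - H μ β γ * N μ δ)) * v β * v γ = 0 := by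
  rw [sum_sum_eq_of_forall_eq (G := fun β γ => ∑ μ, (H μ δ γ * v γ) * (N μ β * v β))
    (H := fun β γ => ∑ μ, (H μ δ β * v β) * (N μ γ * v γ))
    (K := fun β γ => ∑ μ, (H μ β γ * v γ) * (v β * N μ δ)) fun β γ => by
      rw [Finset.sum_mul, Finset.sum_mul, ← Finset.sum_add_distrib, ← Finset.sum_sub_distrib]
      exact Finset.sum_congr rfl fun μ _ => by rw [hs μ δ β]; ring]
  have h1 : ∑ β, ∑ γ, ∑ μ, (H μ δ γ * v γ) * (N μ β * v β) = 0 :=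
    Finset.sum_eq_zero fun β _ => by
      rw [Finset.sum_comm]
      exact Finset.sum_eq_zero fun μ _ => by rw [← Finset.sum_mul, h, zero_mul]
  have h2 : ∑ β, ∑ γ, ∑ μ, (H μ δ β * v β) * (N μ γ * v γ) = 0 := by
    rw [Finset.sum_comm, h1]
  have h3 : ∑ β, ∑ γ, ∑ μ, (H μ β γ * v γ) * (v β * N μ δ) = 0 :=
    Finset.sum_eq_zero fun β _ => by
      rw [Finset.sum_comm]
      exact Finset.sum_eq_zero fun μ _ => by rw [← Finset.sum_mul, h, zero_mul]
  rw [h1, h2, h3, add_zero, sub_zero]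

/-- As `cartan_contract_upper`, with the first two slots filled with `v`. -/
theorem cartan_contract_lower {H : ι → ι → ι → ℝ} (N : ι → ι → ℝ)
    {v : ι → ℝ} (h : ∀ μ i, ∑ j, H μ i j * v j = 0) (hs : ∀ μ i j, H μ i j = H μ j i) (α : ι) :
    ∑ δ, ∑ β, (∑ μ, (H μ δ α * N μ β + H μ β δ * N μ α - H μ β α * N μ δ)) * v δ * v β = 0 := by
  rw [sum_sum_eq_of_forall_eq (G := fun δ β => ∑ μ, (H μ α δ * v δ) * (N μ β * v β))
    (H := fun δ β => ∑ μ, (H μ δ β * v β) * (N μ α * v δ))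
    (K := fun δ β => ∑ μ, (H μ α β * v β) * (N μ δ * v δ)) fun β γ => by
      rw [Finset.sum_mul, Finset.sum_mul, ← Finset.sum_add_distrib, ← Finset.sum_sub_distrib]
      exact Finset.sum_congr rfl fun μ _ => by rw [hs μ α γ, hs μ α β, hs μ β γ]; ring]
  have h1 : ∑ δ, ∑ β, ∑ μ, (H μ α β * v β) * (N μ δ * v δ) = 0 :=
    Finset.sum_eq_zero fun β _ => by
      rw [Finset.sum_comm]
      exact Finset.sum_eq_zero fun μ _ => by rw [← Finset.sum_mul, h, zero_mul]
  have h2 : ∑ δ, ∑ β, ∑ μ, (H μ α δ * v δ) * (N μ β * v β) = 0 := by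
    rw [Finset.sum_comm, h1]
  have h3 : ∑ δ, ∑ β, ∑ μ, (H μ δ β * v β) * (N μ α * v δ) = 0 :=
    Finset.sum_eq_zero fun β _ => by
      rw [Finset.sum_comm]
      exact Finset.sum_eq_zero fun μ _ => by rw [← Finset.sum_mul, h, zero_mul]
  rw [h1, h2, h3, add_zero, sub_zero]

end Contractions

/-- The Christoffel expression of the first kind
`∂g_{δγ}/∂x^β + ∂g_{βδ}/∂x^γ - ∂g_{βγ}/∂x^δ`. -/
noncomputable def formalLower (L : TangentBundle (𝓡 (n + 1)) M → ℝ) (x₀ : M) (δ β γ : Fin (n + 1))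
    (q : Model n × Model n) : ℝ :=
  dx β (coordG L x₀ δ γ) q + dx γ (coordG L x₀ β δ) q - dx δ (coordG L x₀ β γ) q

/-- The Cartan-tensor terms that turn the Christoffel expression of the first kind into that of the
Chern connection. -/
noncomputable def cartanLower (L : TangentBundle (𝓡 (n + 1)) M → ℝ) (x₀ : M) (δ β γ : Fin (n + 1))
    (q : Model n × Model n) : ℝ :=
  ∑ μ, (dv μ (coordG L x₀ δ γ) q * nonlinConn L x₀ μ β q
    + dv μ (coordG L x₀ β δ) q * nonlinConn L x₀ μ γ q
    - dv μ (coordG L x₀ β γ) q * nonlinConn L x₀ μ δ q)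

theorem chernChristoffel_eq (L : TangentBundle (𝓡 (n + 1)) M → ℝ) (x₀ : M) (α β γ : Fin (n + 1))
    (q : Model n × Model n) :
    chernChristoffel L x₀ α β γ q = 1 / 2 * ∑ δ, coordGInv L x₀ α δ q *
      (formalLower L x₀ δ β γ q - cartanLower L x₀ δ β γ q) := by
  rw [chernChristoffel, formalChristoffel, ← mul_sub, ← Finset.sum_sub_distrib]
  simp only [← Finset.mul_sum, ← mul_sub]
  rfl

theorem two_mul_spray (L : TangentBundle (𝓡 (n + 1)) M → ℝ) (x₀ : M) (α : Fin (n + 1))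
    (q : Model n × Model n) :
    2 * spray L x₀ α q = 1 / 2 * ∑ δ, coordGInv L x₀ α δ q *
      ∑ β, ∑ γ, formalLower L x₀ δ β γ q * q.2 β * q.2 γ := by
  rw [← sum_sum_contract (fun δ => coordGInv L x₀ α δ q) (fun i => q.2 i)
    fun δ β γ => formalLower L x₀ δ β γ q, spray, ← mul_assoc]
  norm_num
  rfl

namespace IsCoordNondegenerate

variable {L : TangentBundle (𝓡 (n + 1)) M → ℝ} {x₀ : M} {W : Set (Model n × Model n)}
  {q : Model n × Model n}

theorem dvL (h : IsCoordNondegenerate L x₀ W) (α : Fin (n + 1)) :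
    IsSmoothHom W 1 (dv α (coordL L x₀)) :=
  (h.isSmoothHom.dv h.conic α).of_eq (by norm_num)

theorem coordG (h : IsCoordNondegenerate L x₀ W) (α β : Fin (n + 1)) :
    IsSmoothHom W 0 (coordG L x₀ α β) :=
  ((h.dvL β).dv h.conic α).of_eq (by norm_num)

theorem coordGInv (h : IsCoordNondegenerate L x₀ W) (α β : Fin (n + 1)) :
    IsSmoothHom W 0 (coordGInv L x₀ α β) :=
  IsSmoothHom.matrix_inv h.coordG h.det_ne_zero α β

theorem formalChristoffel (h : IsCoordNondegenerate L x₀ W) (α β γ : Fin (n + 1)) :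
    IsSmoothHom W 0 (formalChristoffel L x₀ α β γ) :=
  (IsSmoothHom.sum _ fun δ _ => ((h.coordGInv α δ).mul
    ((((h.coordG δ γ).dx h.conic β).add ((h.coordG β δ).dx h.conic γ)).sub
      ((h.coordG β γ).dx h.conic δ))).of_eq (by norm_num)).const_mul _

theorem spray (h : IsCoordNondegenerate L x₀ W) (α : Fin (n + 1)) :
    IsSmoothHom W 2 (spray L x₀ α) :=
  (IsSmoothHom.sum _ fun β _ => IsSmoothHom.sum _ fun γ _ =>
    (((h.formalChristoffel α β γ).mul (isSmoothHom_snd β)).mul (isSmoothHom_snd γ)).of_eq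
      (by norm_num)).const_mul _

theorem nonlinConn (h : IsCoordNondegenerate L x₀ W) (α β : Fin (n + 1)) :
    IsSmoothHom W 1 (nonlinConn L x₀ α β) :=
  ((h.spray α).dv h.conic β).of_eq (by norm_num)

theorem dvG_mul_nonlinConn (h : IsCoordNondegenerate L x₀ W) (μ δ γ β : Fin (n + 1)) :
    IsSmoothHom W 0 (fun q => dv μ (LorentzFinsler.coordG L x₀ δ γ) q
      * LorentzFinsler.nonlinConn L x₀ μ β q) :=
  (((h.coordG δ γ).dv h.conic μ).mul (h.nonlinConn μ β)).of_eq (by norm_num)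

theorem chernChristoffel (h : IsCoordNondegenerate L x₀ W) (α β γ : Fin (n + 1)) :
    IsSmoothHom W 0 (chernChristoffel L x₀ α β γ) :=
  (h.formalChristoffel α β γ).sub
    ((IsSmoothHom.sum _ fun δ _ => IsSmoothHom.sum _ fun μ _ =>
      ((h.coordGInv α δ).mul (((h.dvG_mul_nonlinConn μ δ γ β).add
        (h.dvG_mul_nonlinConn μ β δ γ)).sub (h.dvG_mul_nonlinConn μ β γ δ))).of_eq
        (by norm_num)).const_mul _)

theorem coordR (h : IsCoordNondegenerate L x₀ W) (α β : Fin (n + 1)) :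
    IsSmoothHom W 2 (coordR L x₀ α β) :=
  ((((h.spray α).dx h.conic β).const_mul 2).sub
    (IsSmoothHom.sum _ fun γ _ =>
      ((((h.nonlinConn α β).dx h.conic γ).mul (isSmoothHom_snd γ)).of_eq (by norm_num)).sub
        (((((h.nonlinConn α β).dv h.conic γ).const_mul 2).mul (h.spray γ)).of_eq
          (by norm_num)))).sub
    (IsSmoothHom.sum _ fun γ _ => ((h.nonlinConn α γ).mul (h.nonlinConn γ β)).of_eq (by norm_num))

theorem coordG_symm (h : IsCoordNondegenerate L x₀ W) (hq : q ∈ W) (α β : Fin (n + 1)) :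
    LorentzFinsler.coordG L x₀ α β q = LorentzFinsler.coordG L x₀ β α q :=
  h.isSmoothHom.dv_dv_comm h.conic hq α β

theorem dv_coordG_symm (h : IsCoordNondegenerate L x₀ W) (hq : q ∈ W) (μ α β : Fin (n + 1)) :
    dv μ (LorentzFinsler.coordG L x₀ α β) q = dv μ (LorentzFinsler.coordG L x₀ β α) q :=
  h.conic.dv_congr hq (fun _ hp => h.coordG_symm hp α β) μ

theorem dx_coordG_symm (h : IsCoordNondegenerate L x₀ W) (hq : q ∈ W) (μ α β : Fin (n + 1)) :
    dx μ (LorentzFinsler.coordG L x₀ α β) q = dx μ (LorentzFinsler.coordG L x₀ β α) q :=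
  h.conic.dx_congr hq (fun _ hp => h.coordG_symm hp α β) μ

/-- The Cartan tensor vanishes on `v`. -/
theorem sum_dv_coordG (h : IsCoordNondegenerate L x₀ W) (hq : q ∈ W) (μ α : Fin (n + 1)) :
    ∑ β, dv μ (LorentzFinsler.coordG L x₀ α β) q * q.2 β = 0 := by
  have e := (h.coordG μ α).euler h.conic hq
  rw [Int.cast_zero, zero_mul] at e
  rw [← e]
  refine Finset.sum_congr rfl fun β _ => ?_
  rw [h.dv_coordG_symm hq μ α β, mul_comm]
  congr 1
  exact (h.dvL α).dv_dv_comm h.conic hq μ β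

/-- `g_v(v, ·) = ∂L/∂v`, by Euler's identity. -/
theorem sum_coordG (h : IsCoordNondegenerate L x₀ W) (hq : q ∈ W) (α : Fin (n + 1)) :
    ∑ β, q.2 β * LorentzFinsler.coordG L x₀ β α q = dv α (coordL L x₀) q := by
  have := (h.dvL α).euler h.conic hq
  rwa [Int.cast_one, one_mul] at this

theorem sum_dx_coordG (h : IsCoordNondegenerate L x₀ W) (hq : q ∈ W) (α β : Fin (n + 1)) :
    ∑ δ, q.2 δ * dx α (LorentzFinsler.coordG L x₀ δ β) q = dx α (dv β (coordL L x₀)) q := by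
  have e := ((h.dvL β).dx h.conic α).euler h.conic hq
  rw [Int.cast_one, one_mul] at e
  rw [← e]
  refine Finset.sum_congr rfl fun δ _ => ?_
  congr 1
  exact (h.dvL β).dx_dv_comm h.conic hq α δ

theorem sum_dx_dv_coordL (h : IsCoordNondegenerate L x₀ W) (hq : q ∈ W) (α : Fin (n + 1)) :
    ∑ β, q.2 β * dx α (dv β (coordL L x₀)) q = 2 * dx α (coordL L x₀) q := by
  have e := (h.isSmoothHom.dx h.conic α).euler h.conic hq
  rw [Int.cast_ofNat] at e
  rw [← e]
  refine Finset.sum_congr rfl fun δ _ => ?_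
  congr 1
  exact h.isSmoothHom.dx_dv_comm h.conic hq α δ

theorem sum_coordG_mul_coordGInv (h : IsCoordNondegenerate L x₀ W) (hq : q ∈ W)
    (α β : Fin (n + 1)) :
    ∑ δ, LorentzFinsler.coordG L x₀ α δ q * LorentzFinsler.coordGInv L x₀ δ β q
      = if α = β then 1 else 0 := by
  have := Matrix.mul_nonsing_inv (Matrix.of fun i j => LorentzFinsler.coordG L x₀ i j q)
    (isUnit_iff_ne_zero.2 (h.det_ne_zero q hq))
  have := congrFun (congrFun this α) β
  rwa [Matrix.mul_apply, Matrix.one_apply] at this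

/-- Raising the index of `∂L/∂v = g_v(v, ·)` gives `v`. -/
theorem sum_dvL_mul_coordGInv (h : IsCoordNondegenerate L x₀ W) (hq : q ∈ W) (δ : Fin (n + 1)) :
    ∑ α, dv α (coordL L x₀) q * LorentzFinsler.coordGInv L x₀ α δ q = q.2 δ := by
  simp only [← h.sum_coordG hq, Finset.sum_mul, mul_assoc]
  rw [Finset.sum_comm]
  simp only [← Finset.mul_sum, h.sum_coordG_mul_coordGInv hq]
  simp

theorem sum_formalLower (h : IsCoordNondegenerate L x₀ W) (hq : q ∈ W) (δ : Fin (n + 1)) :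
    ∑ β, ∑ γ, formalLower L x₀ δ β γ q * q.2 β * q.2 γ
      = 2 * ∑ β, q.2 β * dx β (dv δ (coordL L x₀)) q - 2 * dx δ (coordL L x₀) q := by
  rw [sum_sum_eq_of_forall_eq
    (G := fun β γ => q.2 β * (q.2 γ * dx β (LorentzFinsler.coordG L x₀ γ δ) q))
    (H := fun β γ => q.2 γ * (q.2 β * dx γ (LorentzFinsler.coordG L x₀ β δ) q))
    (K := fun β γ => q.2 β * (q.2 γ * dx δ (LorentzFinsler.coordG L x₀ γ β) q)) fun β γ => by
      rw [formalLower, h.dx_coordG_symm hq β δ γ, h.dx_coordG_symm hq δ β γ]; ring]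
  rw [Finset.sum_comm (f := fun β γ => q.2 γ * _)]
  simp only [← Finset.mul_sum, h.sum_dx_coordG hq, h.sum_dx_dv_coordL hq]
  ring

/-- Contracted twice with `v`, the Chern connection equals the formal Christoffel symbols, because the
Cartan tensor vanishes on `v`. -/
theorem sum_chernChristoffel (h : IsCoordNondegenerate L x₀ W) (hq : q ∈ W) (α : Fin (n + 1)) :
    ∑ β, ∑ γ, LorentzFinsler.chernChristoffel L x₀ α β γ q * q.2 β * q.2 γ
      = 2 * LorentzFinsler.spray L x₀ α q := by
  simp only [chernChristoffel_eq]
  rw [sum_sum_contract (fun δ => LorentzFinsler.coordGInv L x₀ α δ q) (fun i => q.2 i)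
    fun δ β γ => formalLower L x₀ δ β γ q - cartanLower L x₀ δ β γ q, two_mul_spray]
  congr 1
  refine Finset.sum_congr rfl fun δ _ => ?_
  have hC : ∑ β, ∑ γ, cartanLower L x₀ δ β γ q * q.2 β * q.2 γ = 0 :=
    cartan_contract_upper (H := fun μ i j => dv μ (LorentzFinsler.coordG L x₀ i j) q)
      (fun μ i => LorentzFinsler.nonlinConn L x₀ μ i q) (v := fun i => q.2 i)
      (h.sum_dv_coordG hq) (h.dv_coordG_symm hq) δ
  simp only [sub_mul]
  rw [sum_sum_sub, hC, sub_zero]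

/-- The spray coefficients with lowered index, as the Euler--Lagrange expression of `L`. -/
theorem two_mul_sum_coordG_mul_spray (h : IsCoordNondegenerate L x₀ W) (hq : q ∈ W)
    (α : Fin (n + 1)) :
    2 * ∑ β, LorentzFinsler.coordG L x₀ α β q * LorentzFinsler.spray L x₀ β q
      = ∑ β, q.2 β * dx β (dv α (coordL L x₀)) q - dx α (coordL L x₀) q := by
  have e : ∀ β, 2 * (LorentzFinsler.coordG L x₀ α β q * LorentzFinsler.spray L x₀ β q)
      = ∑ δ, LorentzFinsler.coordG L x₀ α β q * LorentzFinsler.coordGInv L x₀ β δ q *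
        (1 / 2 * ∑ β, ∑ γ, formalLower L x₀ δ β γ q * q.2 β * q.2 γ) := by
    intro β
    rw [mul_left_comm, two_mul_spray, Finset.mul_sum, Finset.mul_sum]
    exact Finset.sum_congr rfl fun δ _ => by ring
  rw [Finset.mul_sum, Finset.sum_congr rfl fun β _ => e β, Finset.sum_comm]
  simp only [← Finset.sum_mul, h.sum_coordG_mul_coordGInv hq, h.sum_formalLower hq]
  simp
  ring

/-- The Euler--Lagrange form of the geodesic equation: along a geodesic the covector `∂L/∂v` is
parallel for the Chern connection. -/
theorem eulerLagrange (h : IsCoordNondegenerate L x₀ W) (hq : q ∈ W) (α : Fin (n + 1)) :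
    ∑ β, q.2 β * dx β (dv α (coordL L x₀)) q
        - 2 * ∑ β, LorentzFinsler.coordG L x₀ α β q * LorentzFinsler.spray L x₀ β q
      = ∑ γ, dv γ (coordL L x₀) q
          * ∑ β, LorentzFinsler.chernChristoffel L x₀ γ β α q * q.2 β := by
  rw [h.two_mul_sum_coordG_mul_spray hq, sub_sub_cancel]
  have hC : ∑ δ, ∑ β, cartanLower L x₀ δ β α q * q.2 δ * q.2 β = 0 :=
    cartan_contract_lower (H := fun μ i j => dv μ (LorentzFinsler.coordG L x₀ i j) q)
      (fun μ i => LorentzFinsler.nonlinConn L x₀ μ i q) (v := fun i => q.2 i)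
      (h.sum_dv_coordG hq) (h.dv_coordG_symm hq) α
  have hF : ∑ δ, ∑ β, formalLower L x₀ δ β α q * q.2 δ * q.2 β = 2 * dx α (coordL L x₀) q := by
    rw [sum_sum_eq_of_forall_eq
      (G := fun δ β => q.2 β * (q.2 δ * dx β (LorentzFinsler.coordG L x₀ δ α) q))
      (H := fun δ β => q.2 δ * (q.2 β * dx α (LorentzFinsler.coordG L x₀ β δ) q))
      (K := fun δ β => q.2 δ * (q.2 β * dx δ (LorentzFinsler.coordG L x₀ β α) q)) fun δ β => by
        rw [formalLower]; ring]
    rw [Finset.sum_comm (f := fun δ β => q.2 β * _)]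
    simp only [← Finset.mul_sum, h.sum_dx_coordG hq, h.sum_dx_dv_coordL hq]
    ring
  have e : ∀ γ, dv γ (coordL L x₀) q
        * ∑ β, LorentzFinsler.chernChristoffel L x₀ γ β α q * q.2 β
      = ∑ δ, dv γ (coordL L x₀) q * LorentzFinsler.coordGInv L x₀ γ δ q *
        (1 / 2 * ∑ β, (formalLower L x₀ δ β α q - cartanLower L x₀ δ β α q) * q.2 β) := by
    intro γ
    simp only [chernChristoffel_eq, Finset.mul_sum, Finset.sum_mul]
    rw [Finset.sum_comm]
    exact Finset.sum_congr rfl fun δ _ => Finset.sum_congr rfl fun β _ => by ring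
  rw [Finset.sum_congr rfl fun γ _ => e γ, Finset.sum_comm]
  simp only [← Finset.sum_mul, h.sum_dvL_mul_coordGInv hq]
  have e2 : ∀ δ, q.2 δ
        * (1 / 2 * ∑ β, (formalLower L x₀ δ β α q - cartanLower L x₀ δ β α q) * q.2 β)
      = 1 / 2 * ∑ β, (formalLower L x₀ δ β α q * q.2 δ * q.2 β
        - cartanLower L x₀ δ β α q * q.2 δ * q.2 β) := by
    intro δ
    rw [mul_left_comm, Finset.mul_sum]
    congr 1
    exact Finset.sum_congr rfl fun β _ => by ring
  rw [Finset.sum_congr rfl fun δ _ => e2 δ, ← Finset.mul_sum, sum_sum_sub, hF, hC]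
  ring

/-- The vector `v` is in the kernel of `R_v`: by Euler's identity for the functions `G`, `N` and their
derivatives, the terms of `R^α_β v^β` cancel. -/
theorem sum_coordR (h : IsCoordNondegenerate L x₀ W) (hq : q ∈ W) (α : Fin (n + 1)) :
    ∑ β, LorentzFinsler.coordR L x₀ α β q * q.2 β = 0 := by
  have h1 : ∀ γ, ∑ β, q.2 β * dx γ (LorentzFinsler.nonlinConn L x₀ α β) q
      = 2 * dx γ (LorentzFinsler.spray L x₀ α) q := by
    intro γ
    have e := ((h.spray α).dx h.conic γ).euler h.conic hq
    rw [Int.cast_ofNat] at e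
    rw [← e]
    refine Finset.sum_congr rfl fun β _ => ?_
    congr 1
    exact (h.spray α).dx_dv_comm h.conic hq γ β
  have h2 : ∀ γ, ∑ β, q.2 β * dv γ (LorentzFinsler.nonlinConn L x₀ α β) q
      = LorentzFinsler.nonlinConn L x₀ α γ q := by
    intro γ
    have e := (h.nonlinConn α γ).euler h.conic hq
    rw [Int.cast_one, one_mul] at e
    rw [← e]
    refine Finset.sum_congr rfl fun β _ => ?_
    congr 1
    exact (h.spray α).dv_dv_comm h.conic hq γ β
  have h3 : ∀ γ, ∑ β, q.2 β * LorentzFinsler.nonlinConn L x₀ γ β q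
      = 2 * LorentzFinsler.spray L x₀ γ q := by
    intro γ
    have e := (h.spray γ).euler h.conic hq
    rwa [Int.cast_ofNat] at e
  have e : ∀ β, LorentzFinsler.coordR L x₀ α β q * q.2 β
      = 2 * (q.2 β * dx β (LorentzFinsler.spray L x₀ α) q)
        - ∑ γ, (q.2 γ * (q.2 β * dx γ (LorentzFinsler.nonlinConn L x₀ α β) q)
          - 2 * LorentzFinsler.spray L x₀ γ q
            * (q.2 β * dv γ (LorentzFinsler.nonlinConn L x₀ α β) q))
        - ∑ γ, LorentzFinsler.nonlinConn L x₀ α γ q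
            * (q.2 β * LorentzFinsler.nonlinConn L x₀ γ β q) := by
    intro β
    rw [LorentzFinsler.coordR, sub_mul, sub_mul, Finset.sum_mul, Finset.sum_mul]
    congr 1
    · congr 1
      · ring
      · exact Finset.sum_congr rfl fun γ _ => by ring
    · exact Finset.sum_congr rfl fun γ _ => by ring
  simp only [e, Finset.sum_sub_distrib]
  rw [Finset.sum_comm (f := fun β γ => q.2 γ * _), Finset.sum_comm (f := fun β γ => 2 * _ * _),
    Finset.sum_comm (f := fun β γ => LorentzFinsler.nonlinConn L x₀ α γ q * _)]
  simp only [← Finset.mul_sum, h1, h2, h3]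
  simp only [Finset.mul_sum, ← Finset.sum_sub_distrib]
  exact Finset.sum_eq_zero fun γ _ => by ring

end IsCoordNondegenerate

end LorentzFinsler

namespace LorentzFinsler

/-! ### Tangent spaces in coordinates -/

variable {n : ℕ} {M : Type*} [TopologicalSpace M] [ChartedSpace (Model n) M]
  [IsManifold (𝓡 (n + 1)) ∞ M]

/-- The change of coordinates of `T_x M`, from the chart around `x` to the chart around `x₀`. -/
noncomputable def toChart (x₀ x : M) : Model n →L[ℝ] Model n :=
  tangentCoordChange (𝓡 (n + 1)) x x₀ x

/-- The change of coordinates of `T_x M`, from the chart around `x₀` to the chart around `x`. -/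
noncomputable def ofChart (x₀ x : M) : Model n →L[ℝ] Model n :=
  tangentCoordChange (𝓡 (n + 1)) x₀ x x

theorem toChart_self (x : M) : toChart (n := n) x x = 1 := by
  ext1 v
  exact tangentCoordChange_self (mem_extChartAt_source x)

theorem ofChart_self (x : M) : ofChart (n := n) x x = 1 := by
  ext1 v
  exact tangentCoordChange_self (mem_extChartAt_source x)

theorem toChart_mul_ofChart {x₀ x : M} (hx : x ∈ (chartAt (Model n) x₀).source) :
    toChart (n := n) x₀ x * ofChart x₀ x = 1 := by
  ext1 v
  have hx' : x ∈ (extChartAt (𝓡 (n + 1)) x₀).source := by rwa [extChartAt_source]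
  exact (tangentCoordChange_comp ⟨⟨hx', mem_extChartAt_source x⟩, hx'⟩).trans
    (tangentCoordChange_self hx')

theorem ofChart_mul_toChart {x₀ x : M} (hx : x ∈ (chartAt (Model n) x₀).source) :
    ofChart (n := n) x₀ x * toChart x₀ x = 1 := by
  ext1 v
  have hx' : x ∈ (extChartAt (𝓡 (n + 1)) x₀).source := by rwa [extChartAt_source]
  exact (tangentCoordChange_comp ⟨⟨mem_extChartAt_source x, hx'⟩, mem_extChartAt_source x⟩).trans
    (tangentCoordChange_self (mem_extChartAt_source x))

theorem tangentCoordChange_mul_toChart {x₀ y x : M} (hx : x ∈ (chartAt (Model n) x₀).source)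
    (hy : x ∈ (chartAt (Model n) y).source) :
    tangentCoordChange (𝓡 (n + 1)) y x₀ x * toChart y x = toChart x₀ x := by
  ext1 v
  have hx' : x ∈ (extChartAt (𝓡 (n + 1)) x₀).source := by rwa [extChartAt_source]
  have hy' : x ∈ (extChartAt (𝓡 (n + 1)) y).source := by rwa [extChartAt_source]
  exact tangentCoordChange_comp ⟨⟨mem_extChartAt_source x, hy'⟩, hx'⟩

theorem ofChart_mul_tangentCoordChange {x₀ y x : M} (hx : x ∈ (chartAt (Model n) x₀).source)
    (hy : x ∈ (chartAt (Model n) y).source) :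
    ofChart y x * tangentCoordChange (𝓡 (n + 1)) x₀ y x = ofChart x₀ x := by
  ext1 v
  have hx' : x ∈ (extChartAt (𝓡 (n + 1)) x₀).source := by rwa [extChartAt_source]
  have hy' : x ∈ (extChartAt (𝓡 (n + 1)) y).source := by rwa [extChartAt_source]
  exact tangentCoordChange_comp ⟨⟨hx', hy'⟩, mem_extChartAt_source x⟩

theorem tangentCoordChange_mul_self {x₀ y x : M} (hx : x ∈ (chartAt (Model n) x₀).source)
    (hy : x ∈ (chartAt (Model n) y).source) :
    tangentCoordChange (𝓡 (n + 1)) y x₀ x * tangentCoordChange (𝓡 (n + 1)) x₀ y x = 1 := by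
  ext1 v
  have hx' : x ∈ (extChartAt (𝓡 (n + 1)) x₀).source := by rwa [extChartAt_source]
  have hy' : x ∈ (extChartAt (𝓡 (n + 1)) y).source := by rwa [extChartAt_source]
  exact (tangentCoordChange_comp ⟨⟨hx', hy'⟩, hx'⟩).trans (tangentCoordChange_self hx')

/-- A field of endomorphisms of the tangent spaces along a curve, read as endomorphisms of
`ℝ^{n+1}`. -/
def endAt {c : ℝ → M}
    (A : (t : ℝ) → TangentSpace (𝓡 (n + 1)) (c t) →L[ℝ] TangentSpace (𝓡 (n + 1)) (c t))
    (t : ℝ) : Model n →L[ℝ] Model n := A t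

/-- The components of an endomorphism field are those in the chart around the foot point, by which
`T_x M` is identified with `ℝ^{n+1}`, conjugated by the change of coordinates. -/
theorem coordEnd_eq {x₀ : M} {c : ℝ → M}
    {A : (t : ℝ) → TangentSpace (𝓡 (n + 1)) (c t) →L[ℝ] TangentSpace (𝓡 (n + 1)) (c t)} {t : ℝ}
    (hx : c t ∈ (chartAt (Model n) x₀).source) :
    coordEnd x₀ c A t = toChart x₀ (c t) * endAt A t * ofChart x₀ (c t) := by
  unfold coordEnd ContinuousLinearMap.inCoordinates
  rw [TangentBundle.continuousLinearMapAt_trivializationAt_eq_core hx,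
    TangentBundle.symmL_trivializationAt_eq_core hx]
  rfl

/-- The induced coordinates on `TM`. -/
theorem chartAt_tangentBundle (x₀ : M) (p : TangentBundle (𝓡 (n + 1)) M) :
    chartAt (ModelProd (Model n) (Model n)) (⟨x₀, 0⟩ : TangentBundle (𝓡 (n + 1)) M) p
      = (chartAt (Model n) x₀ p.1, toChart x₀ p.1 p.2) := rfl

theorem coordL_chart (L : TangentBundle (𝓡 (n + 1)) M → ℝ) {x₀ x : M}
    (hx : x ∈ (chartAt (Model n) x₀).source) (w : Model n) :
    coordL L x₀ (chartAt (Model n) x₀ x, toChart x₀ x w) = L ⟨x, w⟩ := by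
  unfold coordL
  rw [← chartAt_tangentBundle x₀ ⟨x, w⟩, OpenPartialHomeomorph.left_inv]
  simpa using hx

/-- The set of coordinates of nonzero tangent vectors in the chart around `x₀`. -/
def chartDomain (n : ℕ) {M : Type*} [TopologicalSpace M] [ChartedSpace (Model n) M] (x₀ : M) :
    Set (Model n × Model n) :=
  {q | q.1 ∈ (chartAt (Model n) x₀).target ∧ q.2 ≠ 0}

omit [IsManifold (𝓡 (n + 1)) ∞ M] in
theorem isConic_chartDomain (x₀ : M) : IsConic (chartDomain n x₀) where
  isOpen := ((chartAt (Model n) x₀).open_target.preimage continuous_fst).inter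
    (isOpen_ne.preimage continuous_snd)
  smul_mem _ hq _ hc := ⟨hq.1, smul_ne_zero hc.ne' hq.2⟩

theorem toChart_ne_zero {x₀ x : M} (hx : x ∈ (chartAt (Model n) x₀).source) {w : Model n}
    (hw : w ≠ 0) : toChart x₀ x w ≠ 0 := fun h => hw <| by
  have := DFunLike.congr_fun (ofChart_mul_toChart hx) w
  simpa [h] using this.symm

theorem mem_chartDomain {x₀ x : M} (hx : x ∈ (chartAt (Model n) x₀).source) {w : Model n}
    (hw : w ≠ 0) : (chartAt (Model n) x₀ x, toChart x₀ x w) ∈ chartDomain n x₀ :=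
  ⟨(chartAt (Model n) x₀).map_source hx, toChart_ne_zero hx hw⟩

theorem exists_of_mem_chartDomain {x₀ : M} {q : Model n × Model n} (hq : q ∈ chartDomain n x₀) :
    ∃ x ∈ (chartAt (Model n) x₀).source, ∃ w : Model n, w ≠ 0 ∧
      q = (chartAt (Model n) x₀ x, toChart x₀ x w) := by
  have hx := (chartAt (Model n) x₀).map_target hq.1
  have h := DFunLike.congr_fun (toChart_mul_ofChart hx) q.2
  refine ⟨_, hx, ofChart x₀ ((chartAt (Model n) x₀).symm q.1) q.2, fun h0 => hq.2 ?_, ?_⟩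
  · simpa [h0] using h.symm
  · ext1
    · exact ((chartAt (Model n) x₀).right_inv hq.1).symm
    · exact h.symm

theorem contDiffOn_coordL {L : TangentBundle (𝓡 (n + 1)) M → ℝ} (hL : IsLorentzFinsler L)
    (x₀ : M) : ContDiffOn ℝ ∞ (coordL L x₀) (chartDomain n x₀) := by
  have h1 : ContMDiffOn (𝓡 (n + 1)).tangent (𝓡 (n + 1)).tangent ∞
      (chartAt (ModelProd (Model n) (Model n)) (⟨x₀, 0⟩ : TangentBundle (𝓡 (n + 1)) M)).symm
      (chartAt (ModelProd (Model n) (Model n))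
        (⟨x₀, 0⟩ : TangentBundle (𝓡 (n + 1)) M)).target := contMDiffOn_chart_symm
  have hsub : (show Set (ModelProd (Model n) (Model n)) from chartDomain n x₀) ⊆
      (chartAt (ModelProd (Model n) (Model n))
        (⟨x₀, 0⟩ : TangentBundle (𝓡 (n + 1)) M)).target := fun q hq =>
    (TangentBundle.mem_chart_target_iff q _).2 hq.1
  have h2 := hL.smooth.comp (h1.mono hsub) fun q hq => by
      obtain ⟨x, hx, w, hw, rfl⟩ := exists_of_mem_chartDomain hq
      have : (chartAt (ModelProd (Model n) (Model n))
          (⟨x₀, 0⟩ : TangentBundle (𝓡 (n + 1)) M)).symm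
          (chartAt (Model n) x₀ x, toChart x₀ x w) = ⟨x, w⟩ := by
        rw [← chartAt_tangentBundle x₀ ⟨x, w⟩, OpenPartialHomeomorph.left_inv]
        simpa using hx
      show (_ : TangentBundle (𝓡 (n + 1)) M).2 ≠ 0
      rw [this]
      exact hw
  rw [← contMDiffOn_iff_contDiffOn, modelWithCornersSelf_prod]
  exact h2

theorem isSmoothHom_coordL {L : TangentBundle (𝓡 (n + 1)) M → ℝ} (hL : IsLorentzFinsler L)
    (x₀ : M) : IsSmoothHom (chartDomain n x₀) 2 (coordL L x₀) where
  smooth := contDiffOn_coordL hL x₀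
  hom q hq c hc := by
    obtain ⟨x, hx, w, hw, rfl⟩ := exists_of_mem_chartDomain hq
    rw [← map_smul, coordL_chart L hx, coordL_chart L hx]
    exact hL.homogeneous x w c hc

/-- The fundamental tensor in the chart around `x₀`. -/
theorem fundTensor_eq_sum {L : TangentBundle (𝓡 (n + 1)) M → ℝ} (hL : IsLorentzFinsler L)
    {x₀ x : M} (hx : x ∈ (chartAt (Model n) x₀).source) {w : Model n} (hw : w ≠ 0)
    (a b : Model n) :
    fundTensor L ⟨x, w⟩ a b = ∑ α, ∑ β, toChart x₀ x a α * toChart x₀ x b β *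
      coordG L x₀ α β (chartAt (Model n) x₀ x, toChart x₀ x w) := by
  set y := chartAt (Model n) x₀ x with hy
  set T := toChart (n := n) x₀ x with hT
  have hdom : ∀ u : Model n, u ≠ 0 → (y, T u) ∈ chartDomain n x₀ := fun u hu =>
    mem_chartDomain hx hu
  have hS := isSmoothHom_coordL hL x₀
  have hW := isConic_chartDomain (n := n) x₀
  have hi : ∀ u : Model n, HasFDerivAt (fun u => (y, T u))
      ((ContinuousLinearMap.inr ℝ (Model n) (Model n)).comp T) u := fun u => by
    refine ((hasFDerivAt_const y u).prodMk T.hasFDerivAt).congr_fderiv ?_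
    ext v <;> simp
  have h1 : fderiv ℝ (fun u : Model n => L ⟨x, u⟩) =ᶠ[𝓝 w] fun u =>
      (fderiv ℝ (coordL L x₀) (y, T u)).comp
        ((ContinuousLinearMap.inr ℝ (Model n) (Model n)).comp T) := by
    filter_upwards [isOpen_ne.mem_nhds hw] with u hu
    have h2 : (fun u : Model n => L ⟨x, u⟩) = fun u => coordL L x₀ (y, T u) :=
      funext fun u => (coordL_chart L hx u).symm
    rw [h2]
    exact ((hS.differentiableAt hW (hdom u hu)).hasFDerivAt.comp u (hi u)).fderiv
  have h3 : HasFDerivAt (fderiv ℝ (coordL L x₀)) (fderiv ℝ (fderiv ℝ (coordL L x₀)) (y, T w))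
      (y, T w) :=
    (((hS.contDiffAt hW (hdom w hw)).fderiv_right (m := 1) (by norm_cast)).differentiableAt
      (by simp)).hasFDerivAt
  have h4 : fundTensor L ⟨x, w⟩ a b
      = fderiv ℝ (fderiv ℝ (coordL L x₀)) (y, T w) (0, T a) (0, T b) := by
    have h5 := (h3.comp w (hi w)).clm_comp (hasFDerivAt_const
      ((ContinuousLinearMap.inr ℝ (Model n) (Model n)).comp T) w)
    unfold fundTensor
    have h6 := (h5.congr_of_eventuallyEq h1).fderiv
    rw [h6]
    simp
  have h7 : ∀ α β, coordG L x₀ α β (y, T w) = fderiv ℝ (fderiv ℝ (coordL L x₀)) (y, T w)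
      (0, EuclideanSpace.single α 1) (0, EuclideanSpace.single β 1) := fun α β => by
    unfold coordG dv
    have := h3.clm_apply (hasFDerivAt_const
      ((0 : Model n), (EuclideanSpace.single β 1 : Model n)) (y, T w))
    rw [this.fderiv]
    simp
  have h8 : ∀ a : Model n, ((0 : Model n), a)
      = ∑ α, a α • ((0 : Model n), (EuclideanSpace.single α (1 : ℝ) : Model n)) := fun a => by
    ext i
    · simp [Prod.fst_sum]
    · simp [Prod.snd_sum, Pi.single_apply]
  rw [h4, h8 (T a), map_sum, sum_apply]
  refine Finset.sum_congr rfl fun α _ => ?_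
  rw [h8 (T b), map_sum]
  refine Finset.sum_congr rfl fun β _ => ?_
  rw [h7, map_smul, map_smul, smul_apply, smul_eq_mul, smul_eq_mul]
  ring

theorem isCoordNondegenerate_chartDomain {L : TangentBundle (𝓡 (n + 1)) M → ℝ}
    (hL : IsLorentzFinsler L) (x₀ : M) : IsCoordNondegenerate L x₀ (chartDomain n x₀) where
  conic := isConic_chartDomain x₀
  isSmoothHom := isSmoothHom_coordL hL x₀
  det_ne_zero q hq hdet := by
    obtain ⟨x, hx, w, hw, rfl⟩ := exists_of_mem_chartDomain hq
    obtain ⟨a, ha, ha0⟩ := Matrix.exists_mulVec_eq_zero_iff.2 hdet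
    obtain ⟨e, he⟩ := hL.lorentzian ⟨x, w⟩ hw
    set a' : Model n := ofChart x₀ x (WithLp.toLp 2 a) with ha'
    have h1 : toChart x₀ x a' = WithLp.toLp 2 a :=
      DFunLike.congr_fun (toChart_mul_ofChart hx) (WithLp.toLp 2 a)
    have h2 : ∀ b, fundTensor L ⟨x, w⟩ b a' = 0 := fun b => by
      rw [fundTensor_eq_sum hL hx hw, h1]
      refine Finset.sum_eq_zero fun α _ => ?_
      have := congrFun ha0 α
      simp only [Matrix.mulVec, dotProduct, Matrix.of_apply, Pi.zero_apply] at this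
      rw [← mul_zero (toChart x₀ x b α), ← this, Finset.mul_sum]
      exact Finset.sum_congr rfl fun β _ => by ring
    have h3 : a' = 0 := by
      refine e.ext_elem fun i => ?_
      have h4 := h2 (e i)
      rw [← e.sum_repr a', map_sum] at h4
      simp only [map_smul, he, smul_eq_mul] at h4
      simp only [mul_ite, mul_zero, Finset.sum_ite_eq, Finset.mem_univ, if_true] at h4
      split_ifs at h4 <;> simpa using h4
    apply ha
    rw [h3, map_zero] at h1
    simpa using (congrArg (WithLp.ofLp) h1).symm

end LorentzFinsler

namespace LorentzFinsler

/-! ### Curves and their velocities -/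

variable {n : ℕ} {M : Type*} [TopologicalSpace M] [ChartedSpace (Model n) M]
  [IsManifold (𝓡 (n + 1)) ∞ M]

section Curves

variable {c : ℝ → M} {U : Set ℝ} {t : ℝ} {x₀ : M}

theorem contDiffAt_coordCurve (hc : ContMDiffAt 𝓘(ℝ, ℝ) (𝓡 (n + 1)) ∞ c t)
    (hx : c t ∈ (chartAt (Model n) x₀).source) : ContDiffAt ℝ ∞ (coordCurve (n := n) x₀ c) t := by
  have h1 := (contMDiffAt_of_mem_maximalAtlas (I := 𝓡 (n + 1)) (n := ∞)
    (IsManifold.chart_mem_maximalAtlas x₀) hx).comp t hc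
  exact contMDiffAt_iff_contDiffAt.1 h1

theorem toChart_eq_mfderiv {x : M} (hx : x ∈ (chartAt (Model n) x₀).source) :
    toChart (n := n) x₀ x = mfderiv (𝓡 (n + 1)) 𝓘(ℝ, Model n) (chartAt (Model n) x₀) x := by
  have h1 := TangentBundle.continuousLinearMapAt_trivializationAt (I := 𝓡 (n + 1)) hx
  rw [TangentBundle.continuousLinearMapAt_trivializationAt_eq_core hx] at h1
  exact h1

theorem toChart_velocity (hc : MDifferentiableAt 𝓘(ℝ, ℝ) (𝓡 (n + 1)) c t)
    (hx : c t ∈ (chartAt (Model n) x₀).source) :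
    toChart x₀ (c t) (velocity c t).2 = deriv (coordCurve (n := n) x₀ c) t := by
  have h1 : MDifferentiableAt (𝓡 (n + 1)) 𝓘(ℝ, Model n) (chartAt (Model n) x₀) (c t) :=
    (contMDiffAt_of_mem_maximalAtlas (I := 𝓡 (n + 1)) (n := ∞)
      (IsManifold.chart_mem_maximalAtlas x₀) hx).mdifferentiableAt (by simp)
  have h2 := mfderiv_comp t h1 hc
  have h3 : coordCurve x₀ c = chartAt (Model n) x₀ ∘ c := rfl
  show _ = fderiv ℝ (coordCurve x₀ c) t 1
  rw [toChart_eq_mfderiv hx, h3, ← mfderiv_eq_fderiv, h2]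
  rfl

theorem chart_velocity (hc : MDifferentiableAt 𝓘(ℝ, ℝ) (𝓡 (n + 1)) c t)
    (hx : c t ∈ (chartAt (Model n) x₀).source) :
    (chartAt (Model n) x₀ (c t), toChart x₀ (c t) (velocity c t).2) = coordVelocity x₀ c t := by
  rw [toChart_velocity hc hx]; rfl

omit [IsManifold (𝓡 (n + 1)) ∞ M] in
/-- The chain rule for the velocity of a reparametrized curve. -/
theorem velocity_comp {φ : ℝ → ℝ} {φ' s : ℝ}
    (hc : MDifferentiableAt 𝓘(ℝ, ℝ) (𝓡 (n + 1)) c (φ s)) (hφ : HasDerivAt φ φ' s) :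
    velocity (n := n) (fun s => c (φ s)) s
      = ⟨c (φ s), φ' • (velocity (n := n) c (φ s)).2⟩ := by
  have h2 := mfderiv_comp s hc hφ.differentiableAt.mdifferentiableAt
  unfold velocity
  congr 1
  have h3 : (fun s => c (φ s)) = c ∘ φ := rfl
  rw [h3, h2, mfderiv_eq_fderiv, hφ.hasFDerivAt.fderiv]
  show (mfderiv 𝓘(ℝ, ℝ) (𝓡 (n + 1)) c (φ s)) ((1 : ℝ) • φ') = _
  rw [one_smul]
  conv_lhs => rw [show φ' = φ' • (1 : ℝ) by simp]
  exact map_smul _ _ _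

theorem contMDiffAt_velocity (hc : ∀ᶠ s in 𝓝 t, ContMDiffAt 𝓘(ℝ, ℝ) (𝓡 (n + 1)) ∞ c s) :
    ContMDiffAt 𝓘(ℝ, ℝ) (𝓡 (n + 1)).tangent ∞ (velocity (n := n) c) t := by
  rw [Bundle.contMDiffAt_totalSpace]
  refine ⟨hc.self_of_nhds, ?_⟩
  have hx : ∀ᶠ s in 𝓝 t, c s ∈ (chartAt (Model n) (c t)).source :=
    hc.self_of_nhds.continuousAt.eventually
      ((chartAt (Model n) (c t)).open_source.mem_nhds (mem_chart_source _ _))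
  have h1 : ContDiffAt ℝ ∞ (deriv (coordCurve (n := n) (c t) c)) t :=
    contDiffAt_deriv (contDiffAt_coordCurve hc.self_of_nhds (mem_chart_source _ _)) (by exact le_rfl)
  refine (contMDiffAt_iff_contDiffAt.2 h1).congr_of_eventuallyEq ?_
  filter_upwards [hc, hx] with s h2 h3
  exact toChart_velocity (h2.mdifferentiableAt (by simp)) h3

theorem differentiableAt_tangentCoordChange {x y : M}
    (hc : ContMDiffAt 𝓘(ℝ, ℝ) (𝓡 (n + 1)) ∞ c t)
    (hx : c t ∈ (chartAt (Model n) x).source) (hy : c t ∈ (chartAt (Model n) y).source) :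
    DifferentiableAt ℝ (fun s => (tangentCoordChange (𝓡 (n + 1)) x y (c s) :
      Model n →L[ℝ] Model n)) t := by
  have : IsManifold (𝓡 (n + 1)) (∞ + 1) M := by
    rw [show (∞ : WithTop ℕ∞) + 1 = ∞ from rfl]; infer_instance
  have h1 := contDiffOn_fderiv_coord_change (I := 𝓡 (n + 1)) (M := M) (n := ∞)
    (achart (Model n) x) (achart (Model n) y)
  have h2 : (((chartAt (Model n) x).extend (𝓡 (n + 1))).symm ≫
      (chartAt (Model n) y).extend (𝓡 (n + 1))).source ∈ 𝓝 (coordCurve (n := n) x c t) := by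
    have h3 : coordCurve (n := n) x c t ∈ (((chartAt (Model n) x).extend (𝓡 (n + 1))).symm ≫
        (chartAt (Model n) y).extend (𝓡 (n + 1))).source := by
      simp [coordCurve, hx, hy]
    have := (𝓡 (n + 1)).extendCoordChange_source_mem_nhdsWithin h3
    simpa using this
  have h4 := (((h1 _ (mem_of_mem_nhds h2)).contDiffAt h2).differentiableAt (by simp)).comp t
    ((contDiffAt_coordCurve hc hx).differentiableAt (by simp))
  exact h4

end Curves

end LorentzFinsler

namespace LorentzFinsler

/-! ### The projections at a unit timelike vector -/

variable {n : ℕ} {M : Type*} [TopologicalSpace M] [ChartedSpace (Model n) M]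
  [IsManifold (𝓡 (n + 1)) ∞ M]

/-- The covector `∂L/∂v` in the chart around `x₀`; by homogeneity it is `g_v(v, ·)`. -/
noncomputable def coordForm (L : TangentBundle (𝓡 (n + 1)) M → ℝ) (x₀ : M)
    (q : Model n × Model n) : Model n →L[ℝ] ℝ :=
  ∑ α, dv α (coordL L x₀) q • EuclideanSpace.proj (𝕜 := ℝ) α

theorem coordForm_apply (L : TangentBundle (𝓡 (n + 1)) M → ℝ) (x₀ : M)
    (q : Model n × Model n) (b : Model n) :
    coordForm L x₀ q b = ∑ α, dv α (coordL L x₀) q * b α := by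
  simp [coordForm]

section Projection

variable {L : TangentBundle (𝓡 (n + 1)) M → ℝ} {x₀ x : M} {w : Model n}

/-- By homogeneity, `g_v(v, ·)` is the differential of `L` along the fibre. -/
theorem fundTensor_self_left (hL : IsLorentzFinsler L) (hx : x ∈ (chartAt (Model n) x₀).source)
    (hw : w ≠ 0) (b : Model n) :
    fundTensor L ⟨x, w⟩ w b
      = coordForm L x₀ (chartAt (Model n) x₀ x, toChart x₀ x w) (toChart x₀ x b) := by
  rw [fundTensor_eq_sum hL hx hw, coordForm_apply, Finset.sum_comm]
  refine Finset.sum_congr rfl fun β _ => ?_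
  rw [← (isCoordNondegenerate_chartDomain hL x₀).sum_coordG (mem_chartDomain hx hw),
    Finset.sum_mul]
  exact Finset.sum_congr rfl fun α _ => by ring

theorem coordForm_self (hL : IsLorentzFinsler L) {q : Model n × Model n}
    (hq : q ∈ chartDomain n x₀) : coordForm L x₀ q q.2 = 2 * coordL L x₀ q := by
  have := (isSmoothHom_coordL hL x₀).euler (isConic_chartDomain x₀) hq
  rw [coordForm_apply]
  simp only [mul_comm (dv _ _ _)]
  simpa using this

theorem fundTensor_self_self (hL : IsLorentzFinsler L) (hw : w ≠ 0) :
    fundTensor L ⟨x, w⟩ w w = 2 * L ⟨x, w⟩ := by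
  have hx := mem_chart_source (Model n) x
  rw [fundTensor_self_left hL hx hw,
    coordForm_self hL (q := (chartAt (Model n) x x, toChart x x w)) (mem_chartDomain hx hw),
    coordL_chart L hx]

/-- The projection `1 - normalProj` to the line spanned by a unit timelike vector. -/
theorem one_sub_normalProj (hL : IsLorentzFinsler L) (hw : w ≠ 0) (h1 : L ⟨x, w⟩ = -1 / 2) :
    1 - normalProj L ⟨x, w⟩ = -(fundTensor L ⟨x, w⟩ w).smulRight w := by
  have h2 : fundTensor L ⟨x, w⟩ w w = -1 := by rw [fundTensor_self_self hL hw, h1]; norm_num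
  ext1 b
  simp [normalProj, h2]

/-- The projection to the line of `w` in the chart around `x₀`. -/
theorem toChart_mul_one_sub_normalProj (hL : IsLorentzFinsler L)
    (hx : x ∈ (chartAt (Model n) x₀).source) (hw : w ≠ 0) (h1 : L ⟨x, w⟩ = -1 / 2) :
    toChart x₀ x * (1 - normalProj L ⟨x, w⟩) * ofChart x₀ x
      = -(coordForm L x₀ (chartAt (Model n) x₀ x, toChart x₀ x w)).smulRight
          (toChart x₀ x w) := by
  rw [one_sub_normalProj hL hw h1]
  ext1 b
  have h2 : toChart x₀ x (ofChart x₀ x b) = b := DFunLike.congr_fun (toChart_mul_ofChart hx) b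
  simp [fundTensor_self_left hL hx hw, h2]

theorem one_sub_normalProj_mul_self (hL : IsLorentzFinsler L) (hw : w ≠ 0) (h1 : L ⟨x, w⟩ = -1 / 2) :
    (1 - normalProj L ⟨x, w⟩) * (1 - normalProj L ⟨x, w⟩) = 1 - normalProj L ⟨x, w⟩ := by
  have h2 : fundTensor L ⟨x, w⟩ w w = -1 := by rw [fundTensor_self_self hL hw, h1]; norm_num
  rw [one_sub_normalProj hL hw h1]
  ext1 b
  simp [h2]

theorem tr_normalProj (hL : IsLorentzFinsler L) (hw : w ≠ 0) (h1 : L ⟨x, w⟩ = -1 / 2) :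
    tr (normalProj L ⟨x, w⟩) = n := by
  have h2 : fundTensor L ⟨x, w⟩ w w = -1 := by rw [fundTensor_self_self hL hw, h1]; norm_num
  have h3 : tr (1 - normalProj L ⟨x, w⟩) = 1 := by
    rw [one_sub_normalProj hL hw h1, tr_neg, tr_smulRight, h2]; norm_num
  rw [tr_sub, tr_one] at h3
  linarith

theorem normalProj_mem (hL : IsLorentzFinsler L) (hw : w ≠ 0) (h1 : L ⟨x, w⟩ = -1 / 2)
    (b : Model n) : normalProj L ⟨x, w⟩ b ∈ normalSpace L ⟨x, w⟩ := by
  have h2 : fundTensor L ⟨x, w⟩ w w = -1 := by rw [fundTensor_self_self hL hw, h1]; norm_num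
  simp [normalSpace, normalProj, h2]

theorem mem_normalSpace_iff (hL : IsLorentzFinsler L) (hw : w ≠ 0) (h1 : L ⟨x, w⟩ = -1 / 2)
    (b : Model n) : b ∈ normalSpace L ⟨x, w⟩ ↔ (1 - normalProj L ⟨x, w⟩) b = 0 := by
  rw [one_sub_normalProj hL hw h1]
  simp [normalSpace, hw]

theorem mul_one_sub_normalProj (hL : IsLorentzFinsler L) (hw : w ≠ 0) (h1 : L ⟨x, w⟩ = -1 / 2)
    {A : Model n →L[ℝ] Model n} (hA : A w = 0) : A * (1 - normalProj L ⟨x, w⟩) = 0 := by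
  rw [one_sub_normalProj hL hw h1]
  ext1 b
  simp [hA]

/-- Since `R_v v = 0`, the curvature endomorphism is determined by its restriction to the normal
space. -/
theorem curvature_mul_one_sub_normalProj (hL : IsLorentzFinsler L) (hw : w ≠ 0)
    (h1 : L ⟨x, w⟩ = -1 / 2) :
    curvature L ⟨x, w⟩ * (1 - normalProj L ⟨x, w⟩) = 0 := by
  have h2 : curvature L ⟨x, w⟩ w = 0 := by
    ext α
    have h3 := (isCoordNondegenerate_chartDomain hL x).sum_coordR
      (mem_chartDomain (mem_chart_source (Model n) x) hw) α
    rw [toChart_self] at h3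
    have h4 : chartAt (ModelProd (Model n) (Model n)) (⟨x, 0⟩ : TangentBundle (𝓡 (n + 1)) M) ⟨x, w⟩
        = (chartAt (Model n) x x, w) := by
      rw [chartAt_tangentBundle, toChart_self]; rfl
    simp only [curvature, h4]
    exact h3
  exact mul_one_sub_normalProj hL hw h1 h2

end Projection

/-! ### Unit timelike geodesics -/

namespace FinslerSpacetime

variable (S : FinslerSpacetime n M)

theorem snd_ne_zero_of_futureTimelike {p : TangentBundle (𝓡 (n + 1)) M}
    (hp : p ∈ S.futureTimelike) : p.2 ≠ 0 :=
  fun h => (connectedComponentIn_subset _ _ hp.2).2 h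

theorem futureTimelike_subset_futureCausal : S.futureTimelike ⊆ S.futureCausal := fun _ hp =>
  ⟨S.snd_ne_zero_of_futureTimelike hp, subset_closure hp⟩

theorem L_of_F_eq_one {p : TangentBundle (𝓡 (n + 1)) M} (hp : S.F p = 1) : S.L p = -1 / 2 := by
  have h : -2 * S.L p = 1 := Real.sqrt_eq_one.1 hp
  linarith

/-- A unit speed timelike geodesic on the open set `U`. -/
structure IsUnitTimelikeGeodesic (η : ℝ → M) (U : Set ℝ) : Prop where
  isOpen : IsOpen U
  isGeodesicOn : S.IsGeodesicOn η U
  timelike : ∀ t ∈ U, velocity η t ∈ S.futureTimelike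
  unit : ∀ t ∈ U, S.F (velocity η t) = 1

variable {S}

theorem IsGeodesicOn.contMDiffAt {η : ℝ → M} {U : Set ℝ} (h : S.IsGeodesicOn η U)
    (hU : IsOpen U) {t : ℝ} (ht : t ∈ U) : ContMDiffAt 𝓘(ℝ, ℝ) (𝓡 (n + 1)) ∞ η t :=
  h.smooth.contMDiffAt (hU.mem_nhds ht)

theorem IsGeodesicOn.coordVelocity_mem {γ : ℝ → M} {V : Set ℝ} {t : ℝ} {x₀ : M}
    (h : S.IsGeodesicOn γ V) (hV : IsOpen V) (ht : t ∈ V)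
    (hx : γ t ∈ (chartAt (Model n) x₀).source) : coordVelocity x₀ γ t ∈ chartDomain n x₀ := by
  rw [← chart_velocity ((h.contMDiffAt hV ht).mdifferentiableAt (by simp)) hx]
  exact mem_chartDomain hx (h.causal t ht).1

theorem IsGeodesicOn.eventually_mem {γ : ℝ → M} {V : Set ℝ} {t : ℝ} {x₀ : M}
    (h : S.IsGeodesicOn γ V) (hV : IsOpen V) (ht : t ∈ V)
    (hx : γ t ∈ (chartAt (Model n) x₀).source) :
    ∀ᶠ s in 𝓝 t, s ∈ V ∧ γ s ∈ (chartAt (Model n) x₀).source :=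
  have hV' : ∀ᶠ s in 𝓝 t, s ∈ V := hV.mem_nhds ht
  hV'.and ((h.contMDiffAt hV ht).continuousAt.eventually
    ((chartAt (Model n) x₀).open_source.mem_nhds hx))

theorem IsGeodesicOn.hasDerivAt_coordVelocity {γ : ℝ → M} {V : Set ℝ} {t : ℝ} {x₀ : M}
    (h : S.IsGeodesicOn γ V) (hV : IsOpen V) (ht : t ∈ V)
    (hx : γ t ∈ (chartAt (Model n) x₀).source) :
    HasDerivAt (coordVelocity (n := n) x₀ γ)
      ((coordVelocity x₀ γ t).2, deriv (deriv (coordCurve x₀ γ)) t) t := by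
  have h1 := contDiffAt_coordCurve (h.contMDiffAt hV ht) hx
  exact (h1.differentiableAt (by simp)).hasDerivAt.prodMk
    ((contDiffAt_deriv (m := 1) h1 (by norm_cast)).differentiableAt (by simp)).hasDerivAt

namespace IsUnitTimelikeGeodesic

variable {η : ℝ → M} {U : Set ℝ} {t : ℝ} {x₀ : M}

theorem contMDiffAt (h : S.IsUnitTimelikeGeodesic η U) (ht : t ∈ U) :
    ContMDiffAt 𝓘(ℝ, ℝ) (𝓡 (n + 1)) ∞ η t := h.isGeodesicOn.contMDiffAt h.isOpen ht

theorem mdifferentiableAt (h : S.IsUnitTimelikeGeodesic η U) (ht : t ∈ U) :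
    MDifferentiableAt 𝓘(ℝ, ℝ) (𝓡 (n + 1)) η t := (h.contMDiffAt ht).mdifferentiableAt (by simp)

theorem L_velocity (h : S.IsUnitTimelikeGeodesic η U) (ht : t ∈ U) :
    S.L (velocity η t) = -1 / 2 := S.L_of_F_eq_one (h.unit t ht)

theorem velocity_ne_zero (h : S.IsUnitTimelikeGeodesic η U) (ht : t ∈ U) :
    (velocity (n := n) η t).2 ≠ 0 := S.snd_ne_zero_of_futureTimelike (h.timelike t ht)

theorem coordVelocity_mem (h : S.IsUnitTimelikeGeodesic η U) (ht : t ∈ U)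
    (hx : η t ∈ (chartAt (Model n) x₀).source) : coordVelocity x₀ η t ∈ chartDomain n x₀ :=
  h.isGeodesicOn.coordVelocity_mem h.isOpen ht hx

theorem eventually_mem (h : S.IsUnitTimelikeGeodesic η U) (ht : t ∈ U)
    (hx : η t ∈ (chartAt (Model n) x₀).source) :
    ∀ᶠ s in 𝓝 t, s ∈ U ∧ η s ∈ (chartAt (Model n) x₀).source :=
  h.isGeodesicOn.eventually_mem h.isOpen ht hx

theorem hasDerivAt_coordVelocity (h : S.IsUnitTimelikeGeodesic η U) (ht : t ∈ U)
    (hx : η t ∈ (chartAt (Model n) x₀).source) :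
    HasDerivAt (coordVelocity (n := n) x₀ η)
      ((coordVelocity x₀ η t).2, deriv (deriv (coordCurve x₀ η)) t) t :=
  h.isGeodesicOn.hasDerivAt_coordVelocity h.isOpen ht hx

end IsUnitTimelikeGeodesic

end FinslerSpacetime

end LorentzFinsler

namespace LorentzFinsler

/-! ### Parallel fields along a geodesic -/

variable {n : ℕ} {M : Type*} [TopologicalSpace M] [ChartedSpace (Model n) M]
  [IsManifold (𝓡 (n + 1)) ∞ M]

theorem connMatrix_apply (L : TangentBundle (𝓡 (n + 1)) M → ℝ) (x₀ : M) (c : ℝ → M) (t : ℝ)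
    (w : Model n) (α : Fin (n + 1)) :
    connMatrix L x₀ c t w α = ∑ γ, (∑ β, chernChristoffel L x₀ α β γ (coordVelocity x₀ c t)
      * (coordVelocity x₀ c t).2 β) * w γ := rfl

/-- A matrix of differentiable functions is a differentiable field of endomorphisms. -/
theorem differentiableAt_toEuclideanCLM {A : ℝ → Fin (n + 1) → Fin (n + 1) → ℝ} {t : ℝ}
    (hA : ∀ i j, DifferentiableAt ℝ (fun s => A s i j) t) :
    DifferentiableAt ℝ (fun s => Matrix.toEuclideanCLM (𝕜 := ℝ) (Matrix.of (A s))) t := by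
  have h : DifferentiableAt ℝ A t :=
    differentiableAt_pi.2 fun i => differentiableAt_pi.2 fun j => hA i j
  exact ((LinearMap.toContinuousLinearMap
    ((Matrix.toEuclideanCLM (n := Fin (n + 1)) (𝕜 := ℝ)).toAlgEquiv.toLinearMap.comp
      (Matrix.ofLinearEquiv ℝ).toLinearMap)).differentiableAt).comp t h

theorem hasDerivAt_smulRight {E : Type*} [NormedAddCommGroup E] [NormedSpace ℝ E]
    {φ : ℝ → E →L[ℝ] ℝ} {φ' : E →L[ℝ] ℝ} {v : ℝ → E} {v' : E} {t : ℝ}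
    (hφ : HasDerivAt φ φ' t) (hv : HasDerivAt v v' t) :
    HasDerivAt (fun s => (φ s).smulRight (v s)) (φ'.smulRight (v t) + (φ t).smulRight v') t :=
  (((ContinuousLinearMap.smulRightL ℝ E E).hasFDerivAt.comp_hasDerivAt t hφ).clm_apply hv)

/-- For a unit timelike curve, the projection `w ↦ -g_ċ(ċ, w) ċ` to the line of the velocity along the
normal space, in the chart around `x₀`. -/
noncomputable def lineProj (L : TangentBundle (𝓡 (n + 1)) M → ℝ) (x₀ : M) (c : ℝ → M) (s : ℝ) :
    Model n →L[ℝ] Model n :=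
  -(coordForm L x₀ (coordVelocity x₀ c s)).smulRight (coordVelocity x₀ c s).2

namespace FinslerSpacetime

variable {S : FinslerSpacetime n M}

namespace IsUnitTimelikeGeodesic

variable {η : ℝ → M} {U : Set ℝ} {t : ℝ} {x₀ : M}

theorem toChart_one_sub_normalProj (h : S.IsUnitTimelikeGeodesic η U) (ht : t ∈ U)
    (hx : η t ∈ (chartAt (Model n) x₀).source) :
    toChart x₀ (η t) * (1 - normalProj S.L (velocity η t)) * ofChart x₀ (η t)
      = lineProj S.L x₀ η t := by
  have h1 := toChart_mul_one_sub_normalProj S.isLorentzFinsler hx (h.velocity_ne_zero ht)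
    (h.L_velocity ht)
  rw [lineProj, ← chart_velocity (h.mdifferentiableAt ht) hx]
  exact h1

theorem differentiableAt_connMatrix (h : S.IsUnitTimelikeGeodesic η U) (ht : t ∈ U)
    (hx : η t ∈ (chartAt (Model n) x₀).source) :
    DifferentiableAt ℝ (connMatrix S.L x₀ η) t := by
  have hW := isCoordNondegenerate_chartDomain S.isLorentzFinsler x₀
  have hq := h.coordVelocity_mem ht hx
  have hd := (h.hasDerivAt_coordVelocity ht hx).differentiableAt
  refine differentiableAt_toEuclideanCLM fun α γ => DifferentiableAt.fun_sum fun β _ => ?_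
  exact ((((hW.chernChristoffel α β γ).mul (isSmoothHom_snd β)).differentiableAt hW.conic hq).comp
    t hd)

/-- The geodesic equation in terms of the Chern connection: the velocity of a geodesic is parallel. -/
theorem deriv_deriv_coordCurve (h : S.IsUnitTimelikeGeodesic η U) (ht : t ∈ U)
    (hx : η t ∈ (chartAt (Model n) x₀).source) :
    deriv (deriv (coordCurve x₀ η)) t = -connMatrix S.L x₀ η t (coordVelocity x₀ η t).2 := by
  have hW := isCoordNondegenerate_chartDomain S.isLorentzFinsler x₀
  ext α
  have h1 := h.isGeodesicOn.equation x₀ t ht hx α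
  rw [← hW.sum_chernChristoffel (h.coordVelocity_mem ht hx) α, Finset.sum_comm] at h1
  rw [PiLp.neg_apply, connMatrix_apply, eq_neg_iff_add_eq_zero, ← h1]
  simp only [Finset.sum_mul]

/-- The covector `∂L/∂v` is parallel along a geodesic. -/
theorem hasDerivAt_coordForm (h : S.IsUnitTimelikeGeodesic η U) (ht : t ∈ U)
    (hx : η t ∈ (chartAt (Model n) x₀).source) :
    HasDerivAt (fun s => coordForm S.L x₀ (coordVelocity x₀ η s))
      ((coordForm S.L x₀ (coordVelocity x₀ η t)).comp (connMatrix S.L x₀ η t)) t := by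
  have hW := isCoordNondegenerate_chartDomain S.isLorentzFinsler x₀
  have hq := h.coordVelocity_mem ht hx
  have hd := h.hasDerivAt_coordVelocity ht hx
  have h1 : ∀ α, HasDerivAt (fun s => dv α (coordL S.L x₀) (coordVelocity x₀ η s))
      (∑ γ, dv γ (coordL S.L x₀) (coordVelocity x₀ η t) * ∑ β,
        chernChristoffel S.L x₀ γ β α (coordVelocity x₀ η t) * (coordVelocity x₀ η t).2 β) t := by
    intro α
    refine (((hW.dvL α).differentiableAt hW.conic hq).hasFDerivAt.comp_hasDerivAt t
      hd).congr_deriv ?_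
    rw [fderiv_eq_sum, ← hW.eulerLagrange hq, sub_eq_add_neg]
    congr 1
    rw [Finset.mul_sum, ← Finset.sum_neg_distrib]
    refine Finset.sum_congr rfl fun β _ => ?_
    have h2 := h.isGeodesicOn.equation x₀ t ht hx β
    rw [eq_neg_of_add_eq_zero_left h2, hW.coordG_symm hq α β]
    unfold coordG
    ring
  have h2 := HasDerivAt.fun_sum (u := Finset.univ) fun α _ =>
    (h1 α).smul_const (EuclideanSpace.proj (𝕜 := ℝ) (ι := Fin (n + 1)) α)
  refine h2.congr_deriv ?_
  ext1 w
  rw [ContinuousLinearMap.comp_apply, coordForm_apply, sum_apply]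
  simp only [connMatrix_apply, smul_apply, smul_eq_mul, Finset.sum_mul, Finset.mul_sum]
  rw [Finset.sum_comm]
  exact Finset.sum_congr rfl fun γ _ => Finset.sum_congr rfl fun α _ =>
    Finset.sum_congr rfl fun β _ => by
      rw [show EuclideanSpace.proj (𝕜 := ℝ) α w = w α from rfl]; ring

/-- The projection to the line spanned by the velocity of a geodesic is parallel. -/
theorem hasDerivAt_lineProj (h : S.IsUnitTimelikeGeodesic η U) (ht : t ∈ U)
    (hx : η t ∈ (chartAt (Model n) x₀).source) :
    HasDerivAt (lineProj S.L x₀ η) (lineProj S.L x₀ η t * connMatrix S.L x₀ η t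
      - connMatrix S.L x₀ η t * lineProj S.L x₀ η t) t := by
  have h1 := h.hasDerivAt_coordForm ht hx
  have h2 : HasDerivAt (fun s => (coordVelocity (n := n) x₀ η s).2)
      (deriv (deriv (coordCurve x₀ η)) t) t := (h.hasDerivAt_coordVelocity ht hx).snd
  rw [h.deriv_deriv_coordCurve ht hx] at h2
  refine (hasDerivAt_smulRight h1 h2).neg.congr_deriv ?_
  ext1 w
  simp [lineProj]
  abel

end IsUnitTimelikeGeodesic

/-! ### The unweighted Raychaudhuri equation -/

section Jacobi

variable {η : ℝ → M} {U : Set ℝ} {t : ℝ}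
  {J : (t : ℝ) → TangentSpace (𝓡 (n + 1)) (η t) →L[ℝ] TangentSpace (𝓡 (n + 1)) (η t)}

theorem coordEnd_self (J : (t : ℝ) → TangentSpace (𝓡 (n + 1)) (η t) →L[ℝ]
    TangentSpace (𝓡 (n + 1)) (η t)) (t : ℝ) : coordEnd (η t) η J t = endAt J t := by
  rw [coordEnd_eq (mem_chart_source _ _), toChart_self, ofChart_self, one_mul, mul_one]

theorem coordEnd_change (J : (t : ℝ) → TangentSpace (𝓡 (n + 1)) (η t) →L[ℝ]
    TangentSpace (𝓡 (n + 1)) (η t)) {x y : M} (hx : η t ∈ (chartAt (Model n) x).source)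
    (hy : η t ∈ (chartAt (Model n) y).source) :
    coordEnd x η J t = tangentCoordChange (𝓡 (n + 1)) y x (η t) * coordEnd y η J t
      * tangentCoordChange (𝓡 (n + 1)) x y (η t) := by
  rw [coordEnd_eq hx, coordEnd_eq hy, ← tangentCoordChange_mul_toChart hx hy,
    ← ofChart_mul_tangentCoordChange hx hy]
  simp only [mul_assoc]

/-- The unweighted expansion `trace (J' J⁻¹)`. -/
noncomputable def expansion (S : FinslerSpacetime n M) (η : ℝ → M)
    (J : (t : ℝ) → TangentSpace (𝓡 (n + 1)) (η t) →L[ℝ] TangentSpace (𝓡 (n + 1)) (η t)) (t : ℝ) :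
    ℝ :=
  tr (covDeriv S.L η 1 J t * normalInv S.L (velocity η t) (J t))

theorem IsJacobiTensorField.mul_line (hJ : S.IsJacobiTensorField η U J)
    (h : S.IsUnitTimelikeGeodesic η U) (ht : t ∈ U) :
    endAt J t * (1 - normalProj S.L (velocity η t)) = 0 :=
  mul_one_sub_normalProj S.isLorentzFinsler (h.velocity_ne_zero ht) (h.L_velocity ht)
    (hJ.map_velocity t ht)

theorem IsJacobiTensorField.line_mul (hJ : S.IsJacobiTensorField η U J)
    (h : S.IsUnitTimelikeGeodesic η U) (ht : t ∈ U) :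
    (1 - normalProj S.L (velocity η t)) * endAt J t = 0 := by
  have h0 := S.isLorentzFinsler
  have h1 := h.velocity_ne_zero ht
  have h2 := h.L_velocity ht
  ext1 w
  have h3 : endAt J t w = endAt J t (normalProj S.L (velocity η t) w) := by
    have := DFunLike.congr_fun (hJ.mul_line h ht) w
    rw [mul_sub, mul_one] at this
    exact sub_eq_zero.1 this
  have h4 := hJ.map_normal t ht _ (normalProj_mem h0 h1 h2 w)
  have h5 := (mem_normalSpace_iff h0 h1 h2 _).1 h4
  show (1 - normalProj S.L (velocity η t)) (endAt J t w) = 0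
  rw [h3]
  exact h5

theorem line_mul_line (h : S.IsUnitTimelikeGeodesic η U) (ht : t ∈ U) :
    (1 - normalProj S.L (velocity η t)) * (1 - normalProj S.L (velocity η t))
      = 1 - normalProj S.L (velocity η t) :=
  one_sub_normalProj_mul_self S.isLorentzFinsler (h.velocity_ne_zero ht) (h.L_velocity ht)

/-- Where `J` is nonsingular on the normal space, its extension by the identity on the line of the
velocity is invertible. -/
theorem IsJacobiTensorField.isUnit (hJ : S.IsJacobiTensorField η U J)
    (h : S.IsUnitTimelikeGeodesic η U) (ht : t ∈ U)
    (hns : ∀ w ∈ normalSpace S.L (velocity η t), J t w = 0 → w = 0) :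
    IsUnit (endAt J t + (1 - normalProj S.L (velocity η t))) := by
  rw [ContinuousLinearMap.isUnit_iff_bijective]
  have hinj : Function.Injective
      (endAt J t + (1 - normalProj S.L (velocity η t)) : Model n →L[ℝ] Model n) := by
    rw [injective_iff_map_eq_zero]
    intro w hw
    have h1 : (1 - normalProj S.L (velocity η t)) w = 0 := by
      have h2 : (1 - normalProj S.L (velocity η t)) *
          (endAt J t + (1 - normalProj S.L (velocity η t)))
          = 1 - normalProj S.L (velocity η t) := by
        rw [mul_add, hJ.line_mul h ht, line_mul_line h ht, zero_add]
      rw [← h2]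
      exact (congrArg (fun b => (1 - normalProj S.L (velocity η t) : Model n →L[ℝ] Model n) b) hw).trans
        (map_zero _)
    refine hns w ((mem_normalSpace_iff S.isLorentzFinsler (h.velocity_ne_zero ht)
      (h.L_velocity ht) w).2 h1) ?_
    have h3 : endAt J t w + (1 - normalProj S.L (velocity η t)) w = 0 := hw
    rw [h1, add_zero] at h3
    exact h3
  exact ⟨hinj, (LinearMap.injective_iff_surjective
    (f := (endAt J t + (1 - normalProj S.L (velocity η t))).toLinearMap)).1 hinj⟩

/-- Where `J` is nonsingular, `normalInv` is its inverse on the normal space, extended by `0`. -/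
theorem IsJacobiTensorField.normalInv_mul (hJ : S.IsJacobiTensorField η U J)
    (h : S.IsUnitTimelikeGeodesic η U) (ht : t ∈ U)
    (hu : IsUnit (endAt J t + (1 - normalProj S.L (velocity η t)))) :
    endAt J t * normalInv S.L (velocity η t) (J t) = normalProj S.L (velocity η t) ∧
    normalInv S.L (velocity η t) (J t) * endAt J t = normalProj S.L (velocity η t) ∧
    (1 - normalProj S.L (velocity η t)) * normalInv S.L (velocity η t) (J t) = 0 ∧
    normalInv S.L (velocity η t) (J t) * (1 - normalProj S.L (velocity η t)) = 0 := by
  have := mul_inverse_sub_of_orthogonal (hJ.mul_line h ht) (hJ.line_mul h ht) (line_mul_line h ht)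
    (Ring.mul_inverse_cancel _ hu) (Ring.inverse_mul_cancel _ hu)
  rw [sub_sub_cancel] at this
  exact this

theorem ringInverse_conj {A T T' : Model n →L[ℝ] Model n} (h : T * T' = 1) (h' : T' * T = 1)
    (hA : IsUnit A) : Ring.inverse (T * A * T') = T * Ring.inverse A * T' := by
  have h1 : A * Ring.inverse A = 1 := Ring.mul_inverse_cancel _ hA
  have h2 : Ring.inverse A * A = 1 := Ring.inverse_mul_cancel _ hA
  apply ringInverse_eq
  · calc T * A * T' * (T * Ring.inverse A * T') = T * A * (T' * T) * Ring.inverse A * T' := by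
          simp only [mul_assoc]
      _ = T * (A * Ring.inverse A) * T' := by rw [h', mul_one, mul_assoc T A]
      _ = 1 := by rw [h1, mul_one, h]
  · calc T * Ring.inverse A * T' * (T * A * T') = T * Ring.inverse A * (T' * T) * A * T' := by
          simp only [mul_assoc]
      _ = T * (Ring.inverse A * A) * T' := by rw [h', mul_one, mul_assoc T (Ring.inverse A)]
      _ = 1 := by rw [h2, mul_one, h]

theorem coordEnd_add_lineProj (h : S.IsUnitTimelikeGeodesic η U) (ht : t ∈ U) {x₀ : M}
    (hx : η t ∈ (chartAt (Model n) x₀).source) :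
    coordEnd x₀ η J t + lineProj S.L x₀ η t = toChart x₀ (η t)
      * (endAt J t + (1 - normalProj S.L (velocity η t))) * ofChart x₀ (η t) := by
  rw [← h.toChart_one_sub_normalProj ht hx, coordEnd_eq hx, ← add_mul, ← mul_add]

theorem lineProj_self (h : S.IsUnitTimelikeGeodesic η U) (ht : t ∈ U) :
    lineProj S.L (η t) η t = 1 - normalProj S.L (velocity η t) := by
  rw [← h.toChart_one_sub_normalProj ht (mem_chart_source _ _), toChart_self, ofChart_self,
    one_mul, mul_one]

/-- The covariant derivative `J'` at each parameter value is computed in the chart around the point of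
the curve; the expansion may nevertheless be computed in a fixed chart, and with the ordinary
derivative in place of the covariant one, since both changes alter `J'` by a commutator with `J`. -/
theorem IsJacobiTensorField.expansion_eq (hJ : S.IsJacobiTensorField η U J)
    (h : S.IsUnitTimelikeGeodesic η U) (ht : t ∈ U) {x₀ : M}
    (hx : η t ∈ (chartAt (Model n) x₀).source)
    (hu : IsUnit (endAt J t + (1 - normalProj S.L (velocity η t)))) :
    expansion S η J t = tr (deriv (coordEnd x₀ η J) t
      * (Ring.inverse (coordEnd x₀ η J t + lineProj S.L x₀ η t) - lineProj S.L x₀ η t)) := by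
  set K := normalInv S.L (velocity η t) (J t) with hK
  obtain ⟨k1, k2, -, -⟩ := hJ.normalInv_mul h ht hu
  have hy := mem_chart_source (Model n) (η t)
  have e1 : expansion S η J t = tr (deriv (coordEnd (η t) η J) t * K) := by
    have : covDeriv S.L η 1 J t = deriv (coordEnd (η t) η J) t
        + (connMatrix S.L (η t) η t * endAt J t - endAt J t * connMatrix S.L (η t) η t) := by
      rw [← coordEnd_self, ← add_sub_assoc]; rfl
    rw [expansion, this, add_mul, tr_add, tr_commutator_mul (k1.trans k2.symm), add_zero]
  have hev := h.eventually_mem ht hy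
  have hev' := h.eventually_mem ht hx
  have e2 : coordEnd x₀ η J =ᶠ[𝓝 t] fun r => tangentCoordChange (𝓡 (n + 1)) (η t) x₀ (η r)
      * coordEnd (η t) η J r * tangentCoordChange (𝓡 (n + 1)) x₀ (η t) (η r) := by
    filter_upwards [hev, hev'] with r h1 h2 using coordEnd_change J h2.2 h1.2
  have e3 : Ring.inverse (coordEnd x₀ η J t + lineProj S.L x₀ η t) - lineProj S.L x₀ η t
      = toChart x₀ (η t) * K * ofChart x₀ (η t) := by
    rw [coordEnd_add_lineProj h ht hx, ← h.toChart_one_sub_normalProj ht hx,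
      ringInverse_conj (toChart_mul_ofChart hx) (ofChart_mul_toChart hx) hu, ← sub_mul, ← mul_sub]
    rfl
  rw [e1, e3, e2.deriv_eq]
  refine (tr_deriv_conj ((hJ.smooth t ht).differentiableAt (by simp))
    (differentiableAt_tangentCoordChange (h.contMDiffAt ht) hy hx)
    (differentiableAt_tangentCoordChange (h.contMDiffAt ht) hx hy) ?_ ?_).symm
  · filter_upwards [hev, hev'] with r h1 h2 using tangentCoordChange_mul_self h1.2 h2.2
  · rw [coordEnd_self]; exact k1.trans k2.symm

/-- Nonsingularity of `J` on the normal spaces is an open condition. -/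
theorem IsJacobiTensorField.eventually_isUnit (hJ : S.IsJacobiTensorField η U J)
    (h : S.IsUnitTimelikeGeodesic η U) (ht : t ∈ U)
    (hu : IsUnit (endAt J t + (1 - normalProj S.L (velocity η t)))) :
    ∀ᶠ s in 𝓝 t, IsUnit (endAt J s + (1 - normalProj S.L (velocity η s))) := by
  have hx := mem_chart_source (Model n) (η t)
  have hut : IsUnit (coordEnd (η t) η J t + lineProj S.L (η t) η t) := by
    rwa [coordEnd_self, lineProj_self h ht]
  have h1 : ∀ᶠ s in 𝓝 t, IsUnit (coordEnd (η t) η J s + lineProj S.L (η t) η s) :=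
    ((hJ.smooth t ht).continuousAt.add (h.hasDerivAt_lineProj ht hx).continuousAt).eventually
      (Units.isOpen.mem_nhds hut)
  filter_upwards [h.eventually_mem ht hx, h1] with s hs hs1
  have h3 := ofChart_mul_toChart (n := n) hs.2
  have h2 : endAt J s + (1 - normalProj S.L (velocity η s))
      = ofChart (η t) (η s) * (coordEnd (η t) η J s + lineProj S.L (η t) η s)
        * toChart (η t) (η s) := by
    rw [coordEnd_add_lineProj h hs.1 hs.2]
    calc _ = (ofChart (η t) (η s) * toChart (η t) (η s))
          * (endAt J s + (1 - normalProj S.L (velocity η s)))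
          * (ofChart (η t) (η s) * toChart (η t) (η s)) := by rw [h3, one_mul, mul_one]
      _ = _ := by simp only [mul_assoc]
  rw [h2]
  have h4 : IsUnit (ofChart (n := n) (η t) (η s)) :=
    ⟨⟨_, _, ofChart_mul_toChart hs.2, toChart_mul_ofChart hs.2⟩, rfl⟩
  have h5 : IsUnit (toChart (n := n) (η t) (η s)) :=
    ⟨⟨_, _, toChart_mul_ofChart hs.2, ofChart_mul_toChart hs.2⟩, rfl⟩
  exact (h4.mul hs1).mul h5

/-- The unweighted timelike Raychaudhuri equation: the trace of the Riccati equation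
`B' + B² + R = 0` for `B = J' J⁻¹`. -/
theorem IsJacobiTensorField.hasDerivAt_expansion (hJ : S.IsJacobiTensorField η U J)
    (h : S.IsUnitTimelikeGeodesic η U) (ht : t ∈ U)
    (hns : ∀ w ∈ normalSpace S.L (velocity η t), J t w = 0 → w = 0) :
    HasDerivAt (expansion S η J) (-ricci S.L (velocity η t)
      - tr (covDeriv S.L η 1 J t * normalInv S.L (velocity η t) (J t)
        * (covDeriv S.L η 1 J t * normalInv S.L (velocity η t) (J t)))) t := by
  have hx := mem_chart_source (Model n) (η t)
  have hev := h.eventually_mem ht hx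
  have hu := hJ.isUnit h ht hns
  have hconj : ∀ s, s ∈ U → η s ∈ (chartAt (Model n) (η t)).source →
      coordEnd (η t) η J s * lineProj S.L (η t) η s = 0 ∧
      lineProj S.L (η t) η s * coordEnd (η t) η J s = 0 ∧
      lineProj S.L (η t) η s * lineProj S.L (η t) η s = lineProj S.L (η t) η s := by
    intro s hs hxs
    have hm : ∀ A B : Model n →L[ℝ] Model n,
        toChart (η t) (η s) * A * ofChart (η t) (η s) * (toChart (η t) (η s) * B
          * ofChart (η t) (η s)) = toChart (η t) (η s) * (A * B) * ofChart (η t) (η s) := by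
      intro A B
      calc _ = toChart (η t) (η s) * A * (ofChart (η t) (η s) * toChart (η t) (η s)) * B
            * ofChart (η t) (η s) := by simp only [mul_assoc]
        _ = _ := by rw [ofChart_mul_toChart hxs, mul_one, mul_assoc _ A B]
    rw [← h.toChart_one_sub_normalProj hs hxs, coordEnd_eq hxs, hm, hm, hm, line_mul_line h hs]
    have h1 := hJ.mul_line h hs
    have h2 := hJ.line_mul h hs
    exact ⟨by rw [h1]; simp, by rw [h2]; simp, rfl⟩
  have hQt := lineProj_self h ht
  have hut : IsUnit (coordEnd (η t) η J t + lineProj S.L (η t) η t) := by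
    rwa [coordEnd_self, hQt]
  have hQ := h.hasDerivAt_lineProj ht hx
  have hA := hJ.smooth t ht
  have hmain := hasDerivAt_tr_deriv_mul_inverse (A := coordEnd (η t) η J)
    (Q := lineProj S.L (η t) η) (Γ := connMatrix S.L (η t) η) (t := t)
    (hA.of_le (by norm_cast)) hQ.differentiableAt (h.differentiableAt_connMatrix ht hx)
    (hev.mono fun s hs => (hconj s hs.1 hs.2).1) (hev.mono fun s hs => (hconj s hs.1 hs.2).2.1)
    (hev.mono fun s hs => (hconj s hs.1 hs.2).2.2) hut
    (by rw [hQ.deriv]; abel) (D := coordCovDeriv S.L (η t) η) (fun X s => rfl)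
    (K := fun s => Ring.inverse (coordEnd (η t) η J s + lineProj S.L (η t) η s)
      - lineProj S.L (η t) η s) (fun s => rfl)
  have hev2 : expansion S η J =ᶠ[𝓝 t] fun s => tr (deriv (coordEnd (η t) η J) s
      * (Ring.inverse (coordEnd (η t) η J s + lineProj S.L (η t) η s)
        - lineProj S.L (η t) η s)) := by
    filter_upwards [hev, hJ.eventually_isUnit h ht hu] with s hs hs1
    exact hJ.expansion_eq h hs.1 hs.2 hs1
  refine (hmain.congr_of_eventuallyEq hev2).congr_deriv ?_
  have hKt : Ring.inverse (coordEnd (η t) η J t + lineProj S.L (η t) η t)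
      - lineProj S.L (η t) η t = normalInv S.L (velocity η t) (J t) := by
    rw [coordEnd_self, hQt]; rfl
  simp only [hKt]
  obtain ⟨k1, -, k3, -⟩ := hJ.normalInv_mul h ht hu
  set K := normalInv S.L (velocity η t) (J t) with hK
  have hR : covDeriv S.L η 2 J t * K
      = -(curvature S.L (velocity η t) * normalProj S.L (velocity η t)) := by
    rw [← k1]
    ext1 w
    have h1 : K w ∈ normalSpace S.L (velocity η t) :=
      (mem_normalSpace_iff S.isLorentzFinsler (h.velocity_ne_zero ht) (h.L_velocity ht) _).2
        (DFunLike.congr_fun k3 w)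
    exact eq_neg_of_add_eq_zero_left (hJ.equation t ht _ h1)
  have hRQ : curvature S.L (velocity η t) * normalProj S.L (velocity η t)
      = curvature S.L (velocity η t) := by
    have := curvature_mul_one_sub_normalProj S.isLorentzFinsler (h.velocity_ne_zero ht)
      (h.L_velocity ht)
    rw [mul_sub, mul_one, sub_eq_zero] at this
    exact this.symm
  have hfin : tr (covDeriv S.L η 2 J t * K) = -ricci S.L (velocity η t) := by
    rw [hR, hRQ, tr_neg]; rfl
  rw [← hfin]
  rfl

end Jacobi

end FinslerSpacetime

end LorentzFinsler

namespace LorentzFinsler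

variable {n : ℕ} {M : Type*} [TopologicalSpace M] [ChartedSpace (Model n) M]
  [IsManifold (𝓡 (n + 1)) ∞ M]

/-! ### Change of parameter -/

section Parameter

variable {U : Set ℝ} {τ e : ℝ → ℝ}

theorem invParam_apply (hU : IsOpen U) (hUc : U.OrdConnected)
    (hτ : ∀ t ∈ U, HasDerivAt τ (e t) t) (he : ∀ t ∈ U, 0 < e t) {t : ℝ} (ht : t ∈ U) :
    invParam U τ (τ t) = t := by
  have hmono : StrictMonoOn τ U := by
    refine strictMonoOn_of_deriv_pos hUc.convex
      (fun s hs => (hτ s hs).continuousAt.continuousWithinAt) fun s hs => ?_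
    rw [hU.interior_eq] at hs
    rw [(hτ s hs).deriv]
    exact he s hs
  exact hmono.injOn.leftInvOn_invFunOn ht

theorem hasDerivAt_invParam (hU : IsOpen U) (hUc : U.OrdConnected)
    (hτ : ∀ t ∈ U, HasDerivAt τ (e t) t) (he : ∀ t ∈ U, 0 < e t) {t : ℝ} (ht : t ∈ U)
    (hcont : ContinuousAt e t) : HasDerivAt (invParam U τ) (e t)⁻¹ (τ t) := by
  have hs : HasStrictDerivAt τ (e t) t := hasStrictDerivAt_of_hasDerivAt_of_continuousAt
    (by filter_upwards [hU.mem_nhds ht] with s hs using hτ s hs) hcont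
  -- On `τ(U)` the chosen inverse agrees with the one of the inverse function theorem.
  have h1 := hs.to_localInverse (he t ht).ne'
  refine h1.hasDerivAt.congr_of_eventuallyEq ?_
  have h2 : ∀ᶠ r in 𝓝 (τ t), HasStrictDerivAt.localInverse τ (e t) t hs (he t ht).ne' r ∈ U := by
    refine h1.hasDerivAt.continuousAt.eventually (hU.mem_nhds ?_)
    rw [HasStrictDerivAt.localInverse, HasStrictFDerivAt.localInverse_apply_image]
    exact ht
  have h3 := (hs.hasStrictFDerivAt_equiv (he t ht).ne').eventually_right_inverse
  filter_upwards [h2, h3] with r h4 h5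
  have h6 := invParam_apply hU hUc hτ he h4
  rwa [show τ (HasStrictDerivAt.localInverse τ (e t) t hs (he t ht).ne' r) = r from h5] at h6

end Parameter

/-! ### The weighted expansion -/

theorem smul_mul_end (a : ℝ) (A B : Model n →L[ℝ] Model n) : (a • A) * B = a • (A * B) :=
  ContinuousLinearMap.smul_comp _ _ _

theorem mul_smul_end (a : ℝ) (A B : Model n →L[ℝ] Model n) : A * (a • B) = a • (A * B) :=
  ContinuousLinearMap.comp_smul _ _ _

/-! The scalar tower instances of the algebra of endomorphisms of `ℝ^{n+1}` are not found by instance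
search; the following three rules replace the lemmas that need them. -/

theorem smul_zero_end (a : ℝ) : a • (0 : Model n →L[ℝ] Model n) = 0 := by
  ext; simp

/-- Scaling `A` by `a` scales its inverse `K` on the complement of `Q` by `a⁻¹`. -/
theorem inverse_smul_add_sub {A Q K : Model n →L[ℝ] Model n} {a : ℝ} (ha : a ≠ 0)
    (hAQ : A * Q = 0) (hQA : Q * A = 0) (hQQ : Q * Q = Q) (hAK : A * K = 1 - Q)
    (hKA : K * A = 1 - Q) (hQK : Q * K = 0) (hKQ : K * Q = 0) :
    Ring.inverse (a • A + Q) - Q = a⁻¹ • K := by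
  rw [ringInverse_eq (Y := a⁻¹ • K + Q), add_sub_cancel_right]
  · rw [add_mul, mul_add, mul_add, smul_mul_end, smul_mul_end, mul_smul_end, mul_smul_end, hAK,
      hAQ, hQK, hQQ, smul_smul, mul_inv_cancel₀ ha, one_smul, smul_zero_end, smul_zero_end, add_zero,
      zero_add, sub_add_cancel]
  · rw [add_mul, mul_add, mul_add, smul_mul_end, smul_mul_end, mul_smul_end, mul_smul_end, hKA,
      hKQ, hQA, hQQ, smul_smul, inv_mul_cancel₀ ha, one_smul, smul_zero_end, smul_zero_end, add_zero,
      zero_add, sub_add_cancel]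

namespace FinslerSpacetime

variable {S : FinslerSpacetime n M} {ψ : TangentBundle (𝓡 (n + 1)) M → ℝ} {η : ℝ → M}
  {U : Set ℝ} {t : ℝ}

theorem IsWeight.contDiffAt_psiAlong (hψ : S.IsWeight ψ) (hη : S.IsGeodesicOn η U)
    (hU : IsOpen U) (ht : t ∈ U) : ContDiffAt ℝ ∞ (psiAlong (n := n) ψ η) t := by
  have h1 : ContMDiffOn 𝓘(ℝ, ℝ) (𝓡 (n + 1)).tangent ∞ (velocity (n := n) η) U := fun s hs =>
    (contMDiffAt_velocity (by
      filter_upwards [hU.mem_nhds hs] with r hr using hη.contMDiffAt hU hr)).contMDiffWithinAt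
  have h2 := hψ.smooth.comp h1 fun s hs => hη.causal s hs
  exact (contMDiffOn_iff_contDiffOn.1 h2).contDiffAt (hU.mem_nhds ht)

variable {J : (t : ℝ) → TangentSpace (𝓡 (n + 1)) (η t) →L[ℝ] TangentSpace (𝓡 (n + 1)) (η t)}

/-- The connection matrix is multiplied by the speed `f` of a change of parameter, since the
Christoffel symbols are `0`-homogeneous. -/
theorem IsUnitTimelikeGeodesic.connMatrix_comp (h : S.IsUnitTimelikeGeodesic η U) {φ : ℝ → ℝ}
    {f r : ℝ} (hφ : HasDerivAt φ f r) (hf : 0 < f) (ht : φ r ∈ U) {x₀ : M}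
    (hx : η (φ r) ∈ (chartAt (Model n) x₀).source) :
    connMatrix S.L x₀ (fun s => η (φ s)) r = f • connMatrix S.L x₀ η (φ r) := by
  have hW := isCoordNondegenerate_chartDomain S.isLorentzFinsler x₀
  have h1 : coordVelocity (n := n) x₀ (fun s => η (φ s)) r
      = ((coordVelocity (n := n) x₀ η (φ r)).1, f • (coordVelocity (n := n) x₀ η (φ r)).2) := by
    have h2 := ((contDiffAt_coordCurve (h.contMDiffAt ht) hx).differentiableAt
      (by simp)).hasDerivAt.scomp r hφ
    have h3 : deriv (coordCurve (n := n) x₀ (fun s => η (φ s))) r = _ := h2.deriv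
    simp only [coordVelocity, h3]
    rfl
  ext w α
  rw [smul_apply, PiLp.smul_apply, connMatrix_apply, connMatrix_apply, h1, smul_eq_mul,
    Finset.mul_sum]
  refine Finset.sum_congr rfl fun γ _ => ?_
  rw [← mul_assoc, Finset.mul_sum]
  congr 1
  refine Finset.sum_congr rfl fun β _ => ?_
  rw [(hW.chernChristoffel α β γ).hom _ (h.coordVelocity_mem ht hx) f hf]
  simp
  ring

/-- The derivative in `τ` is `f = dt/dτ` times the derivative in `t`. -/
theorem IsUnitTimelikeGeodesic.covDerivStar_eq (h : S.IsUnitTimelikeGeodesic η U) {τ : ℝ → ℝ}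
    {f : ℝ} (hinv : invParam U τ (τ t) = t) (hd : HasDerivAt (invParam U τ) f (τ t)) (hf : 0 < f)
    (ht : t ∈ U) (hJ : DifferentiableAt ℝ (coordEnd (η t) η J) t) :
    covDerivStar S.L U τ η J t = f • covDeriv S.L η 1 J t := by
  show coordCovDeriv S.L (η (invParam U τ (τ t))) (fun s => η (invParam U τ s))
    (fun r => coordEnd (η (invParam U τ (τ t))) η J (invParam U τ r)) (τ t)
    = f • coordCovDeriv S.L (η t) η (coordEnd (η t) η J) t
  have h1 := h.connMatrix_comp (x₀ := η t) hd hf (by rwa [hinv])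
    (by rw [hinv]; exact mem_chart_source _ _)
  rw [hinv] at h1
  have h2 : HasDerivAt (fun r => coordEnd (η t) η J (invParam U τ r))
      (f • deriv (coordEnd (η t) η J) t) (τ t) :=
    HasDerivAt.scomp_of_eq (τ t) hJ.hasDerivAt hd hinv.symm
  rw [hinv]
  unfold coordCovDeriv
  rw [h2.deriv, h1]
  simp only [hinv]
  rw [smul_sub, smul_add, ContinuousLinearMap.smul_comp,
    ContinuousLinearMap.comp_smul]

theorem coordEnd_weightedJ (ψ : TangentBundle (𝓡 (n + 1)) M → ℝ) (x₀ : M) (η : ℝ → M)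
    (J : (t : ℝ) → TangentSpace (𝓡 (n + 1)) (η t) →L[ℝ] TangentSpace (𝓡 (n + 1)) (η t)) :
    coordEnd x₀ η (weightedJ ψ η J)
      = fun t => Real.exp (-psiAlong (n := n) ψ η t / n) • coordEnd x₀ η J t := by
  funext t
  unfold coordEnd ContinuousLinearMap.inCoordinates weightedJ
  rw [ContinuousLinearMap.smul_comp, ContinuousLinearMap.comp_smul]

omit [IsManifold (𝓡 (n + 1)) ∞ M] in
theorem hasDerivAt_exp_psiAlong (hψ : DifferentiableAt ℝ (psiAlong (n := n) ψ η) t) :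
    HasDerivAt (fun t => Real.exp (-psiAlong (n := n) ψ η t / n))
      (Real.exp (-psiAlong (n := n) ψ η t / n) * (-deriv (psiAlong (n := n) ψ η) t / n)) t :=
  (hψ.hasDerivAt.neg.div_const _).exp

theorem covDeriv_weightedJ (hψ : DifferentiableAt ℝ (psiAlong (n := n) ψ η) t)
    (hJ : DifferentiableAt ℝ (coordEnd (η t) η J) t) :
    covDeriv S.L η 1 (weightedJ ψ η J) t
      = Real.exp (-psiAlong (n := n) ψ η t / n) • (covDeriv S.L η 1 J t
        - (deriv (psiAlong (n := n) ψ η) t / n) • endAt J t) := by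
  show coordCovDeriv S.L (η t) η (coordEnd (η t) η (weightedJ ψ η J)) t
    = _ • (coordCovDeriv S.L (η t) η (coordEnd (η t) η J) t - _)
  rw [coordEnd_weightedJ]
  unfold coordCovDeriv
  have h0 : HasDerivAt (fun t' => Real.exp (-psiAlong (n := n) ψ η t' / n)
      • coordEnd (η t) η J t') _ t := (hasDerivAt_exp_psiAlong hψ).smul hJ.hasDerivAt
  rw [h0.deriv, ContinuousLinearMap.comp_smul,
    ContinuousLinearMap.smul_comp, ← coordEnd_self J t]
  module

/-- The endomorphism `B_ε` in terms of the unweighted one `J' J⁻¹`. -/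
theorem IsJacobiTensorField.Beps_eq (hJ : S.IsJacobiTensorField η U J)
    (h : S.IsUnitTimelikeGeodesic η U) (ht : t ∈ U)
    (hu : IsUnit (endAt J t + (1 - normalProj S.L (velocity η t))))
    (hψ : DifferentiableAt ℝ (psiAlong (n := n) ψ η) t) {τ : ℝ → ℝ} {f : ℝ}
    (hinv : invParam U τ (τ t) = t) (hd : HasDerivAt (invParam U τ) f (τ t)) (hf : 0 < f) :
    Beps S.L ψ U τ η J t = f • (covDeriv S.L η 1 J t * normalInv S.L (velocity η t) (J t)
      - (deriv (psiAlong (n := n) ψ η) t / n) • normalProj S.L (velocity η t)) := by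
  obtain ⟨k1, k2, k3, k4⟩ := hJ.normalInv_mul h ht hu
  have hJd : DifferentiableAt ℝ (coordEnd (η t) η J) t :=
    (hJ.smooth t ht).differentiableAt (by simp)
  have hJd' : DifferentiableAt ℝ (coordEnd (η t) η (weightedJ ψ η J)) t := by
    rw [coordEnd_weightedJ]
    exact ((hasDerivAt_exp_psiAlong hψ).smul hJd.hasDerivAt).differentiableAt
  set a := Real.exp (-psiAlong (n := n) ψ η t / n) with ha
  have ha0 : a ≠ 0 := (Real.exp_pos _).ne'
  have h1 : normalInv S.L (velocity η t) (weightedJ ψ η J t)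
      = a⁻¹ • normalInv S.L (velocity η t) (J t) := by
    refine inverse_smul_add_sub ha0 (hJ.mul_line h ht) (hJ.line_mul h ht) (line_mul_line h ht)
      ?_ ?_ k3 k4
    · exact k1.trans (sub_sub_cancel _ _).symm
    · exact k2.trans (sub_sub_cancel _ _).symm
  show covDerivStar S.L U τ η (weightedJ ψ η J) t
    * normalInv S.L (velocity η t) (weightedJ ψ η J t) = _
  rw [h1, h.covDerivStar_eq hinv hd hf ht hJd', covDeriv_weightedJ hψ hJd, ← ha,
    smul_mul_end, smul_mul_end, mul_smul_end, smul_smul a, mul_inv_cancel₀ ha0, one_smul,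
    sub_mul, smul_mul_end, k1]

/-- The weighted expansion in terms of the unweighted one: the factor `exp(-ψ_η/n)` contributes
`-ψ_η'`, and the change of parameter the factor `f = dt/dτ`. -/
theorem IsJacobiTensorField.thetaEps_eq (hn : 1 ≤ n) (hJ : S.IsJacobiTensorField η U J)
    (h : S.IsUnitTimelikeGeodesic η U) (ht : t ∈ U)
    (hu : IsUnit (endAt J t + (1 - normalProj S.L (velocity η t))))
    (hψ : DifferentiableAt ℝ (psiAlong (n := n) ψ η) t) {τ : ℝ → ℝ} {f : ℝ}
    (hinv : invParam U τ (τ t) = t) (hd : HasDerivAt (invParam U τ) f (τ t)) (hf : 0 < f) :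
    thetaEps S.L ψ U τ η J t = f * (expansion S η J t - deriv (psiAlong (n := n) ψ η) t) := by
  have hn' : (n : ℝ) ≠ 0 := by positivity
  have h1 : tr (normalProj S.L (velocity η t)) = n :=
    tr_normalProj S.isLorentzFinsler (h.velocity_ne_zero ht) (h.L_velocity ht)
  rw [thetaEps, hJ.Beps_eq h ht hu hψ hinv hd hf, tr_smul, tr_sub, tr_smul, h1,
    div_mul_cancel₀ _ hn']
  rfl

end FinslerSpacetime

end LorentzFinsler

namespace LorentzFinsler

variable {n : ℕ} {M : Type*} [TopologicalSpace M] [ChartedSpace (Model n) M]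
  [IsManifold (𝓡 (n + 1)) ∞ M]

/-! ### Uniqueness and affine reparametrization of geodesics -/

/-- The geodesic vector field on `ℝ^{n+1} × ℝ^{n+1}` in the chart around `x₀`. -/
noncomputable def sprayField (L : TangentBundle (𝓡 (n + 1)) M → ℝ) (x₀ : M)
    (q : Model n × Model n) : Model n × Model n :=
  (q.2, WithLp.toLp 2 fun α => -2 * spray L x₀ α q)

theorem contDiffAt_sprayField {L : TangentBundle (𝓡 (n + 1)) M → ℝ} (hL : IsLorentzFinsler L)
    {x₀ : M} {q : Model n × Model n} (hq : q ∈ chartDomain n x₀) :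
    ContDiffAt ℝ 1 (sprayField L x₀) q := by
  have hW := isCoordNondegenerate_chartDomain hL x₀
  refine contDiffAt_snd.prodMk ?_
  rw [contDiffAt_piLp]
  intro α
  exact contDiffAt_const.mul (((hW.spray α).contDiffAt hW.conic hq).of_le (by norm_cast))

namespace FinslerSpacetime

variable {S : FinslerSpacetime n M} {ψ : TangentBundle (𝓡 (n + 1)) M → ℝ} {γ γ' η : ℝ → M}
  {U V V' : Set ℝ} {t : ℝ} {x₀ : M}

theorem IsGeodesicOn.hasDerivAt_coordVelocity_sprayField (h : S.IsGeodesicOn γ V) (hV : IsOpen V)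
    (ht : t ∈ V) (hx : γ t ∈ (chartAt (Model n) x₀).source) :
    HasDerivAt (coordVelocity (n := n) x₀ γ) (sprayField S.L x₀ (coordVelocity x₀ γ t)) t := by
  refine (h.hasDerivAt_coordVelocity hV ht hx).congr_deriv (Prod.ext rfl ?_)
  ext α
  have := h.equation x₀ t ht hx α
  simp only [sprayField]
  linarith

/-- A geodesic is determined, near a parameter value, by its velocity there: in a chart, the geodesic
equation is a first order equation with a smooth right hand side. -/
theorem IsGeodesicOn.eventuallyEq (h : S.IsGeodesicOn γ V) (h' : S.IsGeodesicOn γ' V')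
    (hV : IsOpen V) (hV' : IsOpen V') (ht : t ∈ V) (ht' : t ∈ V')
    (heq : velocity (n := n) γ t = velocity γ' t) : γ =ᶠ[𝓝 t] γ' := by
  have h0 : γ' t = γ t := (congrArg Bundle.TotalSpace.proj heq).symm
  have hx := mem_chart_source (Model n) (γ t)
  have hx' : γ' t ∈ (chartAt (Model n) (γ t)).source := by rw [h0]; exact hx
  have hq := h.coordVelocity_mem hV ht hx
  have e1 : coordVelocity (n := n) (γ t) γ t = coordVelocity (γ t) γ' t := by
    rw [← chart_velocity ((h.contMDiffAt hV ht).mdifferentiableAt (by simp)) hx,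
      ← chart_velocity ((h'.contMDiffAt hV' ht').mdifferentiableAt (by simp)) hx']
    have := congrArg (chartAt (ModelProd (Model n) (Model n))
      (⟨γ t, 0⟩ : TangentBundle (𝓡 (n + 1)) M)) heq
    rw [chartAt_tangentBundle, chartAt_tangentBundle] at this
    exact this
  obtain ⟨K, s, hs, hlip⟩ := (contDiffAt_sprayField S.isLorentzFinsler hq).exists_lipschitzOnWith
  have d1 := h.hasDerivAt_coordVelocity_sprayField hV ht hx
  have d2 := h'.hasDerivAt_coordVelocity_sprayField hV' ht' hx'
  have m1 := h.eventually_mem hV ht hx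
  have m2 := h'.eventually_mem hV' ht' hx'
  have key : coordVelocity (n := n) (γ t) γ =ᶠ[𝓝 t] coordVelocity (γ t) γ' := by
    refine ODE_solution_unique_of_eventually (v := fun _ => sprayField S.L (γ t))
      (s := fun _ => s) (K := K) (Eventually.of_forall fun _ => hlip) ?_ ?_ e1
    · filter_upwards [m1, d1.continuousAt.eventually hs] with r hr hr'
      exact ⟨h.hasDerivAt_coordVelocity_sprayField hV hr.1 hr.2, hr'⟩
    · have hs' : s ∈ 𝓝 (coordVelocity (n := n) (γ t) γ' t) := by rwa [← e1]
      filter_upwards [m2, d2.continuousAt.eventually hs'] with r hr hr'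
      exact ⟨h'.hasDerivAt_coordVelocity_sprayField hV' hr.1 hr.2, hr'⟩
  filter_upwards [key, m1, m2] with r hr h1 h2
  exact (chartAt (Model n) (γ t)).injOn h1.2 h2.2 (congrArg Prod.fst hr)

omit [IsManifold (𝓡 (n + 1)) ∞ M] in
theorem _root_.Filter.EventuallyEq.velocity_eq {γ γ' : ℝ → M} (h : γ =ᶠ[𝓝 t] γ') :
    velocity (n := n) γ t = velocity γ' t := by
  unfold velocity
  have h1 := h.mfderiv_eq (I := 𝓘(ℝ, ℝ)) (I' := 𝓡 (n + 1))
  have h2 := h.self_of_nhds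
  refine Bundle.TotalSpace.ext h2 ?_
  simp only
  rw [h1]
  rw [h2]

/-- The set of future-directed timelike vectors is a cone: the ray through a vector of the set is
connected. -/
theorem smul_mem_futureTimelike {x : M} {v : Model n}
    (hv : (⟨x, v⟩ : TangentBundle (𝓡 (n + 1)) M) ∈ S.futureTimelike) {c : ℝ} (hc : 0 < c) :
    (⟨x, c • v⟩ : TangentBundle (𝓡 (n + 1)) M) ∈ S.futureTimelike := by
  have hL : ∀ r : ℝ, 0 < r → S.L ⟨x, r • v⟩ < 0 := fun r hr => by
    exact (S.isLorentzFinsler.homogeneous x v r hr).trans_lt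
      (mul_neg_of_pos_of_neg (by positivity) hv.1)
  refine ⟨hL c hc, ?_⟩
  have hv0 : v ≠ 0 := S.snd_ne_zero_of_futureTimelike hv
  have h1 : IsPreconnected ((fun r : ℝ => r • v) '' Ioi 0) :=
    isPreconnected_Ioi.image _ (by fun_prop)
  have h2 := h1.subset_connectedComponentIn
    (F := closure {w : Model n | S.L ⟨x, w⟩ < 0} \ {0}) (x := v) ⟨1, by simp, by simp⟩ (by
      rintro _ ⟨r, hr, rfl⟩
      exact ⟨subset_closure (hL r hr), smul_ne_zero (ne_of_gt hr) hv0⟩)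
  -- The component of `X(x)` is also the component of `v`.
  have h3 := connectedComponentIn_eq hv.2
  show c • v ∈ connectedComponentIn (closure {w : Model n | S.L ⟨x, w⟩ < 0} \ {0}) (S.X x)
  erw [h3]
  exact h2 ⟨c, hc, rfl⟩

variable {f : ℝ}

theorem hasDerivAt_affine (t f s : ℝ) : HasDerivAt (fun s : ℝ => t + f * s) f s := by
  simpa using ((hasDerivAt_id s).const_mul f).const_add t

theorem IsUnitTimelikeGeodesic.velocity_affine (h : S.IsUnitTimelikeGeodesic η U) {s : ℝ}
    (hs : t + f * s ∈ U) : velocity (n := n) (fun s => η (t + f * s)) s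
      = ⟨η (t + f * s), f • (velocity (n := n) η (t + f * s)).2⟩ :=
  velocity_comp (h.mdifferentiableAt hs) (hasDerivAt_affine t f s)

/-- Affine reparametrizations of geodesics are geodesics. -/
theorem IsUnitTimelikeGeodesic.isGeodesicOn_affine (h : S.IsUnitTimelikeGeodesic η U) (hf : 0 < f)
    (hV : ∀ s ∈ V, t + f * s ∈ U) : S.IsGeodesicOn (fun s => η (t + f * s)) V where
  smooth := by
    have h1 : ContDiff ℝ ∞ fun s : ℝ => t + f * s := by fun_prop
    exact h.isGeodesicOn.smooth.comp h1.contMDiff.contMDiffOn hV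
  causal s hs := by
    rw [h.velocity_affine (hV s hs)]
    exact S.futureTimelike_subset_futureCausal (smul_mem_futureTimelike (h.timelike _ (hV s hs)) hf)
  equation x₀ s hs hx α := by
    have hW := isCoordNondegenerate_chartDomain S.isLorentzFinsler x₀
    have hm := h.eventually_mem (hV s hs) hx
    have hm' := (hasDerivAt_affine t f s).continuousAt.eventually hm
    have h1 : deriv (coordCurve (n := n) x₀ fun s => η (t + f * s)) =ᶠ[𝓝 s]
        fun s => f • deriv (coordCurve (n := n) x₀ η) (t + f * s) := by
      filter_upwards [hm'] with r hr
      exact (((contDiffAt_coordCurve (h.contMDiffAt hr.1) hr.2).differentiableAt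
        (by simp)).hasDerivAt.scomp r (hasDerivAt_affine t f r)).deriv
    have h2 : HasDerivAt (fun s => f • deriv (coordCurve (n := n) x₀ η) (t + f * s))
        (f • f • deriv (deriv (coordCurve (n := n) x₀ η)) (t + f * s)) s :=
      (HasDerivAt.scomp (h := fun s => t + f * s) s
        (show HasDerivAt (deriv (coordCurve (n := n) x₀ η)) _ _ from
          (h.hasDerivAt_coordVelocity (hV s hs) hx).snd)
        (hasDerivAt_affine t f s)).const_smul f
    have h3 : coordVelocity (n := n) x₀ (fun s => η (t + f * s)) s
        = ((coordVelocity (n := n) x₀ η (t + f * s)).1,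
          f • (coordVelocity (n := n) x₀ η (t + f * s)).2) :=
      Prod.ext rfl h1.self_of_nhds
    rw [h1.deriv_eq, h2.deriv, h3,
      (hW.spray α).hom _ (h.coordVelocity_mem (hV s hs) hx) f hf, PiLp.smul_apply,
      PiLp.smul_apply, smul_eq_mul, smul_eq_mul]
    have h4 := h.isGeodesicOn.equation x₀ _ (hV s hs) hx α
    rw [zpow_ofNat]
    linear_combination f ^ 2 * h4

/-- `psiGeodesic` is defined by a choice of a geodesic; by uniqueness the one with initial velocity
`f • η̇(t)` is the reparametrization `s ↦ η (t + f s)`, and `ψ` is `0`-homogeneous. -/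
theorem IsUnitTimelikeGeodesic.psiGeodesic_eventuallyEq (h : S.IsUnitTimelikeGeodesic η U)
    (hψ : S.IsWeight ψ) (ht : t ∈ U) (hf : 0 < f) :
    S.psiGeodesic ψ ⟨η t, f • (velocity (n := n) η t).2⟩ =ᶠ[𝓝 0]
      fun s => psiAlong (n := n) ψ η (t + f * s) := by
  have hc : ∀ᶠ s in 𝓝 (0 : ℝ), t + f * s ∈ U :=
    (hasDerivAt_affine t f 0).continuousAt.eventually (h.isOpen.mem_nhds (by simpa using ht))
  obtain ⟨δ, hδ, hb⟩ := Metric.eventually_nhds_iff_ball.1 hc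
  rw [Real.ball_eq_Ioo, zero_sub, zero_add] at hb
  have h1 := h.isGeodesicOn_affine hf hb
  have h0 : (0 : ℝ) ∈ Ioo (-δ) δ := ⟨by linarith, hδ⟩
  have h2 : velocity (n := n) (fun s => η (t + f * s)) 0
      = ⟨η t, f • (velocity (n := n) η t).2⟩ := by
    -- The tangent spaces at `η s` and `η t` are different types until `s = t` is substituted.
    have h3 : ∀ s, s = t → (⟨η s, f • (velocity (n := n) η s).2⟩ : TangentBundle (𝓡 (n + 1)) M)
        = ⟨η t, f • (velocity (n := n) η t).2⟩ := by
      rintro _ rfl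
      rfl
    exact (h.velocity_affine (hb 0 h0)).trans (h3 _ (by simp))
  have hex : ∃ γ : ℝ → M, ∃ δ > 0, S.IsGeodesicOn γ (Ioo (-δ) δ) ∧
      velocity γ 0 = ⟨η t, f • (velocity (n := n) η t).2⟩ := ⟨_, δ, hδ, h1, h2⟩
  rw [psiGeodesic, dif_pos hex]
  obtain ⟨δ', hδ', g1, g2⟩ := hex.choose_spec
  have h3 := g1.eventuallyEq h1 isOpen_Ioo isOpen_Ioo ⟨by linarith, hδ'⟩ h0 (g2.trans h2.symm)
  filter_upwards [h3.eventuallyEq_nhds, hc] with s hs hsU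
  rw [psiAlong, psiAlong, hs.velocity_eq, h.velocity_affine hsU]
  exact hψ.homogeneous _ _ f hf
    (S.futureTimelike_subset_futureCausal (h.timelike _ hsU))

theorem IsUnitTimelikeGeodesic.deriv_psiGeodesic (h : S.IsUnitTimelikeGeodesic η U)
    (hψ : S.IsWeight ψ) (ht : t ∈ U) (hf : 0 < f) :
    deriv (S.psiGeodesic ψ ⟨η t, f • (velocity (n := n) η t).2⟩) 0
        = f * deriv (psiAlong (n := n) ψ η) t ∧
      deriv (deriv (S.psiGeodesic ψ ⟨η t, f • (velocity (n := n) η t).2⟩)) 0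
        = f ^ 2 * deriv (deriv (psiAlong (n := n) ψ η)) t := by
  have h1 := h.psiGeodesic_eventuallyEq hψ ht hf
  have hd := hψ.contDiffAt_psiAlong h.isGeodesicOn h.isOpen ht
  have hc : ∀ᶠ s in 𝓝 (0 : ℝ), t + f * s ∈ U :=
    (hasDerivAt_affine t f 0).continuousAt.eventually (h.isOpen.mem_nhds (by simpa using ht))
  have h2 : deriv (fun s => psiAlong (n := n) ψ η (t + f * s)) =ᶠ[𝓝 0]
      fun s => deriv (psiAlong (n := n) ψ η) (t + f * s) * f := by
    filter_upwards [hc] with s hs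
    exact (((hψ.contDiffAt_psiAlong h.isGeodesicOn h.isOpen hs).differentiableAt
      (by simp)).hasDerivAt.comp s (hasDerivAt_affine t f s)).deriv
  have h3 : HasDerivAt (fun s => deriv (psiAlong (n := n) ψ η) (t + f * s) * f)
      (deriv (deriv (psiAlong (n := n) ψ η)) t * f * f) 0 :=
    (HasDerivAt.comp_of_eq (0 : ℝ) ((contDiffAt_deriv (m := 1) hd
      (by norm_cast)).differentiableAt (by simp)).hasDerivAt (hasDerivAt_affine t f 0)
      (by simp)).mul_const f
  constructor
  · rw [h1.deriv_eq, h2.self_of_nhds]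
    simp only [mul_zero, add_zero, mul_comm]
  · rw [(h1.deriv.trans h2).deriv_eq, h3.deriv]
    ring

theorem ricci_smul (S : FinslerSpacetime n M) (x : M) {w : Model n} (hw : w ≠ 0) {c : ℝ}
    (hc : 0 < c) : ricci S.L ⟨x, c • w⟩ = c ^ 2 * ricci S.L ⟨x, w⟩ := by
  have hW := isCoordNondegenerate_chartDomain S.isLorentzFinsler x
  have hq := mem_chartDomain (mem_chart_source (Model n) x) hw
  have h1 : curvature S.L ⟨x, c • w⟩ = c ^ 2 • curvature S.L ⟨x, w⟩ := by
    unfold curvature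
    rw [chartAt_tangentBundle, chartAt_tangentBundle, ← map_smul]
    congr 1
    ext α β
    simp only [Matrix.of_apply, Matrix.smul_apply, map_smul]
    exact (hW.coordR α β).hom _ hq c hc
  rw [ricci, h1, tr_smul]
  rfl

end FinslerSpacetime

end LorentzFinsler

namespace LorentzFinsler

variable {n : ℕ} {M : Type*} [TopologicalSpace M] [ChartedSpace (Model n) M]
  [IsManifold (𝓡 (n + 1)) ∞ M]

/-! ### The weighted Raychaudhuri equation -/

/-- The trace of the square of a trace-free part relative to an idempotent `P` of trace `n`. -/
theorem tr_sub_smul_mul_self {B P : Model n →L[ℝ] Model n} (hn : (n : ℝ) ≠ 0) (hBP : B * P = B)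
    (hPP : P * P = P) (hP : tr P = n) :
    tr ((B - (tr B / n) • P) * (B - (tr B / n) • P)) = tr (B * B) - tr B ^ 2 / n := by
  rw [sub_mul, mul_sub, mul_sub, mul_smul_end, mul_smul_end, smul_mul_end, smul_mul_end, hBP, hPP,
    tr_sub, tr_sub, tr_sub, tr_smul, tr_smul, tr_smul, tr_smul, tr_mul_comm P B, hBP, hP]
  field_simp
  ring

namespace FinslerSpacetime

variable {S : FinslerSpacetime n M} {ψ : TangentBundle (𝓡 (n + 1)) M → ℝ} {η : ℝ → M}
  {U : Set ℝ} {t : ℝ}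
  {J : (t : ℝ) → TangentSpace (𝓡 (n + 1)) (η t) →L[ℝ] TangentSpace (𝓡 (n + 1)) (η t)}

theorem IsJacobiTensorField.tr_sigmaEps (hn : 1 ≤ n) (hJ : S.IsJacobiTensorField η U J)
    (h : S.IsUnitTimelikeGeodesic η U) (ht : t ∈ U)
    (hu : IsUnit (endAt J t + (1 - normalProj S.L (velocity η t))))
    (hψ : DifferentiableAt ℝ (psiAlong (n := n) ψ η) t) {τ : ℝ → ℝ} {f : ℝ}
    (hinv : invParam U τ (τ t) = t) (hd : HasDerivAt (invParam U τ) f (τ t)) (hf : 0 < f) :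
    tr (sigmaEps S.L ψ U τ η J t * sigmaEps S.L ψ U τ η J t)
      = f ^ 2 * (tr (covDeriv S.L η 1 J t * normalInv S.L (velocity η t) (J t)
        * (covDeriv S.L η 1 J t * normalInv S.L (velocity η t) (J t)))
        - expansion S η J t ^ 2 / n) := by
  have hn' : (n : ℝ) ≠ 0 := by positivity
  obtain ⟨-, -, -, k4⟩ := hJ.normalInv_mul h ht hu
  have h1 : tr (normalProj S.L (velocity η t)) = n :=
    tr_normalProj S.isLorentzFinsler (h.velocity_ne_zero ht) (h.L_velocity ht)
  have h2 := line_mul_line h ht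
  set P := normalProj S.L (velocity η t) with hP
  set B := covDeriv S.L η 1 J t * normalInv S.L (velocity η t) (J t) with hB
  have hBP : B * P = B := by
    rw [mul_sub, mul_one, sub_eq_zero] at k4
    rw [hB, mul_assoc, ← k4]
  have hPP : P * P = P := by
    rw [mul_sub, mul_one, sub_mul, one_mul, sub_eq_self, sub_eq_zero] at h2
    exact h2.symm
  have hσ : sigmaEps S.L ψ U τ η J t = f • (B - (tr B / n) • P) := by
    rw [sigmaEps, hJ.thetaEps_eq hn h ht hu hψ hinv hd hf, hJ.Beps_eq h ht hu hψ hinv hd hf,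
      show expansion S η J t = tr B from rfl, ← hP, ← hB]
    module
  rw [hσ, smul_mul_end, mul_smul_end, tr_smul, tr_smul,
    tr_sub_smul_mul_self hn' hBP hPP h1, show expansion S η J t = tr B from rfl]
  ring

theorem IsUnitTimelikeGeodesic.velocityStar_eq (h : S.IsUnitTimelikeGeodesic η U) (ht : t ∈ U)
    {τ : ℝ → ℝ} {f : ℝ} (hinv : invParam U τ (τ t) = t)
    (hd : HasDerivAt (invParam U τ) f (τ t)) :
    velocityStar (n := n) U τ η t = ⟨η t, f • (velocity (n := n) η t).2⟩ := by
  have h1 : ∀ s, s = t → (⟨η s, f • (velocity (n := n) η s).2⟩ : TangentBundle (𝓡 (n + 1)) M)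
      = ⟨η t, f • (velocity (n := n) η t).2⟩ := by
    -- The tangent spaces at `η s` and `η t` are different types until `s = t` is substituted.
    rintro _ rfl
    rfl
  refine (velocity_comp ?_ hd).trans (h1 _ hinv)
  rw [hinv]
  exact h.mdifferentiableAt ht

/-- The derivative of `θ_ε = f (θ - ψ_η')`, where `θ` is the unweighted expansion, in the `ε`-proper
time: it is `f` times the derivative in `t`, with `f = exp(-2(ε-1)ψ_η/n)`. -/
theorem IsJacobiTensorField.hasDerivAt_thetaEps (hn : 1 ≤ n) (hJ : S.IsJacobiTensorField η U J)
    (h : S.IsUnitTimelikeGeodesic η U) (hUc : U.OrdConnected) (ht : t ∈ U) (hψ : S.IsWeight ψ)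
    (hns : ∀ w ∈ normalSpace S.L (velocity η t), J t w = 0 → w = 0)
    {ε f : ℝ} {τ : ℝ → ℝ} (hτ : IsEpsProperTime (n := n) ψ η U ε τ)
    (hf : f = (Real.exp (2 * (ε - 1) / n * psiAlong (n := n) ψ η t))⁻¹) :
    HasDerivAt (thetaEps S.L ψ U τ η J ∘ invParam U τ)
      (f ^ 2 * (-ricci S.L (velocity η t)
        - tr (covDeriv S.L η 1 J t * normalInv S.L (velocity η t) (J t)
          * (covDeriv S.L η 1 J t * normalInv S.L (velocity η t) (J t)))
        - deriv (deriv (psiAlong (n := n) ψ η)) t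
        - 2 * (ε - 1) / n * deriv (psiAlong (n := n) ψ η) t
          * (expansion S η J t - deriv (psiAlong (n := n) ψ η) t))) (τ t) := by
  have hsm := fun s (hs : s ∈ U) => hψ.contDiffAt_psiAlong h.isGeodesicOn h.isOpen hs
  have hdiff := fun s (hs : s ∈ U) => (hsm s hs).differentiableAt (by simp)
  have hinv := fun s (hs : s ∈ U) =>
    invParam_apply h.isOpen hUc hτ (fun _ _ => Real.exp_pos _) hs
  have hd := fun s (hs : s ∈ U) =>
    hasDerivAt_invParam h.isOpen hUc hτ (fun _ _ => Real.exp_pos _) hs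
      ((hdiff s hs).continuousAt.const_mul _).rexp
  have hu := hJ.isUnit h ht hns
  have hdt := hd t ht
  have hev : ∀ᶠ s in 𝓝 t, s ∈ U ∧ IsUnit (endAt J s + (1 - normalProj S.L (velocity η s))) :=
    (show ∀ᶠ s in 𝓝 t, s ∈ U from h.isOpen.mem_nhds ht).and (hJ.eventually_isUnit h ht hu)
  have hev' : ∀ᶠ r in 𝓝 (τ t), _ := hdt.continuousAt.eventually (by rw [hinv t ht]; exact hev)
  have h1 : thetaEps S.L ψ U τ η J ∘ invParam U τ =ᶠ[𝓝 (τ t)] (fun s =>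
      Real.exp (-(2 * (ε - 1) / n * psiAlong (n := n) ψ η s))
        * (expansion S η J s - deriv (psiAlong (n := n) ψ η) s)) ∘ invParam U τ := by
    filter_upwards [hev'] with r hr
    simp only [Function.comp_apply]
    rw [hJ.thetaEps_eq hn h hr.1 hr.2 (hdiff _ hr.1) (hinv _ hr.1) (hd _ hr.1)
      (inv_pos.2 (Real.exp_pos _)), Real.exp_neg]
  have h2 : HasDerivAt (fun s => Real.exp (-(2 * (ε - 1) / n * psiAlong (n := n) ψ η s))) _ t :=
    ((hdiff t ht).hasDerivAt.const_mul (2 * (ε - 1) / n)).neg.exp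
  have h3 : HasDerivAt (fun s => expansion S η J s - deriv (psiAlong (n := n) ψ η) s) _ t :=
    (hJ.hasDerivAt_expansion h ht hns).sub ((contDiffAt_deriv (m := 1) (hsm t ht)
      (by norm_cast)).differentiableAt (by simp)).hasDerivAt
  have h4 := HasDerivAt.comp_of_eq (τ t) (h2.mul h3) hdt (hinv t ht).symm
  refine (h4.congr_of_eventuallyEq h1).congr_deriv ?_
  have h5 : Real.exp ((-fun y => 2 * (ε - 1) / n * psiAlong (n := n) ψ η y) t) = f := by
    rw [hf, ← Real.exp_neg]
    rfl
  rw [h5, ← hf, Real.exp_neg, ← hf]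
  ring

end FinslerSpacetime

end LorentzFinsler

theorem mainTheorem8 {n : ℕ} (hn : 1 ≤ n) {M : Type*} [TopologicalSpace M] [T2Space M]
    [SecondCountableTopology M] [ConnectedSpace M] [ChartedSpace (Model n) M]
    [IsManifold (𝓡 (n + 1)) ∞ M]
    (S : FinslerSpacetime n M)
    (ψ : TangentBundle (𝓡 (n + 1)) M → ℝ) (hψ : S.IsWeight ψ)
    -- `η` is a future-directed timelike geodesic of unit speed on the open interval `U`
    (η : ℝ → M) (U : Set ℝ) (hU : IsOpen U) (hUc : U.OrdConnected)
    (hη : S.IsGeodesicOn η U) (hηt : ∀ t ∈ U, velocity η t ∈ S.futureTimelike)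
    (hη1 : ∀ t ∈ U, S.F (velocity η t) = 1)
    -- `J` is a Lagrange tensor field along `η`
    (J : (t : ℝ) → TangentSpace (𝓡 (n + 1)) (η t) →L[ℝ] TangentSpace (𝓡 (n + 1)) (η t))
    (hJ : S.IsLagrangeTensorField η U J)
    -- `J` is nonsingular on `I`
    (I : Set ℝ) (hI : I ⊆ U)
    (hJI : ∀ t ∈ I, ∀ w ∈ normalSpace S.L (velocity η t), J t w = 0 → w = 0)
    -- `τ` is the `ε`-proper time
    (ε : ℝ) (τ : ℝ → ℝ) (hτ : IsEpsProperTime (n := n) ψ η U ε τ) :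
    ∀ t ∈ I,
      let θ : ℝ → ℝ := thetaEps S.L ψ U τ η J
      let σ := sigmaEps S.L ψ U τ η J
      let ψη : ℝ → ℝ := psiAlong (n := n) ψ η
      let ηs := velocityStar (n := n) U τ η t
      DifferentiableAt ℝ (θ ∘ invParam U τ) (τ t) ∧
      starDeriv U τ θ t + 2 * ε / n * starDeriv U τ ψη t * θ t + θ t ^ 2 / n
          + tr ((σ t).comp (σ t)) + S.ricciN ψ 0 ηs = 0 ∧
      (∀ N : ℝ, N ≠ 0 → N ≠ n →
        starDeriv U τ θ t + (1 - ε ^ 2 * ((N - n) / N)) * (θ t ^ 2 / n)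
          + N * (N - n) / n * (ε * θ t / N + starDeriv U τ ψη t / (N - n)) ^ 2
          + tr ((σ t).comp (σ t)) + S.ricciN ψ N ηs = 0) ∧
      starDeriv U τ θ t + (1 - ε ^ 2) * (θ t ^ 2 / n) + 1 / n * (ε * θ t + starDeriv U τ ψη t) ^ 2
          + tr ((σ t).comp (σ t)) + S.ricciInfty ψ ηs = 0 := by
  intro t htI θ σ ψη ηs
  have ht : t ∈ U := hI htI
  have h : S.IsUnitTimelikeGeodesic η U := ⟨hU, hη, hηt, hη1⟩
  have hJ' := hJ.toIsJacobiTensorField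
  have hn' : (n : ℝ) ≠ 0 := by positivity
  have hψd : DifferentiableAt ℝ (psiAlong (n := n) ψ η) t :=
    (hψ.contDiffAt_psiAlong hη hU ht).differentiableAt (by simp)
  have hinv := invParam_apply hU hUc hτ (fun _ _ => Real.exp_pos _) ht
  have hd := hasDerivAt_invParam hU hUc hτ (fun _ _ => Real.exp_pos _) ht
    (hψd.continuousAt.const_mul _).rexp
  have hu := hJ'.isUnit h ht (hJI t htI)
  have hθ' := hJ'.hasDerivAt_thetaEps hn h hUc ht hψ (hJI t htI) hτ rfl
  set f := (Real.exp (2 * (ε - 1) / n * psiAlong (n := n) ψ η t))⁻¹ with hf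
  have hf0 : 0 < f := inv_pos.2 (Real.exp_pos _)
  have hθ : θ t = f * (S.expansion η J t - deriv (psiAlong (n := n) ψ η) t) :=
    hJ'.thetaEps_eq hn h ht hu hψd hinv hd hf0
  have hσ : tr ((σ t).comp (σ t)) = _ := hJ'.tr_sigmaEps hn h ht hu hψd hinv hd hf0
  have hψs : starDeriv U τ ψη t = deriv (psiAlong (n := n) ψ η) t * f :=
    (HasDerivAt.comp_of_eq (τ t) hψd.hasDerivAt hd hinv.symm).deriv
  have hηs : ηs = _ := h.velocityStar_eq ht hinv hd
  have hψ1 : deriv (S.psiGeodesic ψ ηs) 0 = f * deriv (psiAlong (n := n) ψ η) t := by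
    rw [hηs]
    exact (h.deriv_psiGeodesic hψ ht hf0).1
  have hψ2 : deriv (deriv (S.psiGeodesic ψ ηs)) 0
      = f ^ 2 * deriv (deriv (psiAlong (n := n) ψ η)) t := by
    rw [hηs]
    exact (h.deriv_psiGeodesic hψ ht hf0).2
  have hric : ricci S.L ηs = f ^ 2 * ricci S.L (velocity η t) :=
    (congrArg _ hηs).trans (S.ricci_smul (η t) (h.velocity_ne_zero ht) hf0)
  have hθs : starDeriv U τ θ t = _ := hθ'.deriv
  -- After these substitutions the terms with the trace of the square of `J' J⁻¹` and with the Ricci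
  -- curvature cancel, and polynomial identities in the expansion, `f` and the derivatives of `ψ_η`
  -- are left.
  refine ⟨hθ'.differentiableAt, ?_, fun N hN0 hNn => ?_, ?_⟩
  · rw [hθs, hψs, hθ, hσ, FinslerSpacetime.ricciN, hψ1, hψ2, hric]
    field_simp
    ring
  · have hNn' : N - n ≠ 0 := sub_ne_zero.2 hNn
    rw [hθs, hψs, hθ, hσ, FinslerSpacetime.ricciN, hψ1, hψ2, hric]
    field_simp
    ring
  · rw [hθs, hψs, hθ, hσ, FinslerSpacetime.ricciInfty, hψ2, hric]
    field_simp
    ring
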